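/- **Setting.** Fix a dimension $d\ge 1$, real numbers $q>2$ and $0<\gamma_1<q-2$. Let $g_1,g_2\in[-1,1]$, $M>0$, $r\in\mathbb N$, $a\in\mathbb Z$, let $\Lambda\subset\mathbb Z^d$ be finite, and put $\delta=M^{-\gamma_1}$. $|\cdot|$ is the Euclidean norm for vectors, and the cardinality for finite sets; $x\sim x'$ means $|x-x'|=1$; a set of sites is connected if it is non-empty and connected through $\sim$; all sites lie in $\Lambda$. For $A\subset\Lambda$ let $\Omega_A=\{n\in\mathbb N: n\le M\}^A$. Operators act on $\ell^2(\Omega_\Lambda)$, i.e. on the image of $\mathbb 1_{\le M}=\otimes_{x}\chi(N_x\le M)$ (operators with occupation cutoff $M$), and operators on $\ell^2(\Omega_A)$ are identified with their tensor products with the identity; $s(O)\subset A$ means that $O$ is of this form. $P_\eta$ is the projection on $\delta_\eta$; $E_A(\eta)=\sum_{x\in A}\eta(x)^q$. $\|\cdot\|$ is the operator norm, $\mathrm{tr}^{(M)}(O)=\mathrm{Tr}(O)/\mathrm{Tr}(\mathbb 1_{\le M})$ and $\|O\|_{\mathrm{tr}^{(M)}}^2=\mathrm{tr}^{(M)}(O^*O)$.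 **Potentials.** With the bosonic operators $a_x,a^*_x$ and $N_x=a_x^*a_x$, let $$H_x=N_x^q+V_x,\qquad V_x=g_1(a_x+a_x^*)^2+\tfrac12\sum_{x'\sim x}g_2(a_x^*a_{x'}+a_xa_{x'}^*),$$ and let $\mathcal P_{\le M}(O)=\mathbb 1_{\le M}O\,\mathbb 1_{\le M}$. A potential is a map $A\mapsto\mathscr A(A)$ from subsets of $\Lambda$ to operators supported in $A$. Let $\mathscr E_0(\{x\})=\mathcal P_{\le M}(N_x^q)$ and $\mathscr E_0(A)=0$ if $|A|\ne1$; let $\mathscr E(A)=\mathscr E_0(A)+\sum_{x:\,\{x'\in\Lambda:|x'-x|\le 1\}=A}\mathcal P_{\le M}(V_x)$, so that $\sum_A\mathscr E(A)=\sum_x\mathcal P_{\le M}(H_x)$. Put $[\mathscr A,\mathscr B](A)=\sum_{A_1\cup A_2=A}[\mathscr A(A_1),\mathscr B(A_2)]$, $\mathrm{ad}_{\mathscr A}(\mathscr B)=[\mathscr A,\mathscr B]$, $e^{\mathrm{ad}_{\mathscr A}}=\sum_n \mathrm{ad}^n_{\mathscr A}/n!$. $\mathcal P_{\mathrm{Res}}$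 (resp. $\mathcal P_{\mathrm{NRes}}$) keeps in $\mathscr A(A)$ the matrix elements $\langle\eta,\cdot\,\eta'\rangle$ with $|E_A(\eta)-E_A(\eta')|\le\delta^{-1}M$ (resp. $>\delta^{-1}M$). Define $\mathscr H^{(0)}=\mathscr E$ and $\mathscr H^{(j+1)}=e^{\mathrm{ad}_{\mathscr K^{(j+1)}}}(\mathscr H^{(j)})$, where $\langle\eta,\mathscr K^{(j+1)}(A)\eta'\rangle=\langle\eta,\mathcal P_{\mathrm{NRes}}(\mathscr H^{(j)}-\mathscr E_0)(A)\eta'\rangle/(E_A(\eta)-E_A(\eta'))$ (and $0$ if the denominator vanishes), and $\mathscr G=\mathcal P_{\mathrm{Res}}(\mathscr H^{(r)}-\mathscr E_0)$. Let $\mathcal R_r$ keep only sets with $|A|\le r$ and matrix elements with $|\eta_A-\eta'_A|\le r$, let $\mathcal D$ keep only diagonal matrix elements, and put $\mathscr D=\mathcal D\mathcal R_r(\mathscr E_0+\mathscr G)$, $\hat{\mathscr G}=(1-\mathcal D)\mathcal R_r(\mathscr G)$. **Moves and partition.** Let $\mathbb S=\{x\in\Lambda:|x_1-a|<r^2\}$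 and, for $y\in\mathbb Z^{d-1}$, $B_y=\{x\in\mathbb S:|x-(a,y)|\le2r^2\}$. For $V\subset\mathbb S$, $\mathcal P^{(V)}$ is the set of $\rho\in\mathbb Z^V$ (extended by $0$) with $1\le|\rho|\le r$ whose support $s(\rho)=\{x:\rho(x)\ne0\}$ has at most $r$ points and lies in some connected $A\subset\mathbb S$ with $|A|\le r$; $S(\rho)$ is the union of all such $A$. Let $W_\rho=\sum_{A\subset\mathbb S}\sum_\eta P_\eta\hat{\mathscr G}(A)P_{\eta+\rho}$. On $\Omega_V$ write $\eta\sim_\rho\eta'$ if $\eta'-\eta=\pm\rho$ and $|E_V(\eta)-E_V(\eta')|\le M^{1+\gamma_1}$; $\mathcal F^{(V)}$ is the set of connected components $\mu$ of $\Omega_V$ for the adjacency "$\eta\sim_\rho\eta'$ for some $\rho\in\mathcal P^{(V)}$", $P_\mu=\sum_{\eta\in\mu}P_\eta$, and $\mathcal P^{(V)}(\mu)$ is the set of $\rho\in\mathcal P^{(V)}$ with $\eta\sim_\rho\eta'$ for some $\eta,\eta'\in\mu$. **Splitting.** For $\mu\in\mathcal F^{(B_y)}$ let $K_1,K_2,\dots$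 be the connected components (through non-empty intersections) of the collection $\{S(\rho)\cap B_y:\rho\in\mathcal P^{(B_y)}(\mu)\}$, and let $\mathrm L(\mu)=\{x\in B_y:x_1\le a\}\cup\bigcup_{j:K_j\cap\{x_1\le a\}\ne\emptyset}K_j$. Choose, arbitrarily, for every non-empty $A\subset\mathbb S$ with $|A|\le r$ a point $y(A)$ in the projection of $A$ to the last $d-1$ coordinates. Define $$Z_{\mathrm L,y}=\sum_{\mu\in\mathcal F^{(B_y)}}P_\mu\Big(\sum_{A\subset\mathbb S:\,y(A)=y,\,A\subset\mathrm L(\mu)}\mathscr D(A)+\sum_{\rho\in\mathcal P^{(\mathbb S)}:\,y(s(\rho))=y,\,s(\rho)\subset\mathrm L(\mu)}W_\rho\Big),$$ and $Z_{\mathrm R,y}$ by the same formula with $\not\subset\mathrm L(\mu)$ in place of $\subset\mathrm L(\mu)$ (the sums over $A$ run over $|A|\le r$, since $\mathscr D(A)=0$ otherwise). **Proposition.** There are constants $C,c>0$ and $r_0$, depending only on $d,q,\gamma_1$, such that for every integer $r\ge r_0$ there are $C(r),M_0(r)>0$ (depending only on $d,q,\gamma_1,r$) such that for all $M\ge M_0(r)$,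 all $|g_1|,|g_2|\le1$, all finite $\Lambda$, all $a\in\mathbb Z$, all choices of $y(\cdot)$, and all $y,y'\in\mathbb Z^{d-1}$: 1. $s(Z_{\mathrm L,y}),s(Z_{\mathrm R,y})\subset B_y$, and $\|Z_{\mathrm L,y}\|\le C(r)M^C$, $\|Z_{\mathrm R,y}\|\le C(r)M^C$; 2. $\|[Z_{\mathrm L,y},Z_{\mathrm R,y'}]\|_{\mathrm{tr}^{(M)}}\le C(r)M^{C-cr}$; 3. for every operator $O_{\mathrm R}$ with occupation cutoff $M$ whose support lies in $\{x_1>a+r^2/2\}$, $\|[Z_{\mathrm L,y},O_{\mathrm R}]\|_{\mathrm{tr}^{(M)}}\le C(r)M^{C-cr}\|O_{\mathrm R}\|$; for every operator $O_{\mathrm L}$ with occupation cutoff $M$ whose support lies in $\{x_1<a-r^2/2\}$, $\|[Z_{\mathrm R,y},O_{\mathrm L}]\|_{\mathrm{tr}^{(M)}}\le C(r)M^{C-cr}\|O_{\mathrm L}\|$. -/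

import Mathlib

namespace ResonantSplitting

/-- The lattice `ℤ^d` with `d = k + 1`; the first coordinate is `x 0`. -/
abbrev Site (k : ℕ) := Fin (k + 1) → ℤ

/-- The Euclidean norm of an integer vector. -/
noncomputable def eucl {ι : Type*} [Fintype ι] (v : ι → ℤ) : ℝ :=
  Real.sqrt (∑ i, (v i : ℝ) ^ 2)

/-- The parameters of the model: the on-site exponent `q`, the resonance exponent `γ`
(the resonance threshold is `δ = M ^ (-γ)`), the couplings `g₁, g₂`, the occupation cutoff `M`,
the order `r`, the position `a` of the hyperplane `{x | x₁ = a}`, and the finite volume `Λ`. -/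
structure Setup (k : ℕ) where
  q : ℝ
  γ : ℝ
  g₁ : ℝ
  g₂ : ℝ
  M : ℝ
  r : ℕ
  a : ℤ
  Λ : Finset (Site k)

variable {k : ℕ}

namespace Setup

/-- Sites of the volume `Λ`. -/
abbrev Pt (S : Setup k) := {x : Site k // x ∈ S.Λ}

/-- Occupation numbers `0, 1, …, ⌊M⌋` allowed by the cutoff. -/
abbrev Lvl (S : Setup k) := Fin (⌊S.M⌋₊ + 1)

/-- The cut-off phase space `Ω_Λ^{(M)}`. -/
abbrev Conf (S : Setup k) := S.Pt → S.Lvl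

/-- Operators on the cut-off space `ℓ²(Ω_Λ^{(M)})`, by their matrix elements `⟨η, O η'⟩`.
An operator on a subvolume `A` is identified with its tensor product with the identity. -/
abbrev Op (S : Setup k) := Matrix S.Conf S.Conf ℂ

/-- Families of operators indexed by the subsets of `Λ` (interaction potentials). -/
abbrev Pot (S : Setup k) := Finset S.Pt → S.Op

/-- The cut-off phase space `Ω_V^{(M)}` of a subvolume `V`. -/
abbrev VConf (S : Setup k) (V : Finset S.Pt) := {x : S.Pt // x ∈ V} → S.Lvl

/-- The restriction `η_V`. -/
def restrict (S : Setup k) (V : Finset S.Pt) (η : S.Conf) : S.VConf V := fun x => η x.1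

open Classical in
/-- `s(O) ⊆ A`: the operator `O` has the form `T ⊗ 1` with `T` acting on the sites of `A`. -/
def SupportedIn (S : Setup k) (A : Finset S.Pt) (O : S.Op) : Prop :=
  ∃ T : Matrix (S.VConf A) (S.VConf A) ℂ, ∀ η η' : S.Conf,
    O η η' = if ∀ x, x ∉ A → η x = η' x then T (S.restrict A η) (S.restrict A η') else 0

/-- The operator norm on `ℓ²(Ω_Λ^{(M)})`. -/
noncomputable def opNorm (S : Setup k) (O : S.Op) : ℝ :=
  ‖Matrix.toEuclideanCLM (n := S.Conf) (𝕜 := ℂ) O‖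

/-- The normalized trace `tr^{(M)}(O) = Tr O / Tr 1_{≤ M}`. -/
noncomputable def normTrace (S : Setup k) (O : S.Op) : ℂ :=
  Matrix.trace O / (Fintype.card S.Conf : ℂ)

/-- The normalized Hilbert–Schmidt norm, `‖O‖² = tr^{(M)}(O* O)`. -/
noncomputable def hsNorm (S : Setup k) (O : S.Op) : ℝ :=
  Real.sqrt (S.normTrace (O.conjTranspose * O)).re

/-- The commutator of two operators. -/
noncomputable def comm (S : Setup k) (O₁ O₂ : S.Op) : S.Op := O₁ * O₂ - O₂ * O₁

/-! ### The Hamiltonian without cutoff, on finite linear combinations of the `δ_η` -/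

/-- Finite linear combinations of the number states `δ_η`, `η ∈ ℕ^Λ` (no cutoff). -/
abbrev Fock (S : Setup k) := (S.Pt → ℕ) →₀ ℂ

/-- The annihilation operator `a_x`: `a_x δ_η = √η(x) δ_{η - e_x}`. -/
noncomputable def lower (S : Setup k) (x : S.Pt) : Module.End ℂ S.Fock :=
  Finsupp.lsum ℂ fun η : S.Pt → ℕ =>
    ((Real.sqrt (η x : ℝ) : ℝ) : ℂ) • Finsupp.lsingle (Function.update η x (η x - 1))

/-- The creation operator `a_x^*`: `a_x^* δ_η = √(η(x) + 1) δ_{η + e_x}`. -/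
noncomputable def raise (S : Setup k) (x : S.Pt) : Module.End ℂ S.Fock :=
  Finsupp.lsum ℂ fun η : S.Pt → ℕ =>
    ((Real.sqrt ((η x : ℝ) + 1) : ℝ) : ℂ) • Finsupp.lsingle (Function.update η x (η x + 1))

/-- The power `N_x^q` of the number operator `N_x = a_x^* a_x`. -/
noncomputable def numPow (S : Setup k) (x : S.Pt) : Module.End ℂ S.Fock :=
  Finsupp.lsum ℂ fun η : S.Pt → ℕ =>
    ((((η x : ℝ) ^ S.q : ℝ)) : ℂ) • Finsupp.lsingle η

/-- Nearest neighbours in `Λ`. -/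
noncomputable def nnGraph (S : Setup k) : SimpleGraph S.Pt :=
  SimpleGraph.fromRel fun x z => eucl (x.1 - z.1) = 1

open Classical in
/-- `H_x - N_x^q`, i.e. `g₁ (a_x + a_x^*)² + ½ ∑_{z ∼ x} g₂ (a_x^* a_z + a_x a_z^*)`. -/
noncomputable def siteInteraction (S : Setup k) (x : S.Pt) : Module.End ℂ S.Fock :=
  (S.g₁ : ℂ) • (S.lower x + S.raise x) ^ 2 +
    (1 / 2 : ℂ) • ∑ z : S.Pt, if S.nnGraph.Adj x z then
      (S.g₂ : ℂ) • (S.raise x * S.lower z + S.lower x * S.raise z) else 0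

/-- The energy cutoff: the matrix elements of an operator between cut-off configurations. -/
noncomputable def cutoff (S : Setup k) (T : Module.End ℂ S.Fock) : S.Op :=
  Matrix.of fun η η' : S.Conf =>
    T (Finsupp.single (fun x => (η' x : ℕ)) 1) (fun x => (η x : ℕ))

/-! ### Interaction potentials and the perturbative diagonalization -/

open Classical in
/-- The star `{z ∈ Λ : |z - x| ≤ 1}`. -/
noncomputable def star (S : Setup k) (x : S.Pt) : Finset S.Pt :=
  Finset.univ.filter fun z => eucl (z.1 - x.1) ≤ 1

/-- The potential of the free Hamiltonian: `N_x^q` (cut off) at `{x}`. -/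
noncomputable def freePot (S : Setup k) : S.Pot := fun A =>
  ∑ x : S.Pt, if A = {x} then S.cutoff (S.numPow x) else 0

/-- The potential of the full Hamiltonian: `N_x^q` at `{x}`, and `H_x - N_x^q` at the star of `x`
(all cut off). The potentials sum up to the sum of the cut-off `H_x`. -/
noncomputable def fullPot (S : Setup k) : S.Pot := fun A =>
  S.freePot A + ∑ x : S.Pt, if A = S.star x then S.cutoff (S.siteInteraction x) else 0

/-- The free energy `E_A(η) = ∑_{x ∈ A} η(x)^q`. -/
noncomputable def energy (S : Setup k) (A : Finset S.Pt) (η : S.Conf) : ℝ :=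
  ∑ x ∈ A, ((η x : ℕ) : ℝ) ^ S.q

/-- The resonance threshold `δ = M ^ (-γ)`. -/
noncomputable def thr (S : Setup k) : ℝ := S.M ^ (-S.γ)

open Classical in
/-- The resonant part of a potential. -/
noncomputable def res (S : Setup k) (B : S.Pot) : S.Pot := fun A =>
  Matrix.of fun η η' =>
    if |S.energy A η - S.energy A η'| ≤ S.thr⁻¹ * S.M then B A η η' else 0

open Classical in
/-- The nonresonant part of a potential. -/
noncomputable def nres (S : Setup k) (B : S.Pot) : S.Pot := fun A =>
  Matrix.of fun η η' =>
    if S.thr⁻¹ * S.M < |S.energy A η - S.energy A η'| then B A η η' else 0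

/-- The commutator `ad_K(B)` of potentials:
`[K, B](A) = ∑_{A₁ ∪ A₂ = A} [K(A₁), B(A₂)]`. -/
noncomputable def potAd (S : Setup k) (K B : S.Pot) : S.Pot := fun A =>
  ∑ p : Finset S.Pt × Finset S.Pt,
    if p.1 ∪ p.2 = A then S.comm (K p.1) (B p.2) else 0

/-- `e^{ad_K}(B) = ∑_n ad_K^n(B) / n!`; for every `A` the series converges absolutely. -/
noncomputable def expAd (S : Setup k) (K B : S.Pot) : S.Pot := fun A =>
  ∑' n : ℕ, ((n.factorial : ℂ))⁻¹ • ((S.potAd K)^[n] B) A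

/-- The generator that removes the nonresonant part `F` of `H - E₀` to first order:
`⟨η, K(A) η'⟩ = ⟨η, F(A) η'⟩ / (E_A(η) - E_A(η'))`, so that `[K, E₀] = -F`. -/
noncomputable def generator (S : Setup k) (H : S.Pot) : S.Pot := fun A =>
  Matrix.of fun η η' =>
    S.nres (H - S.freePot) A η η' / ((S.energy A η - S.energy A η' : ℝ) : ℂ)

/-- The transformed potential after `j` steps,
`e^{ad_{K_j}} ⋯ e^{ad_{K_1}} (E) = E₀ + F_j + G_j`. -/
noncomputable def transformed (S : Setup k) : ℕ → S.Pot
  | 0 => S.fullPot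
  | j + 1 => S.expAd (S.generator (S.transformed j)) (S.transformed j)

/-- The resonant potential `G` after `r` steps. -/
noncomputable def resonantPot (S : Setup k) : S.Pot :=
  S.res (S.transformed S.r - S.freePot)

/-- The diagonal part of a potential in the number basis. -/
noncomputable def diagPart (S : Setup k) (B : S.Pot) : S.Pot := fun A =>
  Matrix.diagonal fun η => B A η η

open Classical in
/-- Restriction to the terms of range at most `n`, in space and in the number basis. -/
noncomputable def rangeCut (S : Setup k) (n : ℕ) (B : S.Pot) : S.Pot := fun A =>
  Matrix.of fun η η' =>
    if A.card ≤ n ∧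
        eucl (fun x : {x : S.Pt // x ∈ A} => ((η x.1 : ℕ) : ℤ) - ((η' x.1 : ℕ) : ℤ)) ≤ n
    then B A η η' else 0

/-- The diagonal short-range potential `D`. -/
noncomputable def dPot (S : Setup k) : S.Pot :=
  S.diagPart (S.rangeCut S.r (S.freePot + S.resonantPot))

/-- The off-diagonal short-range resonant potential `Ĝ`. -/
noncomputable def gPot (S : Setup k) : S.Pot :=
  S.rangeCut S.r S.resonantPot - S.diagPart (S.rangeCut S.r S.resonantPot)

/-! ### Strip, balls, moves -/

/-- The strip `{x ∈ Λ : |x₁ - a| < r²}`. -/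
def strip (S : Setup k) : Finset S.Pt :=
  Finset.univ.filter fun x => |x.1 0 - S.a| < (S.r : ℤ) ^ 2

open Classical in
/-- The ball `B_y = {x : |x - (a, y)| ≤ 2 r²} ∩ strip`. -/
noncomputable def ball (S : Setup k) (y : Fin k → ℤ) : Finset S.Pt :=
  S.strip.filter fun x =>
    eucl (x.1 - (Fin.cons S.a y : Site k)) ≤ 2 * (S.r : ℝ) ^ 2

/-- Connected sets of sites. -/
def Conn (S : Setup k) (A : Finset S.Pt) : Prop :=
  (S.nnGraph.induce (A : Set S.Pt)).Connected

/-- The support `s(ρ)` of a move. -/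
def moveSupp (S : Setup k) (ρ : S.Pt → ℤ) : Finset S.Pt :=
  Finset.univ.filter fun x => ρ x ≠ 0

/-- `A` is a connected subset of the strip with at most `r` sites that contains `s(ρ)`. -/
def Hosts (S : Setup k) (A : Finset S.Pt) (ρ : S.Pt → ℤ) : Prop :=
  A ⊆ S.strip ∧ S.Conn A ∧ A.card ≤ S.r ∧ S.moveSupp ρ ⊆ A

open Classical in
/-- The moves in `V`: vectors `ρ ∈ ℤ^V` (extended by zero) with `1 ≤ |ρ| ≤ r` whose support has at
most `r` points and fits in a connected subset of the strip with at most `r` sites. -/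
noncomputable def moves (S : Setup k) (V : Finset S.Pt) : Finset (S.Pt → ℤ) :=
  (Fintype.piFinset fun _ : S.Pt => Finset.Icc (-(S.r : ℤ)) (S.r : ℤ)).filter fun ρ =>
    1 ≤ eucl ρ ∧ eucl ρ ≤ S.r ∧ S.moveSupp ρ ⊆ V ∧ (S.moveSupp ρ).card ≤ S.r ∧
      ∃ A, S.Hosts A ρ

open Classical in
/-- The dependence set `S(ρ)`: the union of all connected `A ⊆ strip` with `|A| ≤ r` and
`s(ρ) ⊆ A`. -/
noncomputable def depSet (S : Setup k) (ρ : S.Pt → ℤ) : Finset S.Pt :=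
  Finset.univ.filter fun x => ∃ A, S.Hosts A ρ ∧ x ∈ A

open Classical in
/-- The move operator `W_ρ = ∑_{A ⊆ strip} ∑_η P_η Ĝ(A) P_{η + ρ}`. -/
noncomputable def moveOp (S : Setup k) (ρ : S.Pt → ℤ) : S.Op :=
  Matrix.of fun η η' =>
    if ∀ x, ((η' x : ℕ) : ℤ) = ((η x : ℕ) : ℤ) + ρ x
    then ∑ A ∈ S.strip.powerset, S.gPot A η η' else 0

/-! ### The partition of phase space -/

/-- The relation `η ∼_ρ η'` on `Ω_V^{(M)}`. -/
def Linked (S : Setup k) (V : Finset S.Pt) (ρ : S.Pt → ℤ) (η η' : S.VConf V) : Prop :=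
  ((∀ x, ((η' x : ℕ) : ℤ) - ((η x : ℕ) : ℤ) = ρ x.1) ∨
    (∀ x, ((η' x : ℕ) : ℤ) - ((η x : ℕ) : ℤ) = -ρ x.1)) ∧
  |(∑ x, ((η x : ℕ) : ℝ) ^ S.q) - ∑ x, ((η' x : ℕ) : ℝ) ^ S.q| ≤ S.M ^ (1 + S.γ)

/-- The adjacency `η ∼ η'`: `η ∼_ρ η'` for some move `ρ` in `V`. -/
def resGraph (S : Setup k) (V : Finset S.Pt) : SimpleGraph (S.VConf V) :=
  SimpleGraph.fromRel fun η η' => ∃ ρ ∈ S.moves V, S.Linked V ρ η η'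

/-- The partition `𝓕^{(V)}` of `Ω_V^{(M)}` into connected components. -/
abbrev Comp (S : Setup k) (V : Finset S.Pt) := (S.resGraph V).ConnectedComponent

noncomputable instance (S : Setup k) (V : Finset S.Pt) : Fintype (S.Comp V) :=
  Fintype.ofFinite _

open Classical in
/-- The projection `P_μ = ∑_{η ∈ μ} P_η` (tensored with the identity outside `V`). -/
noncomputable def proj (S : Setup k) {V : Finset S.Pt} (μ : S.Comp V) : S.Op :=
  Matrix.diagonal fun η => if S.restrict V η ∈ μ.supp then 1 else 0

/-- The set `𝓟^{(V)}(μ)` of moves that are active in the component `μ`. -/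
def activeMoves (S : Setup k) {V : Finset S.Pt} (μ : S.Comp V) : Set (S.Pt → ℤ) :=
  {ρ | ρ ∈ S.moves V ∧ ∃ η ∈ μ.supp, ∃ η' ∈ μ.supp, S.Linked V ρ η η'}

/-! ### The left-right splitting -/

/-- The connected components of a collection of sets: unions of the maximal subcollections that
are connected through non-empty intersections. -/
def clusters {α : Type*} (coll : Set (Set α)) : Set (Set α) :=
  {K | ∃ s ∈ coll, K = ⋃₀ {t | Relation.ReflTransGen
    (fun u v => u ∈ coll ∧ v ∈ coll ∧ (u ∩ v).Nonempty) s t}}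

/-- The collection `{S(ρ) ∩ B_y : ρ ∈ 𝓟^{(y)}(μ)}`. -/
def spots (S : Setup k) {y : Fin k → ℤ} (μ : S.Comp (S.ball y)) : Set (Set S.Pt) :=
  {s | ∃ ρ ∈ S.activeMoves μ, s = {x | x ∈ S.depSet ρ ∧ x ∈ S.ball y}}

open Classical in
/-- The left region `L(μ) ⊆ B_y`: the naive left half together with all clusters of resonant
spots that meet it. -/
noncomputable def leftRegion (S : Setup k) {y : Fin k → ℤ} (μ : S.Comp (S.ball y)) :
    Finset S.Pt :=
  (S.ball y).filter fun x => x.1 0 ≤ S.a ∨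
    ∃ K ∈ clusters (S.spots μ), (∃ z ∈ K, z.1 0 ≤ S.a) ∧ x ∈ K

/-- `yc` assigns to every non-empty subset `A` of the strip with at most `r` sites a point of the
projection of `A` to the last `d - 1` coordinates. -/
def Assigns (S : Setup k) (yc : Finset S.Pt → (Fin k → ℤ)) : Prop :=
  ∀ A : Finset S.Pt, A.Nonempty → A ⊆ S.strip → A.card ≤ S.r →
    ∃ x ∈ A, yc A = Fin.tail x.1

/-- The left part `Z_{L,y}` of the resonant Hamiltonian of the strip. -/
noncomputable def zLeft (S : Setup k) (yc : Finset S.Pt → (Fin k → ℤ)) (y : Fin k → ℤ) : S.Op :=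
  ∑ μ : S.Comp (S.ball y), S.proj μ *
    ((∑ A ∈ S.strip.powerset with yc A = y ∧ A ⊆ S.leftRegion μ, S.dPot A) +
      ∑ ρ ∈ S.moves S.strip with yc (S.moveSupp ρ) = y ∧ S.moveSupp ρ ⊆ S.leftRegion μ,
        S.moveOp ρ)

/-- The right part `Z_{R,y}` of the resonant Hamiltonian of the strip. -/
noncomputable def zRight (S : Setup k) (yc : Finset S.Pt → (Fin k → ℤ)) (y : Fin k → ℤ) : S.Op :=
  ∑ μ : S.Comp (S.ball y), S.proj μ *
    ((∑ A ∈ S.strip.powerset with yc A = y ∧ ¬ A ⊆ S.leftRegion μ, S.dPot A) +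
      ∑ ρ ∈ S.moves S.strip with yc (S.moveSupp ρ) = y ∧ ¬ S.moveSupp ρ ⊆ S.leftRegion μ,
        S.moveOp ρ)

end Setup

end ResonantSplitting

/-!
The operators `Z_L` and `Z_R` are sums of short-range terms: diagonal terms `D(A)` and moves `W_ρ`. Each is
multiplied by an indicator, deciding whether the term counts as left or right, that depends on the
component `μ` of the configuration in `B_y`. The argument has three ingredients.

*Perturbation theory.* The commutator of the generator with the free potential cancels the nonresonant part
exactly (`potAd_freePot`), so each step of the diagonalization preserves locality and a bound of the form
`c M ^ (1 + γ) w ^ |A|` with `w = M ^ (-γ / 3 ^ d)` (`exists_bound_transformed`), the interaction living on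
stars of at most `3 ^ d` sites. For fixed `r` only sets with `|A| ≤ r` matter, hence crude combinatorial
constants suffice. `PotBounds` collects the outcome for `D` and `Ĝ`.

*Bad configurations are rare.* Call `η` good for `y` if the clusters of resonant spots in `B_y` have diameter
less than about `r ^ 2 / (8 d)` (`Good`). A larger cluster is a chain of dependence sets of diameter `2 r` and
hence contains at least `r / (32 d)` active moves with disjoint supports (`exists_disjoint_act`). A move `ρ`
active somewhere in the component of `η` satisfies `|ρ · ω(η)| ≤ B M ^ max (1 + γ) (q - 2)` at `η` itself,
with the frequencies `ω(t) = t ^ (q - 1)` (`exists_act_resonant`). This rests on a Nekhoroshev-type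
confinement (`exists_drift_bound`): in frequency space, a walk with resonant steps stays within a
constant multiple of the resonance width. Convexity enters only through the monotonicity of `ω`: the
frequency drift has the signs of the displacement, which lies in the span of the vectors used. Each such
condition pins one occupation number to a fraction `M ^ (-gap q γ)` of the levels, and conditions with
disjoint supports are independent (`exists_card_not_good_le`).

*Locality of the splitting.* Whether a move is active only depends on the configuration on its cluster
(`act_transfer`). At good configurations the left regions for `y` and `y'` therefore agree near both points
(`Good.mem_leftRegion_iff`), do not change when a term acts (`mem_leftRegion_iff_of_moveOp_ne_zero`),
contain the dependence set of an active move entirely or not at all (`mem_leftRegion_iff_of_mem_act`), and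
deviate from the half space by at most `r ^ 2 / 8`. So, outside rare rows, a left term and a right term act on
disjoint sets or commute, with one exception: a left move `ρ` and a right diagonal term `D(A)` where `A`
meets `s(ρ)` without being part of the dependence set of `ρ`. Then `A` and any set hosting `ρ` together have
more than `r` sites, and the product of the two terms is of order `w ^ r` (`norm_comm_moveOp_dPot_le`).
Likewise the selection can be read off from the region at distance at most `r ^ 2 / 2` from the
half space, up to rare rows, which gives the commutators with distant operators (`hsNorm_comm_select_le`).
As every term has one matrix element per row, rare rows contribute a small Hilbert–Schmidt norm
(`hsNorm_sum_le`).
-/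

namespace ResonantSplitting

/-! ### Drift of resonant walks -/

/-- For one finite set `s` of integer vectors and one sign pattern: a vector `θ` with the signs of an
element of the real span of `s` is controlled by its pairings with `s`. The point is that a single
representative `w₀` of the sign pattern can be used for all `θ`: `∑ w₀ θ = ∑ |w₀| |θ|`. -/
theorem exists_bound_of_sign {ι : Type*} [Fintype ι] (s : Finset (ι → ℤ)) (p : ι → SignType) :
    ∃ C : ℝ, ∀ (c : (ι → ℤ) → ℝ) (θ : ι → ℝ) (e : ℝ),
      (∀ x, SignType.sign (∑ ρ ∈ s, c ρ * ρ x) = p x) → (∀ x, SignType.sign (θ x) = p x) →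
      (∀ ρ ∈ s, |∑ x, (ρ x : ℝ) * θ x| ≤ e) → 0 ≤ e → ∀ x, |θ x| ≤ C * e := by
  by_cases h : ∃ c : (ι → ℤ) → ℝ, ∀ x, SignType.sign (∑ ρ ∈ s, c ρ * (ρ x : ℝ)) = p x
  swap
  · exact ⟨0, fun c θ e hc => absurd ⟨c, hc⟩ h⟩
  obtain ⟨c, hc⟩ := h
  set w : ι → ℝ := fun x => ∑ ρ ∈ s, c ρ * (ρ x : ℝ) with hw
  refine ⟨∑ x, (∑ ρ ∈ s, |c ρ|) / |w x|, fun c' θ e _ hθ he he0 x => ?_⟩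
  have hnn : ∀ x, 0 ≤ w x * θ x := by
    intro x
    have h1 : SignType.sign (w x * θ x) = p x * p x := by
      rw [sign_mul, hc x, hθ x]
    rw [← sign_nonneg_iff, h1]
    rcases p x with _ | _ | _ <;> decide
  have hsum : ∑ x, w x * θ x ≤ (∑ ρ ∈ s, |c ρ|) * e := by
    have : ∑ x, w x * θ x = ∑ ρ ∈ s, c ρ * ∑ x, (ρ x : ℝ) * θ x := by
      simp only [hw, Finset.sum_mul, Finset.mul_sum]
      rw [Finset.sum_comm]
      exact Finset.sum_congr rfl fun _ _ => Finset.sum_congr rfl fun _ _ => by ring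
    rw [this, Finset.sum_mul]
    refine Finset.sum_le_sum fun ρ hρ => (le_abs_self _).trans ?_
    rw [abs_mul]
    exact mul_le_mul_of_nonneg_left (he ρ hρ) (abs_nonneg _)
  have hterm : w x * θ x ≤ (∑ ρ ∈ s, |c ρ|) * e :=
    (Finset.single_le_sum (fun y _ => hnn y) (Finset.mem_univ x)).trans hsum
  have hdiv : ∀ y, 0 ≤ (∑ ρ ∈ s, |c ρ|) / |w y| := fun y => by positivity
  by_cases hwx : w x = 0
  · have : θ x = 0 := by
      rw [← sign_eq_zero_iff, hθ x, ← hc x]; simpa [hw] using hwx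
    rw [this, abs_zero]
    exact mul_nonneg (Finset.sum_nonneg fun y _ => hdiv y) he0
  · have hpos : 0 < |w x| := abs_pos.2 hwx
    have h2 : |θ x| ≤ (∑ ρ ∈ s, |c ρ|) / |w x| * e := by
      rw [div_mul_eq_mul_div, le_div_iff₀ hpos, mul_comm, ← abs_mul, abs_of_nonneg (hnn x)]
      exact hterm
    exact h2.trans (mul_le_mul_of_nonneg_right
      (Finset.single_le_sum (fun y _ => hdiv y) (Finset.mem_univ x)) he0)

/-- The vectors with entries in `[-R, R]`. -/
noncomputable def box (ι : Type*) [Fintype ι] [DecidableEq ι] (R : ℕ) : Finset (ι → ℤ) :=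
  Fintype.piFinset fun _ => Finset.Icc (-(R : ℤ)) R

theorem mem_box {ι : Type*} [Fintype ι] [DecidableEq ι] {R : ℕ} {ρ : ι → ℤ} :
    ρ ∈ box ι R ↔ ∀ x, |ρ x| ≤ R := by
  simp [box, abs_le]

theorem card_box (ι : Type*) [Fintype ι] [DecidableEq ι] (R : ℕ) :
    (box ι R).card = (2 * R + 1) ^ Fintype.card ι := by
  have : ((R : ℤ) + 1 + R).toNat = 2 * R + 1 := by omega
  simp [box, Fintype.card_piFinset, this]

/-- The constant of `exists_bound_of_sign`, uniform over all index types of bounded cardinality. -/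
theorem exists_uniform_bound_of_sign (N R : ℕ) :
    ∃ C : ℝ, 0 ≤ C ∧ ∀ (ι : Type) [Fintype ι] [DecidableEq ι], Fintype.card ι ≤ N →
      ∀ (s : Finset (ι → ℤ)), s ⊆ box ι R →
      ∀ (c : (ι → ℤ) → ℝ) (θ : ι → ℝ) (e : ℝ),
      (∀ x, SignType.sign (∑ ρ ∈ s, c ρ * ρ x) = SignType.sign (θ x)) →
      (∀ ρ ∈ s, |∑ x, (ρ x : ℝ) * θ x| ≤ e) → 0 ≤ e → ∀ x, |θ x| ≤ C * e := by
  classical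
  have key : ∀ n : Fin (N + 1), ∀ t : (box (Fin n) R).powerset × (Fin n → SignType), ∃ C : ℝ,
      ∀ (c : (Fin n → ℤ) → ℝ) (θ : Fin n → ℝ) (e : ℝ),
      (∀ x, SignType.sign (∑ ρ ∈ t.1.1, c ρ * ρ x) = t.2 x) →
      (∀ x, SignType.sign (θ x) = t.2 x) →
      (∀ ρ ∈ t.1.1, |∑ x, (ρ x : ℝ) * θ x| ≤ e) → 0 ≤ e → ∀ x, |θ x| ≤ C * e :=
    fun n t => exists_bound_of_sign t.1.1 t.2
  choose C hC using key
  refine ⟨∑ n, ∑ t, |C n t|, by positivity, ?_⟩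
  intro ι _ _ hι s hs c θ e h1 h2 he x
  let n : Fin (N + 1) := ⟨Fintype.card ι, by omega⟩
  let φ : ι ≃ Fin n := Fintype.equivFin ι
  let Φ : (ι → ℤ) ≃ (Fin n → ℤ) := Equiv.arrowCongr φ (Equiv.refl ℤ)
  have hΦ : ∀ ρ y, Φ ρ y = ρ (φ.symm y) := fun ρ y => rfl
  let s' : Finset (Fin n → ℤ) := s.map Φ.toEmbedding
  have hs' : s' ∈ (box (Fin n) R).powerset := by
    rw [Finset.mem_powerset]
    intro ρ hρ
    obtain ⟨ρ', hρ', rfl⟩ := Finset.mem_map.1 hρ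
    exact mem_box.2 fun y => mem_box.1 (hs hρ') _
  have hsum : ∀ y, ∑ ρ ∈ s', c (Φ.symm ρ) * ρ y = ∑ ρ ∈ s, c ρ * ρ (φ.symm y) := by
    intro y
    rw [Finset.sum_map]
    refine Finset.sum_congr rfl fun ρ _ => ?_
    simp [hΦ]
  have := hC n (⟨s', hs'⟩, fun y => SignType.sign (θ (φ.symm y))) (fun ρ => c (Φ.symm ρ))
    (fun y => θ (φ.symm y)) e (fun y => by rw [hsum]; exact h1 _) (fun y => rfl)
    (by
      intro ρ hρ
      obtain ⟨ρ', hρ', rfl⟩ := Finset.mem_map.1 hρ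
      have := h2 ρ' hρ'
      rwa [← Equiv.sum_comp φ.symm] at this) he (φ x)
  simp only [Equiv.symm_apply_apply] at this
  refine this.trans (mul_le_mul_of_nonneg_right ?_ he)
  refine (le_abs_self _).trans ?_
  refine (Finset.single_le_sum (f := fun t => |C n t|) (fun t _ => abs_nonneg _)
    (Finset.mem_univ _)).trans ?_
  exact Finset.single_le_sum (f := fun n => ∑ t, |C n t|)
    (fun t _ => Finset.sum_nonneg fun _ _ => abs_nonneg _) (Finset.mem_univ n)

/-- A symmetric step relation on configurations, each of whose steps is a bounded integer vector `ρ`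
nearly orthogonal to the frequency vector `ω ∘ σ`, and moves the frequencies by at most `ε`. -/
structure IsResonantStep {ι : Type*} [Fintype ι] (R : ℕ) (ω : ℕ → ℝ) (ε : ℝ)
    (step : (ι → ℕ) → (ι → ℕ) → Prop) : Prop where
  symm : ∀ σ τ, step σ τ → step τ σ
  move : ∀ σ τ, step σ τ → ∃ ρ : ι → ℤ, (∀ x, |ρ x| ≤ R) ∧ (∀ x, (τ x : ℤ) - σ x = ρ x) ∧
    |∑ x, (ρ x : ℝ) * ω (σ x)| ≤ ε
  drift : ∀ σ τ, step σ τ → ∀ x, |ω (τ x) - ω (σ x)| ≤ ε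

theorem abs_pairing_le {ι : Type*} [Fintype ι] {N R : ℕ} (hι : Fintype.card ι ≤ N)
    {ρ : ι → ℤ} (hρ : ∀ x, |ρ x| ≤ R) {θ : ι → ℝ} {b : ℝ} (hb : 0 ≤ b) (hθ : ∀ x, |θ x| ≤ b) :
    |∑ x, (ρ x : ℝ) * θ x| ≤ N * R * b := by
  refine (Finset.abs_sum_le_sum_abs _ _).trans ?_
  have h : ∀ x ∈ Finset.univ, |(ρ x : ℝ) * θ x| ≤ R * b := by
    intro x _
    rw [abs_mul]
    refine mul_le_mul ?_ (hθ x) (abs_nonneg _) (Nat.cast_nonneg _)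
    exact_mod_cast hρ x
  refine (Finset.sum_le_card_nsmul _ _ _ h).trans ?_
  rw [nsmul_eq_mul, mul_assoc]
  refine mul_le_mul_of_nonneg_right ?_ (by positivity)
  exact_mod_cast hι

/-- Nekhoroshev-type confinement, by induction on the number `n` of vectors resonant at the starting
point. All estimates are in the frequencies `ω ∘ σ`, where they stay linear in `ε`.

If a vector resonant at the wide scale `A'` is not resonant at the narrow scale `A`, at the starting
point or at a later point `τ`, then fewer vectors are resonant there at scale `A`, and the induction
hypothesis applies (in the second case to the reversed walk). Otherwise all the vectors used by the walk
are resonant at both ends, so that `exists_bound_of_sign` bounds the drift: since `ω` is increasing,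
`ω ∘ τ - ω ∘ σ` has the signs of `τ - σ`, which lies in the span of these vectors. -/
theorem exists_drift_bound_of_card_le (N R : ℕ) (n : ℕ) :
    ∃ A B : ℝ, 1 ≤ A ∧ 0 ≤ B ∧ ∀ (ι : Type) [Fintype ι] [DecidableEq ι], Fintype.card ι ≤ N →
      ∀ (ω : ℕ → ℝ), StrictMono ω → ∀ (ε : ℝ), 0 ≤ ε →
      ∀ (step : (ι → ℕ) → (ι → ℕ) → Prop), IsResonantStep R ω ε step →
      ∀ σ : ι → ℕ,
        ((box ι R).filter fun ρ => |∑ x, (ρ x : ℝ) * ω (σ x)| ≤ A * ε).card ≤ n →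
        ∀ τ, Relation.ReflTransGen step σ τ → ∀ x, |ω (τ x) - ω (σ x)| ≤ B * ε := by
  induction n with
  | zero =>
    refine ⟨1, 0, le_rfl, le_rfl, ?_⟩
    intro ι _ _ hι ω hω ε hε step hstep σ hcard τ hτ x
    rcases Relation.ReflTransGen.cases_head hτ with rfl | ⟨σ', h, _⟩
    · simp
    · obtain ⟨ρ, h1, h2, h3⟩ := hstep.move _ _ h
      have : ρ ∈ (box ι R).filter fun ρ => |∑ x, (ρ x : ℝ) * ω (σ x)| ≤ 1 * ε := by
        rw [Finset.mem_filter, mem_box]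
        exact ⟨h1, by linarith⟩
      rw [Nat.le_zero, Finset.card_eq_zero] at hcard
      rw [hcard] at this
      simp at this
  | succ n ih =>
    obtain ⟨A, B, hA, hB, ih⟩ := ih
    obtain ⟨C, hC, hsign⟩ := exists_uniform_bound_of_sign N R
    have hB' : 0 ≤ max B (C * (2 * A)) := le_max_of_le_left hB
    set B' := max B (C * (2 * A)) with hBdef
    set A' := A + 1 + N * R * (B' + 1) with hAdef
    have hNR : (0 : ℝ) ≤ N * R := by positivity
    have hA' : A ≤ A' := by have := mul_nonneg hNR (by linarith : 0 ≤ B' + 1); linarith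
    refine ⟨A', B', by linarith, hB', ?_⟩
    intro ι _ _ hι ω hω ε hε step hstep σ hcard τ hτ
    have hBB : B * ε ≤ B' * ε := mul_le_mul_of_nonneg_right (le_max_left _ _) hε
    set Res : ℝ → (ι → ℕ) → Finset (ι → ℤ) := fun A σ =>
      (box ι R).filter fun ρ => |∑ x, (ρ x : ℝ) * ω (σ x)| ≤ A * ε with hRes
    have hsymm : ∀ a b, Relation.ReflTransGen step a b → Relation.ReflTransGen step b a := by
      intro a b h
      induction h with
      | refl => exact .refl
      | tail _ h2 ih => exact ih.head (hstep.symm _ _ h2)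
    by_cases hfull : Res A' σ ⊆ Res A σ
    swap
    · -- fewer vectors are resonant at the smaller scale
      have hlt : (Res A σ).card ≤ n := by
        have hss : Res A σ ⊂ Res A' σ := by
          refine ⟨fun ρ hρ => ?_, hfull⟩
          rw [hRes, Finset.mem_filter] at hρ ⊢
          exact ⟨hρ.1, hρ.2.trans (mul_le_mul_of_nonneg_right hA' hε)⟩
        have := Finset.card_lt_card hss
        have : (Res A' σ).card ≤ n + 1 := hcard
        omega
      intro x
      exact (ih ι hι ω hω ε hε step hstep σ hlt τ hτ x).trans hBB
    -- the walk only uses vectors that are resonant at the starting point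
    have main : ∀ τ, Relation.ReflTransGen step σ τ → (∀ x, |ω (τ x) - ω (σ x)| ≤ B' * ε) ∧
        ∃ c : (ι → ℤ) → ℝ, ∀ x, ((τ x : ℝ) - σ x) = ∑ ρ ∈ Res A' σ, c ρ * (ρ x : ℝ) := by
      intro τ hτ
      induction hτ with
      | refl => exact ⟨fun x => by simpa using mul_nonneg hB' hε, fun _ => 0, by simp⟩
      | @tail τ₁ τ hτ₁ hst ih1 =>
        obtain ⟨hb, c, hc⟩ := ih1
        obtain ⟨ρ, h1, h2, h3⟩ := hstep.move _ _ hst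
        have hdr := hstep.drift _ _ hst
        have hτ' := hτ₁.tail hst
        have hρ : ρ ∈ Res A' σ := by
          rw [hRes, Finset.mem_filter, mem_box]
          refine ⟨h1, ?_⟩
          have h4 : |∑ x, (ρ x : ℝ) * (ω (τ₁ x) - ω (σ x))| ≤ N * R * (B' * ε) :=
            abs_pairing_le hι h1 (mul_nonneg hB' hε) hb
          have h5 : ∑ x, (ρ x : ℝ) * ω (σ x) = ∑ x, (ρ x : ℝ) * ω (τ₁ x) -
              ∑ x, (ρ x : ℝ) * (ω (τ₁ x) - ω (σ x)) := by
            rw [← Finset.sum_sub_distrib]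
            exact Finset.sum_congr rfl fun _ _ => by ring
          rw [h5]
          refine (abs_sub _ _).trans ?_
          have : A' * ε = A * ε + ε + N * R * (B' * ε) + N * R * ε := by rw [hAdef]; ring
          rw [this]
          nlinarith [mul_nonneg hNR hε, mul_nonneg (by linarith : 0 ≤ A) hε]
        have hspan : ∃ c : (ι → ℤ) → ℝ, ∀ x, ((τ x : ℝ) - σ x) =
            ∑ ρ ∈ Res A' σ, c ρ * (ρ x : ℝ) := by
          refine ⟨fun ρ' => c ρ' + if ρ' = ρ then 1 else 0, fun x => ?_⟩
          have h6 : ((τ x : ℝ) - τ₁ x) = ρ x := by exact_mod_cast h2 x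
          simp only [add_mul, Finset.sum_add_distrib, ← hc x, ite_mul, one_mul, zero_mul,
            Finset.sum_ite_eq', hρ, if_true]
          linarith
        refine ⟨?_, hspan⟩
        by_cases hτres : Res A' σ ⊆ Res A τ
        · -- both ends are resonant with all the vectors used
          obtain ⟨c', hc'⟩ := hspan
          intro x
          have h7 := hsign ι hι (Res A' σ) (Finset.filter_subset _ _) c'
            (fun x => ω (τ x) - ω (σ x)) (2 * A * ε) ?_ ?_ (by positivity) x
          · refine h7.trans ?_
            rw [← mul_assoc]
            exact mul_le_mul_of_nonneg_right (le_max_right _ _) hε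
          · intro y
            rw [← hc' y]
            rcases lt_trichotomy (τ y) (σ y) with h | h | h
            · rw [sign_neg (sub_neg.2 (hω h)), sign_neg (sub_neg.2 (by exact_mod_cast h))]
            · simp [h]
            · rw [sign_pos (sub_pos.2 (hω h)), sign_pos (sub_pos.2 (by exact_mod_cast h))]
          · intro ρ' hρ'
            have e1 := (Finset.mem_filter.1 (hτres hρ')).2
            have e2 := (Finset.mem_filter.1 (hfull hρ')).2
            have e3 : ∑ x, (ρ' x : ℝ) * (ω (τ x) - ω (σ x)) = ∑ x, (ρ' x : ℝ) * ω (τ x) -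
                ∑ x, (ρ' x : ℝ) * ω (σ x) := by
              rw [← Finset.sum_sub_distrib]
              exact Finset.sum_congr rfl fun _ _ => by ring
            rw [e3]
            refine (abs_sub _ _).trans ?_
            linarith
        · -- some vector has left resonance: go back from the end point
          have hsub : Res A τ ⊆ Res A' σ := by
            intro ρ' hρ'
            rw [hRes, Finset.mem_filter] at hρ' ⊢
            refine ⟨hρ'.1, ?_⟩
            have h4 : |∑ x, (ρ' x : ℝ) * (ω (τ x) - ω (σ x))| ≤ N * R * ((B' + 1) * ε) := by
              refine abs_pairing_le hι (mem_box.1 hρ'.1) (by positivity) fun x => ?_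
              have : ω (τ x) - ω (σ x) = (ω (τ x) - ω (τ₁ x)) + (ω (τ₁ x) - ω (σ x)) := by ring
              rw [this]
              refine (abs_add_le _ _).trans ?_
              linarith [hdr x, hb x]
            have h5 : ∑ x, (ρ' x : ℝ) * ω (σ x) = ∑ x, (ρ' x : ℝ) * ω (τ x) -
                ∑ x, (ρ' x : ℝ) * (ω (τ x) - ω (σ x)) := by
              rw [← Finset.sum_sub_distrib]
              exact Finset.sum_congr rfl fun _ _ => by ring
            rw [h5]
            refine (abs_sub _ _).trans ?_
            have : A' * ε = A * ε + ε + N * R * ((B' + 1) * ε) := by rw [hAdef]; ring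
            rw [this]
            linarith [hρ'.2]
          have hlt : (Res A τ).card ≤ n := by
            have := Finset.card_lt_card (⟨hsub, hτres⟩ : Res A τ ⊂ Res A' σ)
            have : (Res A' σ).card ≤ n + 1 := hcard
            omega
          intro x
          rw [abs_sub_comm]
          exact (ih ι hι ω hω ε hε step hstep τ hlt σ (hsymm _ _ hτ') x).trans hBB
    exact (main τ hτ).1

/-- Resonant walks stay within `B ε` of their starting point, in frequency space. -/
theorem exists_drift_bound (N R : ℕ) :
    ∃ B : ℝ, 0 ≤ B ∧ ∀ (ι : Type) [Fintype ι], Fintype.card ι ≤ N →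
      ∀ (ω : ℕ → ℝ), StrictMono ω → ∀ (ε : ℝ), 0 ≤ ε →
      ∀ (step : (ι → ℕ) → (ι → ℕ) → Prop), IsResonantStep R ω ε step →
      ∀ σ τ, Relation.ReflTransGen step σ τ → ∀ x, |ω (τ x) - ω (σ x)| ≤ B * ε := by
  classical
  obtain ⟨A, B, _, hB, h⟩ := exists_drift_bound_of_card_le N R ((2 * R + 1) ^ N)
  refine ⟨B, hB, fun ι _ hι ω hω ε hε step hstep σ τ => ?_⟩
  refine h ι hι ω hω ε hε step hstep σ ?_ τ
  refine (Finset.card_filter_le _ _).trans ?_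
  rw [card_box]
  exact Nat.pow_le_pow_right (by omega) hι

/-! ### Counting configurations with several independent constraints -/

/-- One constraint at the coordinate `x`, on top of a condition that does not involve `x`. -/
theorem card_filter_and_mul_le {X T : Type*} [Fintype X] [DecidableEq X] [Fintype T]
    (x : X) (P Q : (X → T) → Prop) [DecidablePred P] [DecidablePred Q] (b : ℕ)
    (hP : ∀ η t, P η → P (Function.update η x t))
    (hQ : ∀ η : X → T, (Finset.univ.filter fun t => Q (Function.update η x t)).card ≤ b) :
    (Finset.univ.filter fun η => P η ∧ Q η).card * Fintype.card T ≤
      b * (Finset.univ.filter fun η => P η).card := by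
  classical
  rw [← Finset.card_univ, ← Finset.card_product, mul_comm b]
  calc _ ≤ ((Finset.univ.filter fun η => P η).sigma
        fun η => Finset.univ.filter fun t => Q (Function.update η x t)).card := by
        refine Finset.card_le_card_of_injOn
          (fun p => ⟨Function.update p.1 x p.2, p.1 x⟩) ?_ ?_
        · rintro ⟨η, t⟩ h
          simp only [Finset.coe_product, Set.mem_prod, Finset.mem_coe, Finset.mem_filter,
            Finset.mem_univ, true_and, and_true] at h
          simp only [Finset.coe_sigma, Set.mem_sigma_iff, Finset.mem_coe, Finset.mem_filter,
            Finset.mem_univ, true_and]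
          exact ⟨hP _ _ h.1, by simpa using h.2⟩
        · rintro ⟨η, t⟩ _ ⟨η', t'⟩ _ h
          simp only [Sigma.mk.injEq, heq_eq_eq] at h
          obtain ⟨h1, h2⟩ := h
          have ht : t = t' := by simpa using congrFun h1 x
          refine Prod.ext (funext fun z => ?_) ht
          by_cases hz : z = x
          · rw [hz]; exact h2
          · simpa [hz] using congrFun h1 z
    _ ≤ _ := by
        rw [Finset.card_sigma]
        refine (Finset.sum_le_card_nsmul _ _ b fun η _ => hQ η).trans ?_
        simp

/-- `n` constraints, the `j`-th one sensitive to the coordinate `x j` and independent of the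
coordinates `x i`, `i ≠ j`, hold simultaneously on at most a fraction `(b / |T|) ^ n`. -/
theorem card_forall_lt_mul_pow_le {X T : Type*} [Fintype X] [DecidableEq X] [Fintype T]
    (n : ℕ) (x : ℕ → X) (Q : ℕ → (X → T) → Prop) [∀ j, DecidablePred (Q j)] (b : ℕ)
    (hind : ∀ i < n, ∀ j < n, i ≠ j → ∀ η t, Q j η → Q j (Function.update η (x i) t))
    (hQ : ∀ j < n, ∀ η : X → T,
      (Finset.univ.filter fun t => Q j (Function.update η (x j) t)).card ≤ b) :
    (Finset.univ.filter fun η => ∀ j < n, Q j η).card * Fintype.card T ^ n ≤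
      b ^ n * Fintype.card (X → T) := by
  induction n with
  | zero => simp
  | succ n ih =>
    have h1 := card_filter_and_mul_le (x n) (fun η => ∀ j < n, Q j η) (Q n) b
      (fun η t h j hj => hind n (by omega) j (by omega) (by omega) η t (h j hj))
      (hQ n (by omega))
    have h2 := ih (fun i hi j hj => hind i (by omega) j (by omega))
      (fun j hj => hQ j (by omega))
    have h3 : (Finset.univ.filter fun η => ∀ j < n + 1, Q j η) =
        Finset.univ.filter fun η => (∀ j < n, Q j η) ∧ Q n η := by
      ext η
      simp only [Finset.mem_filter, Finset.mem_univ, true_and]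
      constructor
      · exact fun h => ⟨fun j hj => h j (by omega), h n (by omega)⟩
      · rintro ⟨h, h'⟩ j hj
        rcases Nat.lt_succ_iff_lt_or_eq.1 hj with h4 | rfl
        · exact h j h4
        · exact h'
    rw [h3, pow_succ']
    calc _ = (Finset.univ.filter fun η => (∀ j < n, Q j η) ∧ Q n η).card * Fintype.card T *
          Fintype.card T ^ n := by ring
      _ ≤ b * (Finset.univ.filter fun η => ∀ j < n, Q j η).card * Fintype.card T ^ n :=
          Nat.mul_le_mul_right _ h1
      _ = b * ((Finset.univ.filter fun η => ∀ j < n, Q j η).card * Fintype.card T ^ n) := by ring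
      _ ≤ b * (b ^ n * Fintype.card (X → T)) := Nat.mul_le_mul_left _ h2
      _ = _ := by ring

/-! ### Powers of integers -/

/-- The graph of `t ↦ t ^ p` lies above its tangents. The last hypothesis excludes `0 ^ 0 = 1`. -/
theorem rpow_tangent {p : ℝ} (hp : 1 ≤ p) {s t : ℝ} (hs : 0 ≤ s) (ht : 0 ≤ t) (hs0 : s = 0 → 1 < p) :
    p * s ^ (p - 1) * (t - s) ≤ t ^ p - s ^ p := by
  rcases hs.eq_or_lt with rfl | hs
  · have := hs0 rfl
    rw [Real.zero_rpow (by linarith), Real.zero_rpow (by linarith)]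
    simpa using Real.rpow_nonneg ht p
  have h := one_add_mul_self_le_rpow_one_add (s := t / s - 1) (by
    have : 0 ≤ t / s := by positivity
    linarith) hp
  have h1 : 1 + (t / s - 1) = t / s := by ring
  rw [h1, Real.div_rpow ht hs.le] at h
  have h2 : 0 < s ^ p := Real.rpow_pos_of_pos hs p
  rw [le_div_iff₀ h2] at h
  have h3 : s ^ p = s ^ (p - 1) * s := by
    rw [← Real.rpow_add_one hs.ne']; ring_nf
  have h4 : (1 + p * (t / s - 1)) * s ^ p = s ^ p + p * s ^ (p - 1) * (t - s) := by
    rw [h3]; field_simp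
  linarith

theorem abs_rpow_sub_rpow_le {p : ℝ} (hp : 1 < p) {s t m : ℝ} (hs : 0 ≤ s) (ht : 0 ≤ t)
    (hsm : s ≤ m) (htm : t ≤ m) : |t ^ p - s ^ p| ≤ p * m ^ (p - 1) * |t - s| := by
  wlog h : s ≤ t generalizing s t
  · rw [abs_sub_comm, abs_sub_comm t s]
    exact this ht hs htm hsm (le_of_not_ge h)
  have h1 := rpow_tangent hp.le ht hs fun _ => hp
  have h2 : t ^ (p - 1) ≤ m ^ (p - 1) := Real.rpow_le_rpow ht htm (by linarith)
  have h3 : s ^ p ≤ t ^ p := Real.rpow_le_rpow hs h (by linarith)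
  rw [abs_of_nonneg (by linarith), abs_of_nonneg (by linarith)]
  have h4 : p * t ^ (p - 1) * (t - s) ≤ p * m ^ (p - 1) * (t - s) := by
    refine mul_le_mul_of_nonneg_right ?_ (by linarith)
    exact mul_le_mul_of_nonneg_left h2 (by linarith)
  linarith

/-- First order Taylor estimate, from the tangents at both ends. -/
theorem abs_rpow_sub_linear_le {p : ℝ} (hp : 2 < p) {s t m : ℝ} (hs : 0 ≤ s) (ht : 0 ≤ t)
    (hsm : s ≤ m) (htm : t ≤ m) :
    |t ^ p - s ^ p - p * s ^ (p - 1) * (t - s)| ≤ p * (p - 1) * m ^ (p - 2) * |t - s| ^ 2 := by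
  have h1 := rpow_tangent (by linarith : 1 ≤ p) hs ht fun _ => by linarith
  have h2 := rpow_tangent (by linarith : 1 ≤ p) ht hs fun _ => by linarith
  have h3 := abs_rpow_sub_rpow_le (by linarith : 1 < p - 1) hs ht hsm htm
  have h4 : p - 1 - 1 = p - 2 := by ring
  rw [h4] at h3
  rw [abs_of_nonneg (by linarith)]
  have h5 : (t ^ (p - 1) - s ^ (p - 1)) * (t - s) ≤ (p - 1) * m ^ (p - 2) * |t - s| * |t - s| := by
    refine (le_abs_self _).trans ?_
    rw [abs_mul]
    exact mul_le_mul_of_nonneg_right h3 (abs_nonneg _)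
  nlinarith

/-- The number of integers `t` with `t ^ p` in an interval of length `ℓ`. -/
theorem card_rpow_mem_interval_le {p : ℝ} (hp : 1 ≤ p) (n : ℕ) (u ℓ : ℝ) (hℓ : 0 ≤ ℓ) :
    ((Finset.univ.filter fun t : Fin n => u ≤ ((t : ℕ) : ℝ) ^ p ∧ ((t : ℕ) : ℝ) ^ p ≤ u + ℓ).card : ℝ)
      ≤ ℓ ^ (1 / p) + 1 := by
  classical
  set F := Finset.univ.filter fun t : Fin n => u ≤ ((t : ℕ) : ℝ) ^ p ∧ ((t : ℕ) : ℝ) ^ p ≤ u + ℓ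
  have hℓp : 0 ≤ ℓ ^ (1 / p) := Real.rpow_nonneg hℓ _
  rcases F.eq_empty_or_nonempty with h | h
  · rw [h, Finset.card_empty, Nat.cast_zero]; linarith
  set t₀ := F.min' h
  have h0 : t₀ ∈ F := F.min'_mem h
  have hdiff : ∀ t ∈ F, ((t : ℕ) : ℝ) - (t₀ : ℕ) ≤ ℓ ^ (1 / p) := by
    intro t ht
    have hle : t₀ ≤ t := F.min'_le _ ht
    have hle' : ((t₀ : ℕ) : ℝ) ≤ (t : ℕ) := by exact_mod_cast hle
    have h1 := (Finset.mem_filter.1 ht).2.2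
    have h2 := (Finset.mem_filter.1 h0).2.1
    have h3 := Real.add_rpow_le_rpow_add (sub_nonneg.2 hle') (Nat.cast_nonneg (t₀ : ℕ)) hp
    rw [sub_add_cancel] at h3
    have h4 : (((t : ℕ) : ℝ) - (t₀ : ℕ)) ^ p ≤ ℓ := by linarith
    have h5 := Real.rpow_le_rpow (Real.rpow_nonneg (sub_nonneg.2 hle') _) h4
      (by positivity : 0 ≤ 1 / p)
    rwa [← Real.rpow_mul (sub_nonneg.2 hle'), mul_one_div_cancel (by linarith), Real.rpow_one] at h5
  have hcard : F.card ≤ (Finset.Icc (t₀ : ℕ) ((t₀ : ℕ) + ⌊ℓ ^ (1 / p)⌋₊)).card := by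
    refine Finset.card_le_card_of_injOn (fun t => (t : ℕ)) ?_ (fun a _ b _ h => Fin.ext h)
    intro t ht
    have hle : t₀ ≤ t := F.min'_le _ ht
    have hle' : (t₀ : ℕ) ≤ t := hle
    have h1 := hdiff t ht
    rw [← Nat.cast_sub hle'] at h1
    have := Nat.le_floor h1
    simp only [Finset.coe_Icc, Set.mem_Icc]
    omega
  rw [Nat.card_Icc] at hcard
  have h6 : F.card ≤ ⌊ℓ ^ (1 / p)⌋₊ + 1 := by omega
  have h7 : (F.card : ℝ) ≤ (⌊ℓ ^ (1 / p)⌋₊ : ℝ) + 1 := by exact_mod_cast h6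
  linarith [Nat.floor_le hℓp]

namespace Setup
variable {k : ℕ}

/-! ### Locality of operators -/

/-- An intrinsic form of `SupportedIn`: the operator does not change the occupations outside `A`, and
its matrix elements are invariant under relabelings of the levels outside `A`. In this form locality is
visibly stable under products. -/
structure Loc (S : Setup k) (A : Finset S.Pt) (O : S.Op) : Prop where
  eq_off : ∀ η η', O η η' ≠ 0 → ∀ x, x ∉ A → η x = η' x
  perm : ∀ π : S.Pt → Equiv.Perm S.Lvl, (∀ x ∈ A, π x = 1) → ∀ η η' : S.Conf,
    O (fun x => π x (η x)) (fun x => π x (η' x)) = O η η'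

theorem Loc.congr {S : Setup k} {A : Finset S.Pt} {O : S.Op} (h : S.Loc A O) {η η' ξ ξ' : S.Conf}
    (h1 : ∀ x, x ∉ A → η x = η' x) (h2 : ∀ x, x ∉ A → ξ x = ξ' x)
    (h3 : ∀ x ∈ A, η x = ξ x) (h4 : ∀ x ∈ A, η' x = ξ' x) : O η η' = O ξ ξ' := by
  classical
  have := h.perm (fun x => if x ∈ A then 1 else Equiv.swap (η x) (ξ x))
    (fun x hx => by simp [hx]) η η'
  rw [← this]
  congr 1 <;> funext x <;> by_cases hx : x ∈ A
  · simp [hx, h3]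
  · simp [hx]
  · simp [hx, h4]
  · simp [hx, ← h2 x hx, ← h1 x hx]

theorem Loc.supportedIn {S : Setup k} {A : Finset S.Pt} {O : S.Op} (h : S.Loc A O) :
    S.SupportedIn A O := by
  classical
  let ext : S.VConf A → S.Conf := fun σ x => if hx : x ∈ A then σ ⟨x, hx⟩ else 0
  refine ⟨fun σ τ => O (ext σ) (ext τ), fun η η' => ?_⟩
  split_ifs with hη
  · refine h.congr hη (fun x hx => by simp [ext, hx]) ?_ ?_ <;>
    · intro x hx
      simp [ext, hx, restrict]
  · by_contra hne
    exact hη (h.eq_off _ _ hne)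

theorem SupportedIn.loc {S : Setup k} {A : Finset S.Pt} {O : S.Op} (h : S.SupportedIn A O) :
    S.Loc A O := by
  classical
  obtain ⟨T, hT⟩ := h
  refine ⟨fun η η' hne x hx => ?_, fun π hπ η η' => ?_⟩
  · rw [hT] at hne
    split_ifs at hne with hη
    · exact hη x hx
    · exact absurd rfl hne
  · rw [hT, hT]
    have h1 : ∀ ξ : S.Conf, S.restrict A (fun x => π x (ξ x)) = S.restrict A ξ := by
      intro ξ
      funext x
      simp [restrict, hπ x.1 x.2]
    rw [h1, h1]
    simp only [EmbeddingLike.apply_eq_iff_eq]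

theorem Loc.mono {S : Setup k} {A B : Finset S.Pt} {O : S.Op} (h : S.Loc A O) (hAB : A ⊆ B) :
    S.Loc B O :=
  ⟨fun η η' hne x hx => h.eq_off η η' hne x fun hA => hx (hAB hA),
    fun π hπ => h.perm π fun x hx => hπ x (hAB hx)⟩

theorem Loc.zero (S : Setup k) (A : Finset S.Pt) : S.Loc A 0 :=
  ⟨fun _ _ hne => absurd rfl hne, fun _ _ _ _ => rfl⟩

theorem Loc.add {S : Setup k} {A : Finset S.Pt} {O₁ O₂ : S.Op} (h₁ : S.Loc A O₁)
    (h₂ : S.Loc A O₂) : S.Loc A (O₁ + O₂) := by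
  refine ⟨fun η η' hne => ?_, fun π hπ η η' => ?_⟩
  · by_cases h : O₁ η η' = 0
    · exact h₂.eq_off η η' fun h' => hne (by simp [h, h'])
    · exact h₁.eq_off η η' h
  · simp only [Matrix.add_apply, h₁.perm π hπ, h₂.perm π hπ]

theorem Loc.smul {S : Setup k} {A : Finset S.Pt} {O : S.Op} (h : S.Loc A O) (c : ℂ) :
    S.Loc A (c • O) := by
  refine ⟨fun η η' hne => h.eq_off η η' fun h' => hne (by simp [h']), fun π hπ η η' => ?_⟩
  simp only [Matrix.smul_apply, h.perm π hπ]

theorem Loc.neg {S : Setup k} {A : Finset S.Pt} {O : S.Op} (h : S.Loc A O) : S.Loc A (-O) := by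
  simpa using h.smul (-1)

theorem Loc.sub {S : Setup k} {A : Finset S.Pt} {O₁ O₂ : S.Op} (h₁ : S.Loc A O₁)
    (h₂ : S.Loc A O₂) : S.Loc A (O₁ - O₂) := by
  rw [sub_eq_add_neg]
  exact h₁.add h₂.neg

theorem Loc.sum {S : Setup k} {A : Finset S.Pt} {ι : Type*} {s : Finset ι} {O : ι → S.Op}
    (h : ∀ i ∈ s, S.Loc A (O i)) : S.Loc A (∑ i ∈ s, O i) := by
  classical
  induction s using Finset.induction_on with
  | empty => simpa using Loc.zero S A
  | insert i s hi ih =>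
    rw [Finset.sum_insert hi]
    exact (h i (by simp)).add (ih fun j hj => h j (by simp [hj]))

theorem Loc.mul {S : Setup k} {A : Finset S.Pt} {O₁ O₂ : S.Op} (h₁ : S.Loc A O₁)
    (h₂ : S.Loc A O₂) : S.Loc A (O₁ * O₂) := by
  refine ⟨fun η η' hne => ?_, fun π hπ η η' => ?_⟩
  · rw [Matrix.mul_apply] at hne
    obtain ⟨ζ, -, hζ⟩ := Finset.exists_ne_zero_of_sum_ne_zero hne
    intro x hx
    rw [h₁.eq_off η ζ (left_ne_zero_of_mul hζ) x hx, h₂.eq_off ζ η' (right_ne_zero_of_mul hζ) x hx]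
  · rw [Matrix.mul_apply, Matrix.mul_apply, ← Equiv.sum_comp (Equiv.piCongrRight π)]
    refine Finset.sum_congr rfl fun ζ _ => ?_
    rw [← h₁.perm π hπ η ζ, ← h₂.perm π hπ ζ η']
    rfl

theorem Loc.comm {S : Setup k} {A : Finset S.Pt} {O₁ O₂ : S.Op} (h₁ : S.Loc A O₁)
    (h₂ : S.Loc A O₂) : S.Loc A (S.comm O₁ O₂) :=
  (h₁.mul h₂).sub (h₂.mul h₁)

/-- Multiplying the matrix elements by a function of the occupations in `A`. -/
theorem Loc.of_mul {S : Setup k} {A : Finset S.Pt} {O O' : S.Op} (h : S.Loc A O)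
    (f : S.Conf → S.Conf → ℂ)
    (hf : ∀ η η' ξ ξ' : S.Conf, (∀ x ∈ A, η x = ξ x) → (∀ x ∈ A, η' x = ξ' x) → f η η' = f ξ ξ')
    (hO' : ∀ η η', O' η η' = f η η' * O η η') : S.Loc A O' := by
  refine ⟨fun η η' hne => h.eq_off η η' fun h' => hne (by simp [hO', h']), fun π hπ η η' => ?_⟩
  rw [hO', hO', h.perm π hπ]
  congr 1
  exact hf _ _ _ _ (fun x hx => by simp [hπ x hx]) (fun x hx => by simp [hπ x hx])

theorem Loc.diagonal {S : Setup k} {A : Finset S.Pt} (f : S.Conf → ℂ)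
    (hf : ∀ η ξ : S.Conf, (∀ x ∈ A, η x = ξ x) → f η = f ξ) : S.Loc A (Matrix.diagonal f) := by
  refine ⟨fun η η' hne x _ => ?_, fun π hπ η η' => ?_⟩
  · have : η = η' := by
      by_contra h
      exact hne (Matrix.diagonal_apply_ne _ h)
    rw [this]
  · by_cases h : η = η'
    · subst h
      rw [Matrix.diagonal_apply_eq, Matrix.diagonal_apply_eq]
      exact hf _ _ fun x hx => by simp [hπ x hx]
    · rw [Matrix.diagonal_apply_ne _ h, Matrix.diagonal_apply_ne]
      intro h'
      exact h (funext fun x => (π x).injective (congrFun h' x))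

theorem Loc.tsum {S : Setup k} {A : Finset S.Pt} {O : ℕ → S.Op} (h : ∀ n, S.Loc A (O n)) :
    S.Loc A (∑' n, O n) := by
  by_cases hs : Summable O
  swap
  · rw [tsum_eq_zero_of_not_summable hs]
    exact Loc.zero S A
  have happ : ∀ η η', (∑' n, O n) η η' = ∑' n, O n η η' := by
    intro η η'
    have h1 : ∀ ξ, Summable fun n => O n ξ := Pi.summable.1 hs
    have h2 : ∀ ξ, Summable fun n => O n η ξ := Pi.summable.1 (h1 η)
    exact (congrFun (tsum_apply hs) η').trans (tsum_apply (h1 η))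
  refine ⟨fun η η' hne => ?_, fun π hπ η η' => ?_⟩
  · rw [happ] at hne
    have : ∃ n, O n η η' ≠ 0 := by
      by_contra! h'
      exact hne (by simp [h'])
    obtain ⟨n, hn⟩ := this
    exact (h n).eq_off η η' hn
  · rw [happ, happ]
    exact tsum_congr fun n => (h n).perm π hπ η η'

/-- Operators with disjoint supports commute. -/
theorem Loc.mul_comm_of_disjoint {S : Setup k} {A B : Finset S.Pt} {O₁ O₂ : S.Op} (h₁ : S.Loc A O₁)
    (h₂ : S.Loc B O₂) (hAB : Disjoint A B) : O₁ * O₂ = O₂ * O₁ := by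
  classical
  have key : ∀ {A B : Finset S.Pt} {O₁ O₂ : S.Op}, S.Loc A O₁ → S.Loc B O₂ → Disjoint A B →
      ∀ η η', (O₁ * O₂) η η' =
        O₁ η (fun x => if x ∈ A then η' x else η x) *
          O₂ (fun x => if x ∈ A then η' x else η x) η' := by
    intro A B O₁ O₂ h₁ h₂ hAB η η'
    rw [Matrix.mul_apply]
    refine Finset.sum_eq_single _ (fun ζ _ hζ => ?_) (by simp)
    by_contra hne
    refine hζ (funext fun x => ?_)
    by_cases hx : x ∈ A
    · simp only [hx, if_true]
      exact h₂.eq_off ζ η' (right_ne_zero_of_mul hne) x (Finset.disjoint_left.1 hAB hx)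
    · simp only [hx, if_false]
      exact (h₁.eq_off η ζ (left_ne_zero_of_mul hne) x hx).symm
  ext η η'
  rw [key h₁ h₂ hAB, key h₂ h₁ hAB.symm]
  by_cases hη : ∀ x, x ∉ A → x ∉ B → η x = η' x
  · rw [mul_comm]
    congr 1
    · refine h₂.congr ?_ ?_ ?_ ?_ <;> intro x hx
      · by_cases hA : x ∈ A <;> simp [hA]
        exact hη x hA hx
      · simp [hx]
      · simp [Finset.disjoint_right.1 hAB hx]
      · simp [hx]
    · refine h₁.congr ?_ ?_ ?_ ?_ <;> intro x hx
      · simp [hx]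
      · by_cases hB : x ∈ B <;> simp [hB]
        exact hη x hx hB
      · simp [Finset.disjoint_left.1 hAB hx]
      · simp [hx]
  · push Not at hη
    obtain ⟨x, hA, hB, hx⟩ := hη
    have e1 : O₂ (fun x => if x ∈ A then η' x else η x) η' = 0 := by
      by_contra hne
      have := h₂.eq_off _ _ hne x hB
      simp [hA] at this
      exact hx this
    have e2 : O₁ (fun x => if x ∈ B then η' x else η x) η' = 0 := by
      by_contra hne
      have := h₁.eq_off _ _ hne x hA
      simp [hB] at this
      exact hx this
    rw [e1, e2, mul_zero, mul_zero]

theorem Loc.comm_eq_zero {S : Setup k} {A B : Finset S.Pt} {O₁ O₂ : S.Op} (h₁ : S.Loc A O₁)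
    (h₂ : S.Loc B O₂) (hAB : Disjoint A B) : S.comm O₁ O₂ = 0 := by
  rw [Setup.comm, h₁.mul_comm_of_disjoint h₂ hAB, sub_self]

/-! ### Norms -/

theorem hsNorm_eq (S : Setup k) (X : S.Op) :
    S.hsNorm X = Real.sqrt ((∑ η, ∑ η', ‖X η η'‖ ^ 2) / Fintype.card S.Conf) := by
  have h1 : Matrix.trace (X.conjTranspose * X) = ((∑ η, ∑ η', ‖X η η'‖ ^ 2 : ℝ) : ℂ) := by
    rw [Finset.sum_comm]
    simp only [Matrix.trace, Matrix.diag_apply, Matrix.mul_apply, Matrix.conjTranspose_apply]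
    push_cast
    refine Finset.sum_congr rfl fun η' _ => Finset.sum_congr rfl fun η _ => ?_
    exact Complex.conj_mul' _
  rw [hsNorm, normTrace, h1]
  congr 1
  have : ((∑ η, ∑ η', ‖X η η'‖ ^ 2 : ℝ) : ℂ) / (Fintype.card S.Conf : ℂ) =
      (((∑ η, ∑ η', ‖X η η'‖ ^ 2) / Fintype.card S.Conf : ℝ) : ℂ) := by push_cast; rfl
  rw [this, Complex.ofReal_re]

theorem opNorm_nonneg (S : Setup k) (O : S.Op) : 0 ≤ S.opNorm O := norm_nonneg _

theorem sum_norm_sq_mulVec_le (S : Setup k) (O : S.Op) (v : S.Conf → ℂ) :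
    ∑ η, ‖(O.mulVec v) η‖ ^ 2 ≤ S.opNorm O ^ 2 * ∑ η, ‖v η‖ ^ 2 := by
  have h := (Matrix.toEuclideanCLM (n := S.Conf) (𝕜 := ℂ) O).le_opNorm (WithLp.toLp 2 v)
  have h2 := pow_le_pow_left₀ (norm_nonneg _) h 2
  rw [mul_pow, EuclideanSpace.norm_sq_eq, EuclideanSpace.norm_sq_eq] at h2
  simpa [opNorm] using h2

theorem opNorm_conjTranspose (S : Setup k) (O : S.Op) : S.opNorm O.conjTranspose = S.opNorm O := by
  rw [opNorm, opNorm, ← Matrix.star_eq_conjTranspose, map_star]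
  exact (ContinuousLinearMap.adjoint).norm_map _

theorem sum_norm_sq_mul_le (S : Setup k) (O X : S.Op) :
    ∑ η, ∑ η', ‖(O * X) η η'‖ ^ 2 ≤ S.opNorm O ^ 2 * ∑ η, ∑ η', ‖X η η'‖ ^ 2 := by
  rw [Finset.sum_comm, Finset.sum_comm (f := fun η η' => ‖X η η'‖ ^ 2), Finset.mul_sum]
  exact Finset.sum_le_sum fun η' _ => S.sum_norm_sq_mulVec_le O fun η => X η η'

theorem sum_norm_sq_mul_le' (S : Setup k) (X O : S.Op) :
    ∑ η, ∑ η', ‖(X * O) η η'‖ ^ 2 ≤ S.opNorm O ^ 2 * ∑ η, ∑ η', ‖X η η'‖ ^ 2 := by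
  have h := S.sum_norm_sq_mul_le O.conjTranspose X.conjTranspose
  rw [← Matrix.conjTranspose_mul, opNorm_conjTranspose] at h
  simp only [Matrix.conjTranspose_apply, norm_star] at h
  rwa [Finset.sum_comm, Finset.sum_comm (f := fun η η' => ‖X η' η‖ ^ 2)] at h

theorem hsNorm_comm_le (S : Setup k) (X O : S.Op) :
    S.hsNorm (S.comm X O) ≤ 2 * S.hsNorm X * S.opNorm O := by
  rw [hsNorm_eq, hsNorm_eq]
  set T := ∑ η, ∑ η', ‖X η η'‖ ^ 2 with hT
  have hTn : 0 ≤ T := by positivity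
  have hc : (0 : ℝ) < Fintype.card S.Conf := by exact_mod_cast Fintype.card_pos
  have hle : ∑ η, ∑ η', ‖(S.comm X O) η η'‖ ^ 2 ≤ 4 * S.opNorm O ^ 2 * T := by
    have h1 := S.sum_norm_sq_mul_le O X
    have h2 := S.sum_norm_sq_mul_le' X O
    calc _ ≤ ∑ η, ∑ η', (2 * ‖(X * O) η η'‖ ^ 2 + 2 * ‖(O * X) η η'‖ ^ 2) := by
          refine Finset.sum_le_sum fun η _ => Finset.sum_le_sum fun η' _ => ?_
          have : ‖(S.comm X O) η η'‖ ≤ ‖(X * O) η η'‖ + ‖(O * X) η η'‖ := norm_sub_le _ _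
          nlinarith [norm_nonneg ((S.comm X O) η η'), sq_nonneg (‖(X * O) η η'‖ - ‖(O * X) η η'‖)]
      _ = 2 * (∑ η, ∑ η', ‖(X * O) η η'‖ ^ 2) + 2 * ∑ η, ∑ η', ‖(O * X) η η'‖ ^ 2 := by
          simp only [Finset.sum_add_distrib, Finset.mul_sum]
      _ ≤ _ := by linarith
  refine Real.sqrt_le_iff.2 ⟨by have := S.opNorm_nonneg O; positivity, ?_⟩
  rw [mul_pow, mul_pow, Real.sq_sqrt (by positivity)]
  calc _ ≤ 4 * S.opNorm O ^ 2 * T / Fintype.card S.Conf := by gcongr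
    _ = _ := by ring

theorem opNorm_sum_le (S : Setup k) {ι : Type*} (s : Finset ι) (O : ι → S.Op) :
    S.opNorm (∑ i ∈ s, O i) ≤ ∑ i ∈ s, S.opNorm (O i) := by
  unfold opNorm
  rw [map_sum]
  exact norm_sum_le _ _

theorem norm_sum_sq_of_subsingleton {ι : Type*} [Fintype ι] (f : ι → ℂ)
    (h : ∀ i j, f i ≠ 0 → f j ≠ 0 → i = j) : ‖∑ i, f i‖ ^ 2 = ∑ i, ‖f i‖ ^ 2 := by
  by_cases h0 : ∀ i, f i = 0
  · simp [h0]
  push Not at h0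
  obtain ⟨i, hi⟩ := h0
  have hz : ∀ j, j ≠ i → f j = 0 := fun j hj => by
    by_contra hne
    exact hj (h j i hne hi)
  rw [Fintype.sum_eq_single i hz, Fintype.sum_eq_single i fun j hj => by simp [hz j hj]]

theorem sum_norm_sq_le_of_subsingleton {ι : Type*} [Fintype ι] (f : ι → ℂ) {b : ℝ}
    (hb : ∀ i, ‖f i‖ ≤ b)
    (h : ∀ i j, f i ≠ 0 → f j ≠ 0 → i = j) : ∑ i, ‖f i‖ ^ 2 ≤ b ^ 2 := by
  by_cases h0 : ∀ i, f i = 0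
  · simp [h0]; positivity
  push Not at h0
  obtain ⟨i, hi⟩ := h0
  have hz : ∀ j, j ≠ i → f j = 0 := fun j hj => by
    by_contra hne
    exact hj (h j i hne hi)
  rw [Fintype.sum_eq_single i fun j hj => by simp [hz j hj]]
  exact pow_le_pow_left₀ (norm_nonneg _) (hb i) 2

/-- An operator with at most one non-zero matrix element in each row and column. -/
def IsShift (S : Setup k) (T : S.Op) : Prop :=
  (∀ η ζ ζ', T η ζ ≠ 0 → T η ζ' ≠ 0 → ζ = ζ') ∧ ∀ ζ η η', T η ζ ≠ 0 → T η' ζ ≠ 0 → η = η'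

theorem opNorm_le_of_isShift (S : Setup k) {T : S.Op} (hT : S.IsShift T) {b : ℝ} (hb0 : 0 ≤ b)
    (hb : ∀ η η', ‖T η η'‖ ≤ b) : S.opNorm T ≤ b := by
  refine ContinuousLinearMap.opNorm_le_bound _ hb0 fun v => ?_
  rw [← sq_le_sq₀ (norm_nonneg _) (by positivity), mul_pow, EuclideanSpace.norm_sq_eq,
    EuclideanSpace.norm_sq_eq]
  have h1 : ∀ η, ‖(Matrix.toEuclideanCLM (n := S.Conf) (𝕜 := ℂ) T v) η‖ ^ 2 =
      ∑ η', ‖T η η'‖ ^ 2 * ‖v η'‖ ^ 2 := by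
    intro η
    have : (Matrix.toEuclideanCLM (n := S.Conf) (𝕜 := ℂ) T v) η = ∑ η', T η η' * v η' := by
      rw [Matrix.ofLp_toEuclideanCLM]; rfl
    rw [this, norm_sum_sq_of_subsingleton]
    · simp only [norm_mul, mul_pow]
    · intro i j hi hj
      exact hT.1 η i j (left_ne_zero_of_mul hi) (left_ne_zero_of_mul hj)
  simp only [h1]
  rw [Finset.sum_comm, Finset.mul_sum]
  refine Finset.sum_le_sum fun η' _ => ?_
  rw [← Finset.sum_mul]
  refine mul_le_mul_of_nonneg_right ?_ (by positivity)
  exact sum_norm_sq_le_of_subsingleton (fun η => T η η') (fun η => hb η η') (hT.2 η')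

/-! ### Column-sum bounds -/

/-- The `ℓ¹` operator norm of `O` is at most `b`. In contrast with the `ℓ²` operator norm this bound is
inherited by every operator with smaller matrix elements. -/
def ColB (S : Setup k) (O : S.Op) (b : ℝ) : Prop := ∀ η', ∑ η, ‖O η η'‖ ≤ b

theorem ColB.mono {S : Setup k} {O : S.Op} {b b' : ℝ} (h : S.ColB O b) (hb : b ≤ b') :
    S.ColB O b' := fun η' => (h η').trans hb

theorem ColB.nonneg {S : Setup k} {O : S.Op} {b : ℝ} (h : S.ColB O b) : 0 ≤ b :=
  (Finset.sum_nonneg fun _ _ => norm_nonneg _).trans (h fun _ => 0)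

theorem ColB.norm_apply_le {S : Setup k} {O : S.Op} {b : ℝ} (h : S.ColB O b) (η η' : S.Conf) :
    ‖O η η'‖ ≤ b :=
  (Finset.single_le_sum (f := fun η => ‖O η η'‖) (fun _ _ => norm_nonneg _)
    (Finset.mem_univ η)).trans (h η')

theorem ColB.of_le {S : Setup k} {O O' : S.Op} {b : ℝ} (h : S.ColB O b)
    (hO : ∀ η η', ‖O' η η'‖ ≤ ‖O η η'‖) : S.ColB O' b :=
  fun η' => (Finset.sum_le_sum fun η _ => hO η η').trans (h η')

theorem ColB.zero (S : Setup k) : S.ColB 0 0 := fun _ => by simp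

theorem ColB.add {S : Setup k} {O₁ O₂ : S.Op} {b₁ b₂ : ℝ} (h₁ : S.ColB O₁ b₁) (h₂ : S.ColB O₂ b₂) :
    S.ColB (O₁ + O₂) (b₁ + b₂) := fun η' => by
  refine (Finset.sum_le_sum fun η _ => norm_add_le (O₁ η η') (O₂ η η')).trans ?_
  rw [Finset.sum_add_distrib]
  exact add_le_add (h₁ η') (h₂ η')

theorem ColB.smul {S : Setup k} {O : S.Op} {b : ℝ} (h : S.ColB O b) (c : ℂ) :
    S.ColB (c • O) (‖c‖ * b) := fun η' => by
  simp only [Matrix.smul_apply, smul_eq_mul, norm_mul, ← Finset.mul_sum]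
  exact mul_le_mul_of_nonneg_left (h η') (norm_nonneg _)

theorem ColB.neg {S : Setup k} {O : S.Op} {b : ℝ} (h : S.ColB O b) : S.ColB (-O) b :=
  h.of_le fun η η' => by simp

theorem ColB.sub {S : Setup k} {O₁ O₂ : S.Op} {b₁ b₂ : ℝ} (h₁ : S.ColB O₁ b₁) (h₂ : S.ColB O₂ b₂) :
    S.ColB (O₁ - O₂) (b₁ + b₂) := by
  rw [sub_eq_add_neg]
  exact h₁.add h₂.neg

theorem ColB.sum {S : Setup k} {ι : Type*} {s : Finset ι} {O : ι → S.Op} {b : ι → ℝ}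
    (h : ∀ i ∈ s, S.ColB (O i) (b i)) : S.ColB (∑ i ∈ s, O i) (∑ i ∈ s, b i) := by
  classical
  induction s using Finset.induction_on with
  | empty => simpa using ColB.zero S
  | insert i s hi ih =>
    rw [Finset.sum_insert hi, Finset.sum_insert hi]
    exact (h i (by simp)).add (ih fun j hj => h j (by simp [hj]))

theorem ColB.mul {S : Setup k} {O₁ O₂ : S.Op} {b₁ b₂ : ℝ} (h₁ : S.ColB O₁ b₁) (h₂ : S.ColB O₂ b₂) :
    S.ColB (O₁ * O₂) (b₁ * b₂) := fun η' => by
  calc _ ≤ ∑ η, ∑ ζ, ‖O₁ η ζ‖ * ‖O₂ ζ η'‖ := by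
        refine Finset.sum_le_sum fun η _ => ?_
        rw [Matrix.mul_apply]
        refine (norm_sum_le _ _).trans (Finset.sum_le_sum fun ζ _ => ?_)
        rw [norm_mul]
    _ = ∑ ζ, (∑ η, ‖O₁ η ζ‖) * ‖O₂ ζ η'‖ := by
        rw [Finset.sum_comm]
        simp only [Finset.sum_mul]
    _ ≤ ∑ ζ, b₁ * ‖O₂ ζ η'‖ :=
        Finset.sum_le_sum fun ζ _ => mul_le_mul_of_nonneg_right (h₁ ζ) (norm_nonneg _)
    _ ≤ b₁ * b₂ := by
        rw [← Finset.mul_sum]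
        exact mul_le_mul_of_nonneg_left (h₂ η') h₁.nonneg

theorem ColB.comm {S : Setup k} {O₁ O₂ : S.Op} {b₁ b₂ : ℝ} (h₁ : S.ColB O₁ b₁) (h₂ : S.ColB O₂ b₂) :
    S.ColB (S.comm O₁ O₂) (2 * (b₁ * b₂)) := by
  refine ((h₁.mul h₂).sub (h₂.mul h₁)).mono (le_of_eq ?_)
  ring

theorem ColB.summable {S : Setup k} {O : ℕ → S.Op} {b : ℕ → ℝ} (h : ∀ n, S.ColB (O n) (b n))
    (hb : Summable b) : Summable O := by
  refine Pi.summable.2 fun η => Pi.summable.2 fun η' => ?_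
  exact Summable.of_norm_bounded hb fun n => (h n).norm_apply_le η η'

theorem tsum_op_apply {S : Setup k} {O : ℕ → S.Op} (hs : Summable O) (η η' : S.Conf) :
    (∑' n, O n) η η' = ∑' n, O n η η' := by
  have h1 : ∀ ξ, Summable fun n => O n ξ := Pi.summable.1 hs
  exact (congrFun (tsum_apply hs) η').trans (tsum_apply (h1 η))

theorem ColB.tsum {S : Setup k} {O : ℕ → S.Op} {b : ℕ → ℝ} (h : ∀ n, S.ColB (O n) (b n))
    (hb : Summable b) : S.ColB (∑' n, O n) (∑' n, b n) := fun η' => by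
  have hs := ColB.summable h hb
  have hn : ∀ η, Summable fun n => ‖O n η η'‖ := fun η =>
    Summable.of_nonneg_of_le (fun _ => norm_nonneg _) (fun n => (h n).norm_apply_le η η') hb
  calc _ ≤ ∑ η, ∑' n, ‖O n η η'‖ := by
        refine Finset.sum_le_sum fun η _ => ?_
        rw [tsum_op_apply hs]
        exact norm_tsum_le_tsum_norm (hn η)
    _ = ∑' n, ∑ η, ‖O n η η'‖ := (Summable.tsum_finsetSum fun η _ => hn η).symm
    _ ≤ _ := (summable_sum fun η _ => hn η).tsum_le_tsum (fun n => h n η') hb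

/-! ### Distances and connected sets of sites -/

theorem eucl_eq_norm {ι : Type*} [Fintype ι] (v : ι → ℤ) :
    eucl v = ‖(WithLp.toLp 2 fun i => (v i : ℝ) : EuclideanSpace ℝ ι)‖ := by
  rw [eucl, EuclideanSpace.norm_eq]
  simp

theorem eucl_add_le {ι : Type*} [Fintype ι] (v w : ι → ℤ) : eucl (v + w) ≤ eucl v + eucl w := by
  simp only [eucl_eq_norm]
  refine le_trans (le_of_eq ?_) (norm_add_le _ _)
  congr 1
  ext i
  simp

theorem eucl_neg {ι : Type*} [Fintype ι] (v : ι → ℤ) : eucl (-v) = eucl v := by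
  simp [eucl]

theorem eucl_zero {ι : Type*} [Fintype ι] : eucl (0 : ι → ℤ) = 0 := by
  simp [eucl]

theorem eucl_sub_comm {ι : Type*} [Fintype ι] (v w : ι → ℤ) : eucl (v - w) = eucl (w - v) := by
  rw [← eucl_neg, neg_sub]

theorem eucl_sub_le {ι : Type*} [Fintype ι] (u v w : ι → ℤ) :
    eucl (u - w) ≤ eucl (u - v) + eucl (v - w) := by
  have := eucl_add_le (u - v) (v - w)
  rwa [sub_add_sub_cancel] at this

theorem abs_apply_le_eucl {ι : Type*} [Fintype ι] (v : ι → ℤ) (i : ι) : |(v i : ℝ)| ≤ eucl v := by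
  rw [eucl, ← Real.sqrt_sq_eq_abs]
  exact Real.sqrt_le_sqrt (Finset.single_le_sum (f := fun i => (v i : ℝ) ^ 2)
    (fun i _ => sq_nonneg _) (Finset.mem_univ i))

theorem eucl_le_sum {ι : Type*} [Fintype ι] (v : ι → ℤ) : eucl v ≤ ∑ i, |(v i : ℝ)| := by
  refine Real.sqrt_le_iff.2 ⟨Finset.sum_nonneg fun _ _ => abs_nonneg _, ?_⟩
  simp only [← sq_abs (v _ : ℝ)]
  exact Finset.sum_sq_le_sq_sum_of_nonneg fun i _ => abs_nonneg _

theorem nnGraph_adj {S : Setup k} {x z : S.Pt} :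
    S.nnGraph.Adj x z ↔ x ≠ z ∧ eucl (x.1 - z.1) = 1 := by
  rw [nnGraph, SimpleGraph.fromRel_adj, eucl_sub_comm z.1 x.1, or_self]

theorem Conn.nonempty {S : Setup k} {A : Finset S.Pt} (h : S.Conn A) : A.Nonempty := by
  obtain ⟨x⟩ := SimpleGraph.Connected.nonempty h
  exact ⟨x.1, x.2⟩

theorem Conn.union {S : Setup k} {A B : Finset S.Pt} [DecidableEq S.Pt] (hA : S.Conn A)
    (hB : S.Conn B) (h : ¬ Disjoint A B) : S.Conn (A ∪ B) := by
  obtain ⟨x, hxA, hxB⟩ := Finset.not_disjoint_iff.1 h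
  unfold Conn
  rw [Finset.coe_union]
  exact SimpleGraph.induce_union_connected hA.preconnected hB.preconnected ⟨x, hxA, hxB⟩

theorem conn_singleton (S : Setup k) (x : S.Pt) : S.Conn {x} := by
  unfold Conn
  rw [Finset.coe_singleton]
  have : Nonempty (({x} : Set S.Pt)) := ⟨⟨x, rfl⟩⟩
  refine ⟨fun a b => ?_⟩
  have : a = b := Subsingleton.elim _ _
  rw [this]

theorem mem_star {S : Setup k} {x z : S.Pt} : z ∈ S.star x ↔ eucl (z.1 - x.1) ≤ 1 := by
  simp [star]

theorem self_mem_star (S : Setup k) (x : S.Pt) : x ∈ S.star x := by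
  rw [mem_star, sub_self, eucl_zero]; exact zero_le_one

theorem abs_apply_le_one_of_eucl_le_one {ι : Type*} [Fintype ι] {v : ι → ℤ} (h : eucl v ≤ 1) (i : ι) :
    |v i| ≤ 1 := by
  have := (abs_apply_le_eucl v i).trans h
  exact_mod_cast this

theorem eucl_eq_one_of_le {ι : Type*} [Fintype ι] {v : ι → ℤ} (h : eucl v ≤ 1) (hv : v ≠ 0) :
    eucl v = 1 := by
  refine le_antisymm h ?_
  obtain ⟨i, hi⟩ := Function.ne_iff.1 hv
  refine le_trans ?_ (abs_apply_le_eucl v i)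
  exact_mod_cast Int.one_le_abs hi

theorem conn_star (S : Setup k) (x : S.Pt) : S.Conn (S.star x) := by
  unfold Conn
  rw [SimpleGraph.connected_iff_exists_forall_reachable]
  refine ⟨⟨x, S.self_mem_star x⟩, fun z => ?_⟩
  by_cases hz : z.1 = x
  · have : z = ⟨x, S.self_mem_star x⟩ := Subtype.ext hz
    rw [this]
  · refine SimpleGraph.Adj.reachable ?_
    rw [SimpleGraph.comap_adj]
    refine nnGraph_adj.2 ⟨fun h => hz h.symm, ?_⟩
    have h1 : eucl (z.1.1 - x.1) ≤ 1 := mem_star.1 z.2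
    rw [eucl_sub_comm] at h1
    refine eucl_eq_one_of_le h1 fun h => hz (Subtype.ext ?_)
    exact (sub_eq_zero.1 h).symm

theorem card_le_of_forall_abs_sub_le (S : Setup k) (A : Finset S.Pt) (c : Site k) (m : ℕ)
    (h : ∀ x ∈ A, ∀ i, |x.1 i - c i| ≤ m) : A.card ≤ (2 * m + 1) ^ (k + 1) := by
  classical
  have h1 : A.card ≤ (box (Fin (k + 1)) m).card := by
    refine Finset.card_le_card_of_injOn (fun x => x.1 - c) (fun x hx => ?_) fun x _ y _ hxy => ?_
    · exact mem_box.2 fun i => h x hx i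
    · exact Subtype.ext (sub_left_injective hxy)
  rwa [card_box, Fintype.card_fin] at h1

theorem card_star_le (S : Setup k) (x : S.Pt) : (S.star x).card ≤ 3 ^ (k + 1) := by
  have := S.card_le_of_forall_abs_sub_le (S.star x) x.1 1 fun z hz i => by
    simpa using abs_apply_le_one_of_eucl_le_one (mem_star.1 hz) i
  simpa using this

/-- A connected set of `n` sites has diameter at most `n`. -/
theorem Conn.eucl_sub_le {S : Setup k} {A : Finset S.Pt} (hA : S.Conn A) {x z : S.Pt} (hx : x ∈ A)
    (hz : z ∈ A) : eucl (x.1 - z.1) ≤ A.card := by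
  classical
  have hw : ∀ {a b : (A : Set S.Pt)} (w : (S.nnGraph.induce (A : Set S.Pt)).Walk a b),
      eucl (a.1.1 - b.1.1) ≤ w.length := by
    intro a b w
    induction w with
    | nil => simp [eucl_zero]
    | @cons u v w h p ih =>
      have h1 : eucl (u.1.1 - v.1.1) = 1 := (nnGraph_adj.1 (SimpleGraph.comap_adj.1 h)).2
      have h2 := Setup.eucl_sub_le u.1.1 v.1.1 w.1.1
      rw [SimpleGraph.Walk.length_cons]
      push_cast
      linarith
  obtain ⟨p, hp⟩ := hA.preconnected.exists_isPath ⟨x, hx⟩ ⟨z, hz⟩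
  have h1 := hw p
  have h2 := hp.length_lt
  have h3 : Fintype.card (A : Set S.Pt) = A.card := by simp
  rw [h3] at h2
  have h4 : (p.length : ℝ) ≤ A.card := by exact_mod_cast h2.le
  exact h1.trans h4

/-! ### Algebra of interaction potentials -/

/-- A potential whose terms are supported on their index sets and vanish off the connected sets. -/
structure IsLocal (S : Setup k) (B : S.Pot) : Prop where
  loc : ∀ A, S.Loc A (B A)
  conn : ∀ A, ¬ S.Conn A → B A = 0

/-- The term of `B` at a set `A` with at most `r` sites is bounded by `b w ^ |A|` in the `ℓ¹` operator
norm; the weight `w ≤ 1` records the order in perturbation theory. With `|A|` bounded, `A` is a union of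
two sets in at most `4 ^ r` ways, so that bounds of this type are uniform in the volume. -/
def PotB (S : Setup k) (w : ℝ) (B : S.Pot) (b : ℝ) : Prop :=
  ∀ A : Finset S.Pt, A.card ≤ S.r → S.ColB (B A) (b * w ^ A.card)

theorem IsLocal.add {S : Setup k} {B₁ B₂ : S.Pot} (h₁ : S.IsLocal B₁) (h₂ : S.IsLocal B₂) :
    S.IsLocal (B₁ + B₂) :=
  ⟨fun A => (h₁.loc A).add (h₂.loc A), fun A hA => by
    rw [Pi.add_apply, h₁.conn A hA, h₂.conn A hA, add_zero]⟩

theorem IsLocal.sub {S : Setup k} {B₁ B₂ : S.Pot} (h₁ : S.IsLocal B₁) (h₂ : S.IsLocal B₂) :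
    S.IsLocal (B₁ - B₂) :=
  ⟨fun A => (h₁.loc A).sub (h₂.loc A), fun A hA => by
    rw [Pi.sub_apply, h₁.conn A hA, h₂.conn A hA, sub_zero]⟩

/-- Multiplying the matrix elements at `A` by functions of the occupations in `A`. -/
theorem IsLocal.of_mul {S : Setup k} {B B' : S.Pot} (h : S.IsLocal B)
    (f : Finset S.Pt → S.Conf → S.Conf → ℂ)
    (hf : ∀ A, ∀ η η' ξ ξ' : S.Conf, (∀ x ∈ A, η x = ξ x) → (∀ x ∈ A, η' x = ξ' x) →
      f A η η' = f A ξ ξ')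
    (hB' : ∀ A η η', B' A η η' = f A η η' * B A η η') : S.IsLocal B' := by
  refine ⟨fun A => (h.loc A).of_mul (f A) (hf A) (hB' A), fun A hA => ?_⟩
  ext η η'
  rw [hB', h.conn A hA]
  simp

theorem IsLocal.potAd {S : Setup k} {K B : S.Pot} (hK : S.IsLocal K) (hB : S.IsLocal B) :
    S.IsLocal (S.potAd K B) := by
  classical
  refine ⟨fun A => Loc.sum fun p _ => ?_, fun A hA => Finset.sum_eq_zero fun p _ => ?_⟩
  · by_cases hp : p.1 ∪ p.2 = A
    · simp only [hp, if_true]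
      refine Loc.comm ((hK.loc _).mono ?_) ((hB.loc _).mono ?_)
      · rw [← hp]; exact Finset.subset_union_left
      · rw [← hp]; exact Finset.subset_union_right
    · simp only [hp, if_false]
      exact Loc.zero S A
  · by_cases hp : p.1 ∪ p.2 = A
    swap
    · simp only [hp, if_false]
    simp only [hp, if_true]
    by_cases h1 : S.Conn p.1
    swap
    · simp [hK.conn _ h1, Setup.comm]
    by_cases h2 : S.Conn p.2
    swap
    · simp [hB.conn _ h2, Setup.comm]
    by_cases hd : Disjoint p.1 p.2
    · exact (hK.loc _).comm_eq_zero (hB.loc _) hd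
    · exact absurd (hp ▸ h1.union h2 hd) hA

theorem IsLocal.iterate_potAd {S : Setup k} {K B : S.Pot} (hK : S.IsLocal K) (hB : S.IsLocal B)
    (n : ℕ) : S.IsLocal ((S.potAd K)^[n] B) := by
  induction n with
  | zero => exact hB
  | succ n ih =>
    rw [Function.iterate_succ_apply']
    exact hK.potAd ih

theorem IsLocal.expAd {S : Setup k} {K B : S.Pot} (hK : S.IsLocal K) (hB : S.IsLocal B) :
    S.IsLocal (S.expAd K B) := by
  refine ⟨fun A => Loc.tsum fun n => ((hK.iterate_potAd hB n).loc A).smul _, fun A hA => ?_⟩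
  have : ∀ n : ℕ, ((n.factorial : ℂ))⁻¹ • ((S.potAd K)^[n] B) A = 0 := fun n => by
    rw [(hK.iterate_potAd hB n).conn A hA, smul_zero]
  rw [Setup.expAd]
  simp only [this, tsum_zero]

theorem potAd_add (S : Setup k) (K B₁ B₂ : S.Pot) :
    S.potAd K (B₁ + B₂) = S.potAd K B₁ + S.potAd K B₂ := by
  classical
  funext A
  simp only [potAd, Pi.add_apply, ← Finset.sum_add_distrib]
  refine Finset.sum_congr rfl fun p _ => ?_
  split_ifs
  · simp only [comm, mul_add, add_mul]; abel
  · simp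

theorem iterate_potAd_add (S : Setup k) (K B₁ B₂ : S.Pot) (n : ℕ) :
    (S.potAd K)^[n] (B₁ + B₂) = (S.potAd K)^[n] B₁ + (S.potAd K)^[n] B₂ := by
  induction n with
  | zero => rfl
  | succ n ih => simp only [Function.iterate_succ_apply', ih, potAd_add]

/-- The weights are submultiplicative since `|A₁ ∪ A₂| ≤ |A₁| + |A₂|`. -/
theorem PotB.potAd {S : Setup k} {w : ℝ} (hw : 0 ≤ w) (hw1 : w ≤ 1) {K B : S.Pot} {κ b : ℝ}
    (hκ : 0 ≤ κ) (hb : 0 ≤ b) (hK : S.PotB w K κ) (hB : S.PotB w B b) :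
    S.PotB w (S.potAd K B) (2 * 4 ^ S.r * κ * b) := by
  classical
  intro A hA
  have hsum : S.potAd K B A = ∑ p ∈ A.powerset ×ˢ A.powerset,
      if p.1 ∪ p.2 = A then S.comm (K p.1) (B p.2) else 0 := by
    symm
    refine (Finset.sum_subset (Finset.subset_univ _) fun p _ hp => if_neg fun h => hp ?_).trans ?_
    · rw [Finset.mem_product, Finset.mem_powerset, Finset.mem_powerset, ← h]
      exact ⟨Finset.subset_union_left, Finset.subset_union_right⟩
    · unfold Setup.potAd
      exact Finset.sum_congr rfl fun p _ => by congr
  rw [hsum]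
  have hterm : ∀ p ∈ A.powerset ×ˢ A.powerset,
      S.ColB (if p.1 ∪ p.2 = A then S.comm (K p.1) (B p.2) else 0) (2 * (κ * b * w ^ A.card)) := by
    intro p hp
    rw [Finset.mem_product, Finset.mem_powerset, Finset.mem_powerset] at hp
    split_ifs with h
    · have h1 := hK p.1 ((Finset.card_le_card hp.1).trans hA)
      have h2 := hB p.2 ((Finset.card_le_card hp.2).trans hA)
      refine (h1.comm h2).mono ?_
      have h3 : w ^ (p.1.card + p.2.card) ≤ w ^ A.card := by
        refine pow_le_pow_of_le_one hw hw1 ?_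
        rw [← h]
        exact Finset.card_union_le _ _
      rw [pow_add] at h3
      have h4 : κ * w ^ p.1.card * (b * w ^ p.2.card) ≤ κ * b * w ^ A.card := by
        calc _ = κ * b * (w ^ p.1.card * w ^ p.2.card) := by ring
          _ ≤ _ := mul_le_mul_of_nonneg_left h3 (mul_nonneg hκ hb)
      linarith
    · refine (ColB.zero S).mono ?_
      have := pow_nonneg hw A.card
      positivity
  refine (ColB.sum hterm).mono ?_
  rw [Finset.sum_const, Finset.card_product, Finset.card_powerset, nsmul_eq_mul]
  have h4 : ((2 ^ A.card * 2 ^ A.card : ℕ) : ℝ) ≤ 4 ^ S.r := by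
    push_cast
    rw [← mul_pow]
    norm_num
    exact pow_le_pow_right₀ (by norm_num) hA
  have h5 : 0 ≤ 2 * (κ * b * w ^ A.card) := by
    have := pow_nonneg hw A.card
    positivity
  calc _ ≤ 4 ^ S.r * (2 * (κ * b * w ^ A.card)) := mul_le_mul_of_nonneg_right h4 h5
    _ = _ := by ring

theorem PotB.iterate_potAd {S : Setup k} {w : ℝ} (hw : 0 ≤ w) (hw1 : w ≤ 1) {K B : S.Pot} {κ b : ℝ}
    (hκ : 0 ≤ κ) (hb : 0 ≤ b) (hK : S.PotB w K κ) (hB : S.PotB w B b) (n : ℕ) :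
    S.PotB w ((S.potAd K)^[n] B) ((2 * 4 ^ S.r * κ) ^ n * b) := by
  induction n with
  | zero => simpa using hB
  | succ n ih =>
    rw [Function.iterate_succ_apply', pow_succ', mul_assoc]
    exact hK.potAd hw hw1 hκ (by positivity) ih

theorem PotB.neg {S : Setup k} {w : ℝ} {B : S.Pot} {b : ℝ} (h : S.PotB w B b) : S.PotB w (-B) b :=
  fun A hA => (h A hA).neg

theorem cutoff_numPow (S : Setup k) (x : S.Pt) :
    S.cutoff (S.numPow x) = Matrix.diagonal fun η => ((((η x : ℕ) : ℝ) ^ S.q : ℝ) : ℂ) := by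
  classical
  ext η η'
  have hinj : ((fun y => (η' y : ℕ)) = fun y => (η y : ℕ)) ↔ η' = η := by
    constructor
    · exact fun h => funext fun y => Fin.ext (congrFun h y)
    · rintro rfl; rfl
  simp only [cutoff, numPow, Matrix.of_apply, Finsupp.lsum_single, LinearMap.smul_apply,
    Finsupp.lsingle_apply, Finsupp.smul_apply, Finsupp.single_apply, hinj, Matrix.diagonal_apply]
  by_cases h : η = η'
  · simp [h]
  · simp [h, Ne.symm h]

theorem freePot_eq (S : Setup k) (A : Finset S.Pt) :
    S.freePot A = ∑ x : S.Pt, if A = {x} then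
      Matrix.diagonal (fun η : S.Conf => ((((η x : ℕ) : ℝ) ^ S.q : ℝ) : ℂ)) else 0 := by
  classical
  unfold freePot
  refine Finset.sum_congr rfl fun x _ => ?_
  rw [cutoff_numPow]

theorem loc_numPow (S : Setup k) (x : S.Pt) :
    S.Loc {x} (Matrix.diagonal (fun η : S.Conf => ((((η x : ℕ) : ℝ) ^ S.q : ℝ) : ℂ))) :=
  Loc.diagonal _ fun η ξ h => by rw [h x (by simp)]

theorem isLocal_freePot (S : Setup k) : S.IsLocal S.freePot := by
  classical
  refine ⟨fun A => ?_, fun A hA => ?_⟩ <;> rw [freePot_eq]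
  · refine Loc.sum fun x _ => ?_
    split_ifs with h
    · rw [h]; exact S.loc_numPow x
    · exact Loc.zero S A
  · refine Finset.sum_eq_zero fun x _ => if_neg fun h => hA ?_
    rw [h]
    exact S.conn_singleton x

/-- The commutator with the free potential, set by set: `[K(A), N_x ^ q]` vanishes unless `x ∈ A`, and
then it contributes to the same set `A`. -/
theorem potAd_freePot {S : Setup k} {K F : S.Pot} (hK : S.IsLocal K)
    (hF : ∀ A η η', K A η η' * ((S.energy A η - S.energy A η' : ℝ) : ℂ) = F A η η') :
    S.potAd K S.freePot = -F := by
  classical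
  funext A
  set N : S.Pt → S.Op := fun x =>
    Matrix.diagonal (fun η : S.Conf => ((((η x : ℕ) : ℝ) ^ S.q : ℝ) : ℂ)) with hN
  have h1 : S.potAd K S.freePot A =
      ∑ A₁ : Finset S.Pt, ∑ x : S.Pt, if A₁ ∪ {x} = A then S.comm (K A₁) (N x) else 0 := by
    unfold potAd
    rw [Fintype.sum_prod_type]
    refine Finset.sum_congr rfl fun A₁ _ => ?_
    have h2 : ∀ A₂ : Finset S.Pt, (if A₁ ∪ A₂ = A then S.comm (K A₁) (S.freePot A₂) else 0) =
        ∑ x : S.Pt, if A₂ = {x} then (if A₁ ∪ A₂ = A then S.comm (K A₁) (N x) else 0) else 0 := by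
      intro A₂
      rw [freePot_eq]
      split_ifs with h
      · simp only [Setup.comm, Finset.mul_sum, Finset.sum_mul, ← Finset.sum_sub_distrib]
        refine Finset.sum_congr rfl fun x _ => ?_
        split_ifs
        · rfl
        · simp
      · simp
    calc _ = ∑ A₂ : Finset S.Pt, (if A₁ ∪ A₂ = A then S.comm (K A₁) (S.freePot A₂) else 0) :=
          Finset.sum_congr rfl fun _ _ => by congr
      _ = _ := by
        simp only [h2]
        rw [Finset.sum_comm]
        refine Finset.sum_congr rfl fun x _ => ?_
        rw [Finset.sum_ite_eq' Finset.univ ({x} : Finset S.Pt)]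
        simp
  have h3 : S.potAd K S.freePot A = ∑ x ∈ A, S.comm (K A) (N x) := by
    rw [h1, Finset.sum_comm, ← Finset.sum_filter_add_sum_filter_not Finset.univ (fun x => x ∈ A)]
    have h4 : ∀ x : S.Pt, ∀ A₁ : Finset S.Pt, A₁ ≠ A →
        (if A₁ ∪ {x} = A then S.comm (K A₁) (N x) else 0) = 0 := by
      intro x A₁ hne
      split_ifs with h
      · refine (hK.loc A₁).comm_eq_zero (S.loc_numPow x) ?_
        rw [Finset.disjoint_singleton_right]
        intro hx
        exact hne (by rw [← h]; ext y; simp; rintro rfl; exact hx)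
      · rfl
    have h5 : ∀ x : S.Pt, (∑ A₁ : Finset S.Pt, if A₁ ∪ {x} = A then S.comm (K A₁) (N x) else 0) =
        if x ∈ A then S.comm (K A) (N x) else 0 := by
      intro x
      rw [Finset.sum_eq_single A (fun A₁ _ hne => h4 x A₁ hne) (by simp)]
      refine if_congr ?_ rfl rfl
      simp
    simp only [h5]
    rw [Finset.sum_filter_add_sum_filter_not, Finset.sum_ite_mem, Finset.univ_inter]
  rw [h3]
  ext η η'
  rw [Pi.neg_apply, Matrix.neg_apply, ← hF A η η', Matrix.sum_apply]
  have h6 : ∀ x, S.comm (K A) (N x) η η' =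
      K A η η' * (((((η' x : ℕ) : ℝ) ^ S.q : ℝ) : ℂ) - ((((η x : ℕ) : ℝ) ^ S.q : ℝ) : ℂ)) := by
    intro x
    rw [Setup.comm, Matrix.sub_apply, hN, Matrix.mul_diagonal, Matrix.diagonal_mul]
    ring
  simp only [h6, ← Finset.mul_sum, Finset.sum_sub_distrib]
  simp only [energy]
  push_cast
  ring

/-- One step of the perturbative diagonalization. Since `[K, E₀] = -F'` with `F'` part of `F`, all the
commutators in the exponential series are bounded by those of `F`. -/
theorem PotB.expAd {S : Setup k} {w : ℝ} (hw : 0 ≤ w) (hw1 : w ≤ 1) {K F F' : S.Pot} {κ b : ℝ}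
    (hκ : 1 ≤ κ) (hb : 0 ≤ b) (hK : S.PotB w K κ) (hF : S.PotB w F b) (hF' : S.PotB w F' b)
    (hE : S.potAd K S.freePot = -F') :
    S.PotB w (S.expAd K (S.freePot + F) - S.freePot)
      (2 * b * ∑' n : ℕ, (2 * 4 ^ S.r * κ) ^ n / n.factorial) := by
  intro A hA
  have ht1 : 1 ≤ 2 * 4 ^ S.r * κ := by
    have : (1 : ℝ) ≤ 4 ^ S.r := one_le_pow₀ (by norm_num)
    nlinarith
  set t := 2 * 4 ^ S.r * κ with ht
  set u : ℕ → S.Op := fun n =>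
    ((n.factorial : ℂ))⁻¹ • ((S.potAd K)^[n] (S.freePot + F)) A with hu
  set v : ℕ → S.Op := fun n => u n - if n = 0 then S.freePot A else 0 with hv
  have hW : 0 ≤ w ^ A.card := pow_nonneg hw _
  have hvb : ∀ n, S.ColB (v n) (2 * b * w ^ A.card * (t ^ n / n.factorial)) := by
    intro n
    have hFn := hK.iterate_potAd hw hw1 (by linarith) hb hF n A hA
    rw [← ht] at hFn
    rcases n with _ | n
    · have : v 0 = F A := by simp [hv, hu]
      rw [this]
      refine (hF A hA).mono ?_
      simp
      nlinarith [mul_nonneg hb hW]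
    · have hF'n := (hK.iterate_potAd hw hw1 (by linarith) hb hF'.neg n) A hA
      rw [← ht] at hF'n
      have : v (n + 1) = (((n + 1).factorial : ℂ))⁻¹ •
          (((S.potAd K)^[n] (-F')) A + ((S.potAd K)^[n + 1] F) A) := by
        simp only [hv, hu, Nat.add_eq_zero_iff, one_ne_zero, and_false, if_false, sub_zero]
        rw [iterate_potAd_add, Function.iterate_succ_apply (f := S.potAd K) (x := S.freePot), hE]
        rfl
      rw [this]
      refine ((hF'n.add hFn).smul _).mono ?_
      rw [norm_inv, Complex.norm_natCast, inv_mul_eq_div,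
        div_le_iff₀ (by positivity)]
      have h1 : t ^ n ≤ t ^ (n + 1) := pow_le_pow_right₀ ht1 (by omega)
      have h2 : 2 * b * w ^ A.card * (t ^ (n + 1) / (n + 1).factorial) * ((n + 1).factorial : ℝ) =
          t ^ (n + 1) * (b * w ^ A.card) + t ^ (n + 1) * (b * w ^ A.card) := by
        field_simp
        ring
      rw [h2, mul_assoc, mul_assoc]
      have := mul_le_mul_of_nonneg_right h1 (mul_nonneg hb hW)
      linarith
  have hsum : Summable fun n : ℕ => 2 * b * w ^ A.card * (t ^ n / n.factorial) :=
    (Real.summable_pow_div_factorial t).mul_left _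
  have hvs := ColB.summable hvb hsum
  have huv : u = fun n => v n + if n = 0 then S.freePot A else 0 := by
    funext n
    simp [hv]
  have h0 : HasSum (fun n : ℕ => if n = 0 then S.freePot A else 0) (S.freePot A) := by
    simpa using hasSum_ite_eq (0 : ℕ) (S.freePot A)
  have hexp : (S.expAd K (S.freePot + F) - S.freePot) A = ∑' n, v n := by
    rw [Pi.sub_apply, sub_eq_iff_eq_add]
    change ∑' n, u n = _
    rw [huv]
    exact (hvs.hasSum.add h0).tsum_eq
  rw [hexp]
  refine (ColB.tsum hvb hsum).mono (le_of_eq ?_)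
  rw [tsum_mul_left]
  ring

/-! ### The interaction of the model -/

/-- `T` maps each number state to a multiple of a number state, acts on the sites of `A` only, and is
of order `j` in the creation and annihilation operators. -/
def IsMono (S : Setup k) (A : Finset S.Pt) (j : ℕ) (T : Module.End ℂ S.Fock) : Prop :=
  ∃ (F : (S.Pt → ℕ) → S.Pt → ℕ) (c : (S.Pt → ℕ) → ℂ),
    (∀ ξ, T (Finsupp.single ξ 1) = Finsupp.single (F ξ) (c ξ)) ∧
    (∀ ξ x, x ∉ A → F ξ x = ξ x) ∧
    (∀ ξ ξ', (∀ x ∈ A, ξ x = ξ' x) → (∀ x ∈ A, F ξ x = F ξ' x) ∧ c ξ = c ξ') ∧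
    ∀ ξ (m : ℕ), (∀ x, ξ x ≤ m) → (∀ x, F ξ x ≤ m + j) ∧ ‖c ξ‖ ≤ Real.sqrt (m + j) ^ j

theorem IsMono.mono {S : Setup k} {A B : Finset S.Pt} {j : ℕ} {T : Module.End ℂ S.Fock}
    (h : S.IsMono A j T) (hAB : A ⊆ B) : S.IsMono B j T := by
  obtain ⟨F, c, h1, h2, h3, h4⟩ := h
  refine ⟨F, c, h1, fun ξ x hx => h2 ξ x fun h => hx (hAB h), fun ξ ξ' hξ => ?_, h4⟩
  have h5 := h3 ξ ξ' fun x hx => hξ x (hAB hx)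
  refine ⟨fun x hx => ?_, h5.2⟩
  by_cases hA : x ∈ A
  · exact h5.1 x hA
  · rw [h2 ξ x hA, h2 ξ' x hA, hξ x hx]

theorem IsMono.mul {S : Setup k} {A : Finset S.Pt} {i j : ℕ} {T₁ T₂ : Module.End ℂ S.Fock}
    (hT₁ : S.IsMono A i T₁) (hT₂ : S.IsMono A j T₂) : S.IsMono A (j + i) (T₁ * T₂) := by
  obtain ⟨F, c, h1, h2, h3, h4⟩ := hT₁
  obtain ⟨F', c', h1', h2', h3', h4'⟩ := hT₂
  refine ⟨fun ξ => F (F' ξ), fun ξ => c' ξ * c (F' ξ), fun ξ => ?_, fun ξ x hx => ?_,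
    fun ξ ξ' hξ => ?_, fun ξ m hξ => ?_⟩
  · have : (Finsupp.single (F' ξ) (c' ξ) : S.Fock) = c' ξ • Finsupp.single (F' ξ) 1 := by simp
    rw [Module.End.mul_apply, h1', this, map_smul, h1]
    simp
  · exact (h2 _ x hx).trans (h2' _ x hx)
  · obtain ⟨e1, e2⟩ := h3' ξ ξ' hξ
    obtain ⟨e3, e4⟩ := h3 (F' ξ) (F' ξ') e1
    exact ⟨e3, by simp only [e2, e4]⟩
  · obtain ⟨e1, e2⟩ := h4' ξ m hξ
    obtain ⟨e3, e4⟩ := h4 (F' ξ) (m + j) e1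
    refine ⟨fun x => by rw [← add_assoc]; exact e3 x, ?_⟩
    rw [norm_mul, pow_add]
    push_cast at e4 ⊢
    rw [← add_assoc]
    refine mul_le_mul (e2.trans ?_) e4 (norm_nonneg _) (by positivity)
    have : Real.sqrt (m + j) ≤ Real.sqrt (m + j + i) := Real.sqrt_le_sqrt (by linarith [(Nat.cast_nonneg i : (0 : ℝ) ≤ i)])
    exact pow_le_pow_left₀ (Real.sqrt_nonneg _) this j

theorem isMono_lower (S : Setup k) (x : S.Pt) : S.IsMono {x} 1 (S.lower x) := by
  classical
  refine ⟨fun ξ => Function.update ξ x (ξ x - 1), fun ξ => ((Real.sqrt (ξ x) : ℝ) : ℂ), fun ξ => ?_,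
    fun ξ z hz => ?_, fun ξ ξ' hξ => ?_, fun ξ m hξ => ⟨fun z => ?_, ?_⟩⟩
  · simp only [lower, Finsupp.lsum_single, LinearMap.smul_apply, Finsupp.lsingle_apply,
      Finsupp.smul_single, smul_eq_mul, mul_one]
  · exact Function.update_of_ne (by simpa using hz) _ _
  · simp only [Finset.mem_singleton, forall_eq, Function.update_self] at hξ ⊢
    rw [hξ]
    exact ⟨rfl, rfl⟩
  · by_cases h : z = x
    · have := hξ x
      simp only [h, Function.update_self]
      omega
    · simp only [Function.update_of_ne h]
      exact (hξ z).trans (by omega)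
  · rw [Complex.norm_real, Real.norm_of_nonneg (Real.sqrt_nonneg _), pow_one]
    refine Real.sqrt_le_sqrt ?_
    have : ((ξ x : ℕ) : ℝ) ≤ m := by exact_mod_cast hξ x
    push_cast
    linarith

theorem isMono_raise (S : Setup k) (x : S.Pt) : S.IsMono {x} 1 (S.raise x) := by
  classical
  refine ⟨fun ξ => Function.update ξ x (ξ x + 1), fun ξ => ((Real.sqrt ((ξ x : ℝ) + 1) : ℝ) : ℂ),
    fun ξ => ?_, fun ξ z hz => ?_, fun ξ ξ' hξ => ?_, fun ξ m hξ => ⟨fun z => ?_, ?_⟩⟩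
  · simp only [raise, Finsupp.lsum_single, LinearMap.smul_apply, Finsupp.lsingle_apply,
      Finsupp.smul_single, smul_eq_mul, mul_one]
  · exact Function.update_of_ne (by simpa using hz) _ _
  · simp only [Finset.mem_singleton, forall_eq, Function.update_self] at hξ ⊢
    rw [hξ]
    exact ⟨rfl, rfl⟩
  · by_cases h : z = x
    · have := hξ x
      simp only [h, Function.update_self]
      omega
    · simp only [Function.update_of_ne h]
      exact (hξ z).trans (by omega)
  · rw [Complex.norm_real, Real.norm_of_nonneg (Real.sqrt_nonneg _), pow_one]
    refine Real.sqrt_le_sqrt ?_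
    have : ((ξ x : ℕ) : ℝ) ≤ m := by exact_mod_cast hξ x
    push_cast
    linarith

theorem natCoe_injective (S : Setup k) :
    Function.Injective fun (η : S.Conf) (x : S.Pt) => (η x : ℕ) :=
  fun _ _ h => funext fun x => Fin.ext (congrFun h x)

theorem IsMono.loc_cutoff {S : Setup k} {A : Finset S.Pt} {j : ℕ} {T : Module.End ℂ S.Fock}
    (h : S.IsMono A j T) : S.Loc A (S.cutoff T) := by
  classical
  obtain ⟨F, c, h1, h2, h3, h4⟩ := h
  have happ : ∀ η η' : S.Conf, S.cutoff T η η' =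
      if F (fun x => (η' x : ℕ)) = fun x => (η x : ℕ) then c (fun x => (η' x : ℕ)) else 0 := by
    intro η η'
    rw [cutoff, Matrix.of_apply, h1, Finsupp.single_apply]
  refine ⟨fun η η' hne x hx => ?_, fun π hπ η η' => ?_⟩
  · rw [happ] at hne
    split_ifs at hne with hF
    · have := congrFun hF x
      rw [h2 _ x hx] at this
      exact (Fin.ext this).symm
    · exact absurd rfl hne
  · rw [happ, happ]
    have h5 := h3 (fun x => ((π x (η' x) : S.Lvl) : ℕ)) (fun x => (η' x : ℕ))
      (fun x hx => by simp [hπ x hx])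
    rw [h5.2]
    refine if_congr ?_ rfl rfl
    rw [funext_iff, funext_iff]
    refine forall_congr' fun x => ?_
    by_cases hx : x ∈ A
    · rw [h5.1 x hx, hπ x hx]
      rfl
    · rw [h2 _ x hx, h2 _ x hx, Fin.val_inj, Fin.val_inj]
      simp

theorem IsMono.colB_cutoff {S : Setup k} {A : Finset S.Pt} {T : Module.End ℂ S.Fock}
    (h : S.IsMono A 2 T) (hM : 1 ≤ S.M) : S.ColB (S.cutoff T) (3 * S.M) := by
  classical
  obtain ⟨F, c, h1, h2, h3, h4⟩ := h
  intro η'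
  have h5 := (h4 (fun x => (η' x : ℕ)) ⌊S.M⌋₊ fun x => Nat.lt_succ_iff.1 (η' x).2).2
  have h6 : ‖c fun x => (η' x : ℕ)‖ ≤ 3 * S.M := by
    refine h5.trans ?_
    push_cast
    rw [Real.sq_sqrt (by positivity)]
    have := Nat.floor_le (by linarith : 0 ≤ S.M)
    linarith
  by_cases hex : ∃ η₀ : S.Conf, F (fun x => (η' x : ℕ)) = fun x => (η₀ x : ℕ)
  · obtain ⟨η₀, hη₀⟩ := hex
    rw [Finset.sum_eq_single η₀]
    · rw [cutoff, Matrix.of_apply, h1, hη₀, Finsupp.single_eq_same]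
      exact h6
    · intro η _ hne
      rw [cutoff, Matrix.of_apply, h1, hη₀, Finsupp.single_eq_of_ne, norm_zero]
      exact fun h => hne (S.natCoe_injective h)
    · simp
  · refine le_trans (le_of_eq (Finset.sum_eq_zero fun η _ => ?_)) (by linarith)
    rw [cutoff, Matrix.of_apply, h1, Finsupp.single_eq_of_ne, norm_zero]
    exact fun h => hex ⟨η, h.symm⟩

theorem cutoff_add (S : Setup k) (T₁ T₂ : Module.End ℂ S.Fock) :
    S.cutoff (T₁ + T₂) = S.cutoff T₁ + S.cutoff T₂ := by
  ext η η'; simp [cutoff]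

theorem cutoff_smul (S : Setup k) (c : ℂ) (T : Module.End ℂ S.Fock) :
    S.cutoff (c • T) = c • S.cutoff T := by
  ext η η'; simp [cutoff]

theorem cutoff_zero (S : Setup k) : S.cutoff 0 = 0 := by
  ext η η'; simp [cutoff]

theorem cutoff_sum (S : Setup k) {ι : Type*} (s : Finset ι) (T : ι → Module.End ℂ S.Fock) :
    S.cutoff (∑ i ∈ s, T i) = ∑ i ∈ s, S.cutoff (T i) := by
  classical
  induction s using Finset.induction_on with
  | empty => simpa using S.cutoff_zero
  | insert i s hi ih => rw [Finset.sum_insert hi, Finset.sum_insert hi, cutoff_add, ih]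

open Classical in
theorem cutoff_siteInteraction (S : Setup k) (x : S.Pt) : S.cutoff (S.siteInteraction x) =
    (S.g₁ : ℂ) • (S.cutoff (S.lower x * S.lower x) + S.cutoff (S.raise x * S.lower x) +
      (S.cutoff (S.lower x * S.raise x) + S.cutoff (S.raise x * S.raise x))) +
    (1 / 2 : ℂ) • ∑ z ∈ (S.star x).filter (fun z => S.nnGraph.Adj x z), (S.g₂ : ℂ) •
      (S.cutoff (S.raise x * S.lower z) + S.cutoff (S.lower x * S.raise z)) := by
  classical
  have h1 : (S.lower x + S.raise x) ^ 2 = S.lower x * S.lower x + S.raise x * S.lower x +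
      (S.lower x * S.raise x + S.raise x * S.raise x) := by
    rw [sq, mul_add, add_mul, add_mul]
  have h2 : ∀ z : S.Pt, S.nnGraph.Adj x z → z ∈ S.star x := by
    intro z hz
    rw [mem_star, eucl_sub_comm]
    exact (nnGraph_adj.1 hz).2.le
  have h3 : (S.star x).filter (fun z => S.nnGraph.Adj x z) =
      Finset.univ.filter fun z => S.nnGraph.Adj x z := by
    ext z
    simp only [Finset.mem_filter, Finset.mem_univ, true_and]
    exact ⟨fun h => h.2, fun h => ⟨h2 z h, h⟩⟩
  rw [siteInteraction, h1, cutoff_add, cutoff_smul, cutoff_smul, cutoff_sum]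
  simp only [cutoff_add]
  congr 2
  convert (Finset.sum_filter (s := Finset.univ) (fun z => S.nnGraph.Adj x z)
    (fun z => (S.g₂ : ℂ) •
      (S.cutoff (S.raise x * S.lower z) + S.cutoff (S.lower x * S.raise z)))).symm using 1
  · refine Finset.sum_congr rfl fun z _ => ?_
    split_ifs
    · rw [cutoff_smul, cutoff_add]
    · exact S.cutoff_zero
  · rw [h3]

theorem loc_cutoff_siteInteraction (S : Setup k) (x : S.Pt) :
    S.Loc (S.star x) (S.cutoff (S.siteInteraction x)) := by
  classical
  have hx : ({x} : Finset S.Pt) ⊆ S.star x := Finset.singleton_subset_iff.2 (S.self_mem_star x)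
  have hl := (S.isMono_lower x).mono hx
  have hr := (S.isMono_raise x).mono hx
  rw [cutoff_siteInteraction]
  refine (Loc.smul (((hl.mul hl).loc_cutoff.add (hr.mul hl).loc_cutoff).add
    ((hl.mul hr).loc_cutoff.add (hr.mul hr).loc_cutoff)) _).add (Loc.smul (Loc.sum fun z hz => ?_) _)
  have hz' : ({z} : Finset S.Pt) ⊆ S.star x :=
    Finset.singleton_subset_iff.2 (Finset.mem_filter.1 hz).1
  exact ((hr.mul ((S.isMono_lower z).mono hz')).loc_cutoff.add
    (hl.mul ((S.isMono_raise z).mono hz')).loc_cutoff).smul _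

theorem colB_cutoff_siteInteraction (S : Setup k) (hM : 1 ≤ S.M) (h₁ : |S.g₁| ≤ 1) (h₂ : |S.g₂| ≤ 1)
    (x : S.Pt) : S.ColB (S.cutoff (S.siteInteraction x)) ((12 + 3 * 3 ^ (k + 1)) * S.M) := by
  classical
  have hx : ({x} : Finset S.Pt) ⊆ S.star x := Finset.singleton_subset_iff.2 (S.self_mem_star x)
  have hl := (S.isMono_lower x).mono hx
  have hr := (S.isMono_raise x).mono hx
  have hn : ∀ g : ℝ, |g| ≤ 1 → ∀ {O : S.Op} {b : ℝ}, S.ColB O b → S.ColB ((g : ℂ) • O) b := by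
    intro g hg O b h
    refine (h.smul _).mono ?_
    rw [Complex.norm_real, Real.norm_eq_abs]
    have := h.nonneg
    nlinarith
  rw [cutoff_siteInteraction]
  have e1 := hn S.g₁ h₁ ((((hl.mul hl).colB_cutoff hM).add ((hr.mul hl).colB_cutoff hM)).add
    (((hl.mul hr).colB_cutoff hM).add ((hr.mul hr).colB_cutoff hM)))
  have e2 : S.ColB (∑ z ∈ (S.star x).filter (fun z => S.nnGraph.Adj x z), (S.g₂ : ℂ) •
      (S.cutoff (S.raise x * S.lower z) + S.cutoff (S.lower x * S.raise z)))
      (∑ z ∈ (S.star x).filter (fun z => S.nnGraph.Adj x z), (3 * S.M + 3 * S.M)) := by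
    refine ColB.sum fun z hz => ?_
    have hz' : ({z} : Finset S.Pt) ⊆ S.star x :=
      Finset.singleton_subset_iff.2 (Finset.mem_filter.1 hz).1
    exact hn S.g₂ h₂ (((hr.mul ((S.isMono_lower z).mono hz')).colB_cutoff hM).add
      ((hl.mul ((S.isMono_raise z).mono hz')).colB_cutoff hM))
  refine (e1.add (e2.smul _)).mono ?_
  rw [Finset.sum_const, nsmul_eq_mul]
  have h3 : (((S.star x).filter (fun z => S.nnGraph.Adj x z)).card : ℝ) ≤ 3 ^ (k + 1) := by
    exact_mod_cast (Finset.card_filter_le _ _).trans (S.card_star_le x)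
  have h4 : ‖(1 / 2 : ℂ)‖ = 1 / 2 := by norm_num
  rw [h4]
  nlinarith [mul_le_mul_of_nonneg_right h3 (by linarith : 0 ≤ S.M)]

/-! ### The transformed potentials -/

/-- The standing assumptions on the parameters. -/
structure Admissible (S : Setup k) : Prop where
  two_lt : 2 < S.q
  γ_pos : 0 < S.γ
  γ_lt : S.γ < S.q - 2
  one_le : 1 ≤ S.M
  g₁_le : |S.g₁| ≤ 1
  g₂_le : |S.g₂| ≤ 1

/-- The weight per site: the interaction sits on stars of at most `3 ^ d` sites, so each order in
`δ = M ^ (-γ)` gains at most `3 ^ d` sites. -/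
noncomputable def weight (S : Setup k) : ℝ := S.M ^ (-S.γ / 3 ^ (k + 1))

theorem Admissible.M_pos {S : Setup k} (h : S.Admissible) : 0 < S.M := by linarith [h.one_le]

theorem Admissible.thr_inv_mul {S : Setup k} (h : S.Admissible) : S.thr⁻¹ * S.M = S.M ^ (1 + S.γ) := by
  rw [thr, Real.rpow_neg h.M_pos.le, inv_inv, Real.rpow_add h.M_pos, Real.rpow_one, mul_comm]

theorem Admissible.weight_pos {S : Setup k} (h : S.Admissible) : 0 < S.weight :=
  Real.rpow_pos_of_pos h.M_pos _

theorem Admissible.weight_le_one {S : Setup k} (h : S.Admissible) : S.weight ≤ 1 := by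
  refine Real.rpow_le_one_of_one_le_of_nonpos h.one_le ?_
  rw [neg_div]
  have := h.γ_pos
  have : 0 ≤ S.γ / 3 ^ (k + 1) := by positivity
  linarith

theorem weight_pow (S : Setup k) (hM : 0 ≤ S.M) (n : ℕ) :
    S.weight ^ n = S.M ^ (-S.γ * n / 3 ^ (k + 1)) := by
  rw [weight, ← Real.rpow_natCast, ← Real.rpow_mul hM]
  congr 1
  ring

theorem fullPot_sub_freePot (S : Setup k) (A : Finset S.Pt) : (S.fullPot - S.freePot) A =
    ∑ x ∈ A, if A = S.star x then S.cutoff (S.siteInteraction x) else 0 := by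
  classical
  rw [Pi.sub_apply, fullPot, add_sub_cancel_left]
  symm
  refine (Finset.sum_subset (Finset.subset_univ A) fun x _ hx => if_neg fun h => hx ?_).trans
    (Finset.sum_congr rfl fun _ _ => by congr)
  rw [h]
  exact S.self_mem_star x

theorem isLocal_fullPot_sub (S : Setup k) : S.IsLocal (S.fullPot - S.freePot) := by
  classical
  refine ⟨fun A => ?_, fun A hA => ?_⟩ <;> rw [fullPot_sub_freePot]
  · refine Loc.sum fun x _ => ?_
    split_ifs with h
    · rw [h]; exact S.loc_cutoff_siteInteraction x
    · exact Loc.zero S A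
  · refine Finset.sum_eq_zero fun x _ => if_neg fun h => hA ?_
    rw [h]
    exact S.conn_star x

theorem potB_fullPot_sub {S : Setup k} (hS : S.Admissible) :
    S.PotB S.weight (S.fullPot - S.freePot)
      (3 ^ (k + 1) * (12 + 3 * 3 ^ (k + 1)) * S.M ^ (1 + S.γ)) := by
  classical
  intro A _
  rw [fullPot_sub_freePot]
  set cV : ℝ := 12 + 3 * 3 ^ (k + 1) with hcV
  have hcV0 : 0 ≤ cV := by positivity
  have hM := hS.M_pos
  by_cases hstar : ∃ x, A = S.star x
  swap
  · have h0 : (∑ x ∈ A, if A = S.star x then S.cutoff (S.siteInteraction x) else 0) = 0 :=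
      Finset.sum_eq_zero fun x _ => if_neg fun h => hstar ⟨x, h⟩
    rw [h0]
    refine (ColB.zero S).mono ?_
    have := hS.weight_pos
    positivity
  obtain ⟨x₀, hx₀⟩ := hstar
  have hcard : A.card ≤ 3 ^ (k + 1) := hx₀ ▸ S.card_star_le x₀
  have h1 : ∀ x ∈ A, S.ColB (if A = S.star x then S.cutoff (S.siteInteraction x) else 0)
      (cV * S.M) := by
    intro x _
    split_ifs
    · exact S.colB_cutoff_siteInteraction hS.one_le hS.g₁_le hS.g₂_le x
    · exact (ColB.zero S).mono (by positivity)
  refine (ColB.sum h1).mono ?_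
  rw [Finset.sum_const, nsmul_eq_mul]
  have h2 : S.M ≤ S.M ^ (1 + S.γ) * S.weight ^ A.card := by
    have h3 : S.weight ^ 3 ^ (k + 1) ≤ S.weight ^ A.card :=
      pow_le_pow_of_le_one hS.weight_pos.le hS.weight_le_one hcard
    have h4 : S.weight ^ 3 ^ (k + 1) = S.M ^ (-S.γ) := by
      rw [weight_pow _ hM.le]
      congr 1
      push_cast
      field_simp
    have h5 : S.M ^ (1 + S.γ) * S.M ^ (-S.γ) = S.M := by
      rw [← Real.rpow_add hM, add_neg_cancel_right, Real.rpow_one]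
    calc S.M = S.M ^ (1 + S.γ) * S.weight ^ 3 ^ (k + 1) := by rw [h4, h5]
      _ ≤ _ := mul_le_mul_of_nonneg_left h3 (by positivity)
  have h6 : (A.card : ℝ) ≤ 3 ^ (k + 1) := by exact_mod_cast hcard
  calc (A.card : ℝ) * (cV * S.M) ≤ 3 ^ (k + 1) * (cV * (S.M ^ (1 + S.γ) * S.weight ^ A.card)) := by
        gcongr
    _ = _ := by ring

theorem energy_congr {S : Setup k} {A : Finset S.Pt} {η ξ : S.Conf} (h : ∀ x ∈ A, η x = ξ x) :
    S.energy A η = S.energy A ξ :=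
  Finset.sum_congr rfl fun x hx => by rw [h x hx]

theorem isLocal_nres {S : Setup k} {B : S.Pot} (hB : S.IsLocal B) : S.IsLocal (S.nres B) := by
  classical
  refine hB.of_mul (fun A η η' => if S.thr⁻¹ * S.M < |S.energy A η - S.energy A η'| then 1 else 0)
    (fun A η η' ξ ξ' h h' => ?_) fun A η η' => ?_
  · simp only [energy_congr h, energy_congr h']
  · simp only [nres, Matrix.of_apply]
    split_ifs <;> simp

theorem isLocal_res {S : Setup k} {B : S.Pot} (hB : S.IsLocal B) : S.IsLocal (S.res B) := by
  classical
  refine hB.of_mul (fun A η η' => if |S.energy A η - S.energy A η'| ≤ S.thr⁻¹ * S.M then 1 else 0)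
    (fun A η η' ξ ξ' h h' => ?_) fun A η η' => ?_
  · simp only [energy_congr h, energy_congr h']
  · simp only [res, Matrix.of_apply]
    split_ifs <;> simp

theorem isLocal_generator {S : Setup k} {H : S.Pot} (hH : S.IsLocal (H - S.freePot)) :
    S.IsLocal (S.generator H) := by
  refine (isLocal_nres hH).of_mul
    (fun A η η' => (((S.energy A η - S.energy A η' : ℝ) : ℂ))⁻¹)
    (fun A η η' ξ ξ' h h' => ?_) fun A η η' => ?_
  · simp only [energy_congr h, energy_congr h']
  · rw [generator, Matrix.of_apply, div_eq_mul_inv, mul_comm]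

theorem norm_nres_le {S : Setup k} (B : S.Pot) (A : Finset S.Pt) (η η' : S.Conf) :
    ‖S.nres B A η η'‖ ≤ ‖B A η η'‖ := by
  classical
  simp only [nres, Matrix.of_apply]
  split_ifs <;> simp

theorem norm_res_le {S : Setup k} (B : S.Pot) (A : Finset S.Pt) (η η' : S.Conf) :
    ‖S.res B A η η'‖ ≤ ‖B A η η'‖ := by
  classical
  simp only [res, Matrix.of_apply]
  split_ifs <;> simp

theorem PotB.generator {S : Setup k} (hS : S.Admissible) {H : S.Pot} {w c : ℝ}
    (hH : S.PotB w (H - S.freePot) (c * S.M ^ (1 + S.γ))) : S.PotB w (S.generator H) c := by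
  classical
  intro A hA η'
  have hT : 0 < S.M ^ (1 + S.γ) := Real.rpow_pos_of_pos hS.M_pos _
  have h1 : ∀ η, ‖S.generator H A η η'‖ ≤ ‖(H - S.freePot) A η η'‖ / S.M ^ (1 + S.γ) := by
    intro η
    simp only [Setup.generator, nres, Matrix.of_apply, hS.thr_inv_mul]
    split_ifs with h
    · rw [norm_div, Complex.norm_real, Real.norm_eq_abs]
      exact div_le_div_of_nonneg_left (norm_nonneg _) hT h.le
    · rw [zero_div, norm_zero]
      positivity
  refine (Finset.sum_le_sum fun η _ => h1 η).trans ?_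
  rw [← Finset.sum_div, div_le_iff₀ hT]
  refine (hH A hA η').trans (le_of_eq (by ring))

/-- After `j` steps the potential is local and of size `M δ ^ (|A| / 3 ^ d - 1)`, with constants that
depend only on `j`, `r` and `d`. -/
theorem exists_bound_transformed (k r j : ℕ) : ∃ c : ℝ, 1 ≤ c ∧ ∀ S : Setup k, S.Admissible →
    S.r = r → S.IsLocal (S.transformed j - S.freePot) ∧
      S.PotB S.weight (S.transformed j - S.freePot) (c * S.M ^ (1 + S.γ)) := by
  induction j with
  | zero =>
    refine ⟨3 ^ (k + 1) * (12 + 3 * 3 ^ (k + 1)), ?_, fun S hS _ =>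
      ⟨S.isLocal_fullPot_sub, potB_fullPot_sub hS⟩⟩
    have : (1 : ℝ) ≤ 3 ^ (k + 1) := one_le_pow₀ (by norm_num)
    nlinarith
  | succ j ih =>
    obtain ⟨c, hc, ih⟩ := ih
    refine ⟨max 1 (2 * c * ∑' n : ℕ, (2 * 4 ^ r * c) ^ n / n.factorial), le_max_left _ _,
      fun S hS hr => ?_⟩
    obtain ⟨h1, h2⟩ := ih S hS hr
    have hT : 0 < S.M ^ (1 + S.γ) := Real.rpow_pos_of_pos hS.M_pos _
    have hK := isLocal_generator h1
    have hH : S.transformed j = S.freePot + (S.transformed j - S.freePot) := by abel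
    have hE : S.potAd (S.generator (S.transformed j)) S.freePot =
        -S.nres (S.transformed j - S.freePot) := by
      refine potAd_freePot hK fun A η η' => ?_
      by_cases h0 : ((S.energy A η - S.energy A η' : ℝ) : ℂ) = 0
      · have h0' : S.energy A η - S.energy A η' = 0 := by exact_mod_cast h0
        rw [h0, mul_zero, nres, Matrix.of_apply, if_neg]
        rw [h0', abs_zero, hS.thr_inv_mul]
        exact not_lt.2 hT.le
      · rw [Setup.generator, Matrix.of_apply, div_mul_cancel₀ _ h0]
    constructor
    · change S.IsLocal (S.expAd _ _ - _)
      refine (hK.expAd ?_).sub S.isLocal_freePot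
      rw [hH]
      exact S.isLocal_freePot.add h1
    · change S.PotB S.weight (S.expAd _ _ - _) _
      have h3 := PotB.expAd hS.weight_pos.le hS.weight_le_one hc (by positivity)
        (PotB.generator hS h2) h2 (fun A hA => (h2 A hA).of_le fun η η' => norm_nres_le _ A η η') hE
      rw [← hH, hr] at h3
      refine fun A hA => (h3 A hA).mono ?_
      refine mul_le_mul_of_nonneg_right ?_ (pow_nonneg hS.weight_pos.le _)
      calc _ = (2 * c * ∑' n : ℕ, (2 * 4 ^ r * c) ^ n / n.factorial) * S.M ^ (1 + S.γ) := by ring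
        _ ≤ _ := mul_le_mul_of_nonneg_right (le_max_right _ _) hT.le

/-! ### The diagonal and off-diagonal resonant potentials -/

/-- The occupation range used in `rangeCut`. -/
noncomputable def occDist (S : Setup k) (A : Finset S.Pt) (η η' : S.Conf) : ℝ :=
  eucl (fun x : {x : S.Pt // x ∈ A} => ((η x.1 : ℕ) : ℤ) - ((η' x.1 : ℕ) : ℤ))

theorem occDist_congr {S : Setup k} {A : Finset S.Pt} {η η' ξ ξ' : S.Conf}
    (h : ∀ x ∈ A, η x = ξ x) (h' : ∀ x ∈ A, η' x = ξ' x) : S.occDist A η η' = S.occDist A ξ ξ' := by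
  unfold occDist
  congr 1
  funext x
  rw [h x.1 x.2, h' x.1 x.2]

theorem occDist_self (S : Setup k) (A : Finset S.Pt) (η : S.Conf) : S.occDist A η η = 0 := by
  unfold occDist
  simp only [sub_self]
  exact eucl_zero

open Classical in
theorem rangeCut_apply (S : Setup k) (n : ℕ) (B : S.Pot) (A : Finset S.Pt) (η η' : S.Conf) :
    S.rangeCut n B A η η' = if A.card ≤ n ∧ S.occDist A η η' ≤ n then B A η η' else 0 := by
  rw [rangeCut, Matrix.of_apply]
  congr

theorem isLocal_rangeCut {S : Setup k} {B : S.Pot} (hB : S.IsLocal B) (n : ℕ) :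
    S.IsLocal (S.rangeCut n B) := by
  classical
  refine hB.of_mul (fun A η η' => if A.card ≤ n ∧ S.occDist A η η' ≤ n then 1 else 0)
    (fun A η η' ξ ξ' h h' => ?_) fun A η η' => ?_
  · rw [occDist_congr h h']
  · rw [rangeCut_apply]
    split_ifs <;> simp

theorem isLocal_diagPart {S : Setup k} {B : S.Pot} (hB : S.IsLocal B) : S.IsLocal (S.diagPart B) := by
  refine ⟨fun A => Loc.diagonal _ fun η ξ h => ?_, fun A hA => ?_⟩
  · exact (hB.loc A).congr (fun _ _ => rfl) (fun _ _ => rfl) h h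
  · rw [diagPart, hB.conn A hA]
    simp

theorem dPot_apply_ne (S : Setup k) (A : Finset S.Pt) {η η' : S.Conf} (h : η ≠ η') :
    S.dPot A η η' = 0 := Matrix.diagonal_apply_ne _ h

open Classical in
theorem dPot_apply_self (S : Setup k) (A : Finset S.Pt) (η : S.Conf) :
    S.dPot A η η = if A.card ≤ S.r then S.freePot A η η + S.resonantPot A η η else 0 := by
  rw [dPot, diagPart, Matrix.diagonal_apply_eq, rangeCut_apply, occDist_self]
  simp

theorem gPot_apply_self (S : Setup k) (A : Finset S.Pt) (η : S.Conf) : S.gPot A η η = 0 := by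
  rw [gPot, Pi.sub_apply, Matrix.sub_apply, diagPart, Matrix.diagonal_apply_eq, sub_self]

open Classical in
theorem gPot_apply_ne (S : Setup k) (A : Finset S.Pt) {η η' : S.Conf} (h : η ≠ η') :
    S.gPot A η η' = if A.card ≤ S.r ∧ S.occDist A η η' ≤ S.r then S.resonantPot A η η' else 0 := by
  rw [gPot, Pi.sub_apply, Matrix.sub_apply, diagPart, Matrix.diagonal_apply_ne _ h, sub_zero,
    rangeCut_apply]

theorem freePot_apply_eq_zero (S : Setup k) {A : Finset S.Pt} (hA : A.card ≠ 1) : S.freePot A = 0 := by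
  classical
  rw [freePot_eq]
  refine Finset.sum_eq_zero fun x _ => if_neg fun h => hA ?_
  rw [h, Finset.card_singleton]

theorem norm_freePot_apply_le {S : Setup k} (hS : S.Admissible) (A : Finset S.Pt) (η : S.Conf) :
    ‖S.freePot A η η‖ ≤ S.M ^ S.q := by
  classical
  have hM := hS.M_pos
  by_cases hA : A.card = 1
  · obtain ⟨x, rfl⟩ := Finset.card_eq_one.1 hA
    rw [freePot_eq]
    simp only [Finset.singleton_inj, Finset.sum_ite_eq, Finset.mem_univ, if_true,
      Matrix.diagonal_apply_eq]
    rw [Complex.norm_real, Real.norm_of_nonneg (by positivity)]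
    refine Real.rpow_le_rpow (by positivity) ?_ (by linarith [hS.two_lt])
    have h1 : (η x : ℕ) ≤ ⌊S.M⌋₊ := Nat.lt_succ_iff.1 (η x).2
    exact (Nat.cast_le.2 h1).trans (Nat.floor_le hM.le)
  · rw [S.freePot_apply_eq_zero hA]
    simp
    positivity

/-- What the perturbative construction provides: locality, resonance, and smallness in `|A|`, with a
constant `c` that only depends on `r` and `d`. Singletons are excluded in `dPot_le` since they carry the
large term `N_x ^ q`. -/
structure PotBounds (S : Setup k) (c : ℝ) : Prop where
  one_le : 1 ≤ c
  isLocal_dPot : S.IsLocal S.dPot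
  isLocal_gPot : S.IsLocal S.gPot
  dPot_card : ∀ A, S.r < A.card → S.dPot A = 0
  gPot_card : ∀ A, S.r < A.card → S.gPot A = 0
  gPot_le : ∀ A η η', ‖S.gPot A η η'‖ ≤ c * S.M ^ (1 + S.γ) * S.weight ^ A.card
  gPot_res : ∀ A η η', S.gPot A η η' ≠ 0 → |S.energy A η - S.energy A η'| ≤ S.M ^ (1 + S.γ)
  dPot_le : ∀ A η η', A.card ≠ 1 → ‖S.dPot A η η'‖ ≤ c * S.M ^ (1 + S.γ) * S.weight ^ A.card
  dPot_le' : ∀ A η η', ‖S.dPot A η η'‖ ≤ 2 * c * S.M ^ S.q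

theorem Admissible.mul_weight_pow_le {S : Setup k} (hS : S.Admissible) {c : ℝ} (hc : 0 ≤ c) (n : ℕ) :
    c * S.M ^ (1 + S.γ) * S.weight ^ n ≤ c * S.M ^ S.q := by
  have hM := hS.M_pos
  have h1 : S.M ^ (1 + S.γ) ≤ S.M ^ S.q :=
    Real.rpow_le_rpow_of_exponent_le hS.one_le (by linarith [hS.γ_lt])
  have h2 : S.weight ^ n ≤ 1 := pow_le_one₀ hS.weight_pos.le hS.weight_le_one
  have h3 := pow_nonneg hS.weight_pos.le n
  have h4 : 0 ≤ S.M ^ (1 + S.γ) := by positivity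
  calc _ ≤ c * S.M ^ (1 + S.γ) * 1 := mul_le_mul_of_nonneg_left h2 (by positivity)
    _ ≤ _ := by rw [mul_one]; exact mul_le_mul_of_nonneg_left h1 hc

theorem exists_potBounds (k r : ℕ) : ∃ c : ℝ, ∀ S : Setup k, S.Admissible → S.r = r →
    S.PotBounds c := by
  classical
  obtain ⟨c, hc, h⟩ := exists_bound_transformed k r r
  refine ⟨c, fun S hS hr => ?_⟩
  have hM := hS.M_pos
  obtain ⟨hloc, hB⟩ := h S hS hr
  have hdef : S.resonantPot = S.res (S.transformed r - S.freePot) := by rw [resonantPot, hr]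
  have hRloc : S.IsLocal S.resonantPot := hdef ▸ isLocal_res hloc
  have hRle : ∀ A : Finset S.Pt, A.card ≤ S.r → ∀ η η', ‖S.resonantPot A η η'‖ ≤
      c * S.M ^ (1 + S.γ) * S.weight ^ A.card := by
    intro A hA η η'
    rw [hdef]
    exact (norm_res_le _ A η η').trans ((hB A hA).norm_apply_le η η')
  have hb0 : ∀ A : Finset S.Pt, 0 ≤ c * S.M ^ (1 + S.γ) * S.weight ^ A.card := by
    intro A
    have := pow_nonneg hS.weight_pos.le A.card
    positivity
  have hdiag : ∀ A : Finset S.Pt, ∀ η η' : S.Conf, ∀ b : ℝ, 0 ≤ b → ‖S.dPot A η η‖ ≤ b →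
      ‖S.dPot A η η'‖ ≤ b := by
    intro A η η' b hb h
    by_cases hη : η = η'
    · rwa [← hη]
    · rw [S.dPot_apply_ne A hη, norm_zero]; exact hb
  refine ⟨hc, isLocal_diagPart (isLocal_rangeCut (S.isLocal_freePot.add hRloc) _),
    (isLocal_rangeCut hRloc _).sub (isLocal_diagPart (isLocal_rangeCut hRloc _)), fun A hA => ?_,
    fun A hA => ?_, fun A η η' => ?_, fun A η η' hne => ?_, fun A η η' hA => ?_, fun A η η' => ?_⟩
  · ext η η'
    by_cases hη : η = η'
    · rw [← hη, dPot_apply_self, if_neg (by omega)]; rfl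
    · exact S.dPot_apply_ne A hη
  · ext η η'
    by_cases hη : η = η'
    · rw [← hη]; exact S.gPot_apply_self A η
    · rw [S.gPot_apply_ne A hη, if_neg (by omega)]; rfl
  · by_cases hη : η = η'
    · rw [← hη, gPot_apply_self, norm_zero]; exact hb0 A
    · rw [S.gPot_apply_ne A hη]
      split_ifs with h1
      · exact hRle A h1.1 η η'
      · rw [norm_zero]; exact hb0 A
  · by_cases hη : η = η'
    · rw [← hη, gPot_apply_self] at hne
      exact absurd rfl hne
    · rw [S.gPot_apply_ne A hη] at hne
      split_ifs at hne
      · rw [hdef, res, Matrix.of_apply] at hne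
        split_ifs at hne with h2
        · rwa [hS.thr_inv_mul] at h2
        · exact absurd rfl hne
      · exact absurd rfl hne
  · refine hdiag A η η' _ (hb0 A) ?_
    rw [dPot_apply_self]
    split_ifs with h1
    · rw [S.freePot_apply_eq_zero hA, Matrix.zero_apply, zero_add]
      exact hRle A h1 η η
    · rw [norm_zero]; exact hb0 A
  · refine hdiag A η η' _ (by positivity) ?_
    have hq : 0 ≤ S.M ^ S.q := by positivity
    rw [dPot_apply_self]
    split_ifs with h1
    · refine (norm_add_le _ _).trans ?_
      have h2 := norm_freePot_apply_le hS A η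
      have h3 := (hRle A h1 η η).trans (hS.mul_weight_pow_le (by linarith) _)
      nlinarith
    · rw [norm_zero]; positivity

/-! ### Moves and their dependence sets -/

theorem mem_strip {S : Setup k} {x : S.Pt} : x ∈ S.strip ↔ |x.1 0 - S.a| < (S.r : ℤ) ^ 2 := by
  simp [strip]

theorem mem_moveSupp {S : Setup k} {ρ : S.Pt → ℤ} {x : S.Pt} : x ∈ S.moveSupp ρ ↔ ρ x ≠ 0 := by
  simp [moveSupp]

theorem mem_depSet {S : Setup k} {ρ : S.Pt → ℤ} {x : S.Pt} :
    x ∈ S.depSet ρ ↔ ∃ A, S.Hosts A ρ ∧ x ∈ A := by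
  simp [depSet]

theorem mem_moves {S : Setup k} {V : Finset S.Pt} {ρ : S.Pt → ℤ} : ρ ∈ S.moves V ↔
    (∀ x, |ρ x| ≤ S.r) ∧ 1 ≤ eucl ρ ∧ eucl ρ ≤ S.r ∧ S.moveSupp ρ ⊆ V ∧
      (S.moveSupp ρ).card ≤ S.r ∧ ∃ A, S.Hosts A ρ := by
  simp only [moves, Finset.mem_filter, Fintype.mem_piFinset, Finset.mem_Icc, abs_le]

theorem moves_of_subset {S : Setup k} {V V' : Finset S.Pt} {ρ : S.Pt → ℤ} (h : ρ ∈ S.moves V)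
    (h' : S.moveSupp ρ ⊆ V') : ρ ∈ S.moves V' := by
  rw [mem_moves] at h ⊢
  exact ⟨h.1, h.2.1, h.2.2.1, h', h.2.2.2.2⟩

theorem moveSupp_nonempty {S : Setup k} {V : Finset S.Pt} {ρ : S.Pt → ℤ} (h : ρ ∈ S.moves V) :
    (S.moveSupp ρ).Nonempty := by
  by_contra hne
  have h0 : ρ = 0 := by
    funext x
    by_contra hx
    exact hne ⟨x, mem_moveSupp.2 hx⟩
  have h1 := (mem_moves.1 h).2.1
  rw [h0, eucl_zero] at h1
  linarith

theorem moveSupp_subset_depSet {S : Setup k} {V : Finset S.Pt} {ρ : S.Pt → ℤ} (h : ρ ∈ S.moves V) :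
    S.moveSupp ρ ⊆ S.depSet ρ := by
  obtain ⟨A, hA⟩ := (mem_moves.1 h).2.2.2.2.2
  exact fun x hx => mem_depSet.2 ⟨A, hA, hA.2.2.2 hx⟩

theorem depSet_subset_strip (S : Setup k) (ρ : S.Pt → ℤ) : S.depSet ρ ⊆ S.strip := by
  intro x hx
  obtain ⟨A, hA, hxA⟩ := mem_depSet.1 hx
  exact hA.1 hxA

theorem Hosts.eucl_sub_le {S : Setup k} {A : Finset S.Pt} {ρ : S.Pt → ℤ} (hA : S.Hosts A ρ)
    {x z : S.Pt} (hx : x ∈ A) (hz : z ∈ A) : eucl (x.1 - z.1) ≤ S.r :=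
  (hA.2.1.eucl_sub_le hx hz).trans (by exact_mod_cast hA.2.2.1)

theorem eucl_sub_le_of_mem_depSet {S : Setup k} {ρ : S.Pt → ℤ} {x z : S.Pt} (hx : x ∈ S.depSet ρ)
    (hz : z ∈ S.moveSupp ρ) : eucl (x.1 - z.1) ≤ S.r := by
  obtain ⟨A, hA, hxA⟩ := mem_depSet.1 hx
  exact hA.eucl_sub_le hxA (hA.2.2.2 hz)

theorem eucl_sub_le_of_mem_depSet₂ {S : Setup k} {V : Finset S.Pt} {ρ : S.Pt → ℤ}
    (hρ : ρ ∈ S.moves V) {x z : S.Pt} (hx : x ∈ S.depSet ρ) (hz : z ∈ S.depSet ρ) :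
    eucl (x.1 - z.1) ≤ 2 * S.r := by
  obtain ⟨w, hw⟩ := moveSupp_nonempty hρ
  have h1 := eucl_sub_le_of_mem_depSet hx hw
  have h2 := eucl_sub_le_of_mem_depSet hz hw
  have h3 := Setup.eucl_sub_le x.1 w.1 z.1
  rw [eucl_sub_comm w.1] at h3
  linarith

/-- The center of the ball `B_y`. -/
def center (S : Setup k) (y : Fin k → ℤ) : Site k := Fin.cons S.a y

theorem mem_ball {S : Setup k} {y : Fin k → ℤ} {x : S.Pt} :
    x ∈ S.ball y ↔ x ∈ S.strip ∧ eucl (x.1 - S.center y) ≤ 2 * (S.r : ℝ) ^ 2 := by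
  simp [ball, center]

theorem card_ball_le (S : Setup k) (y : Fin k → ℤ) :
    (S.ball y).card ≤ (2 * (2 * S.r ^ 2) + 1) ^ (k + 1) := by
  refine S.card_le_of_forall_abs_sub_le _ (S.center y) _ fun x hx i => ?_
  have h1 := (abs_apply_le_eucl (x.1 - S.center y) i).trans (mem_ball.1 hx).2
  have h2 : ((|x.1 i - S.center y i| : ℤ) : ℝ) ≤ ((2 * S.r ^ 2 : ℕ) : ℝ) := by
    push_cast
    simpa using h1
  exact_mod_cast h2

/-- The sites of the strip well inside `B_y`, where all the terms attached to `y` live. -/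
def Near (S : Setup k) (y : Fin k → ℤ) (x : S.Pt) : Prop :=
  x ∈ S.strip ∧ eucl (x.1 - S.center y) ≤ 5 / 4 * (S.r : ℝ) ^ 2

theorem Near.mem_ball {S : Setup k} {y : Fin k → ℤ} {x : S.Pt} (h : S.Near y x) : x ∈ S.ball y := by
  refine Setup.mem_ball.2 ⟨h.1, h.2.trans ?_⟩
  nlinarith [sq_nonneg (S.r : ℝ)]

theorem near_of_tail_eq {S : Setup k} (hr : 4 ≤ S.r) {y : Fin k → ℤ} {x w : S.Pt} (hx : x ∈ S.strip)
    (hw : w ∈ S.strip) (hwy : y = Fin.tail w.1) (hxw : eucl (x.1 - w.1) ≤ S.r) : S.Near y x := by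
  refine ⟨hx, ?_⟩
  have h1 : eucl (w.1 - S.center y) ≤ (S.r : ℝ) ^ 2 := by
    refine (eucl_le_sum _).trans ?_
    rw [Fin.sum_univ_succ]
    have h2 : ∀ i : Fin k, |(((w.1 - S.center y) i.succ : ℤ) : ℝ)| = 0 := by
      intro i
      have : (w.1 - S.center y) i.succ = 0 := by
        rw [Pi.sub_apply, center, Fin.cons_succ, hwy, Fin.tail, sub_self]
      rw [this]; simp
    simp only [h2, Finset.sum_const_zero, add_zero]
    have h3 : |(w.1 - S.center y) 0| ≤ (S.r : ℤ) ^ 2 := by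
      rw [Pi.sub_apply, center, Fin.cons_zero]
      exact (mem_strip.1 hw).le
    exact_mod_cast h3
  have h4 := Setup.eucl_sub_le x.1 w.1 (S.center y)
  have h5 : (4 : ℝ) ≤ S.r := by exact_mod_cast hr
  nlinarith

theorem moveOp_apply_ne_zero {S : Setup k} {ρ : S.Pt → ℤ} {η ζ : S.Conf}
    (h : S.moveOp ρ η ζ ≠ 0) : ∀ x, ((ζ x : ℕ) : ℤ) = ((η x : ℕ) : ℤ) + ρ x := by
  classical
  rw [moveOp, Matrix.of_apply] at h
  split_ifs at h with h1
  · exact h1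
  · exact absurd rfl h

theorem eq_of_notMem_moveSupp {S : Setup k} {ρ : S.Pt → ℤ} {η ζ : S.Conf}
    (h : ∀ x, ((ζ x : ℕ) : ℤ) = ((η x : ℕ) : ℤ) + ρ x) {x : S.Pt} (hx : x ∉ S.moveSupp ρ) :
    η x = ζ x := by
  have h0 : ρ x = 0 := by
    by_contra h0
    exact hx (mem_moveSupp.2 h0)
  have := h x
  rw [h0, add_zero] at this
  exact (Fin.ext (by exact_mod_cast this)).symm

open Classical in
/-- Only the sets hosting `ρ` contribute to `W_ρ`. -/
theorem moveOp_apply {S : Setup k} {c : ℝ} (hP : S.PotBounds c) {ρ : S.Pt → ℤ} {η ζ : S.Conf}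
    (h : ∀ x, ((ζ x : ℕ) : ℤ) = ((η x : ℕ) : ℤ) + ρ x) :
    S.moveOp ρ η ζ = ∑ A ∈ (S.depSet ρ).powerset.filter (fun A => S.Hosts A ρ), S.gPot A η ζ := by
  have h1 : S.moveOp ρ η ζ = ∑ A ∈ S.strip.powerset, S.gPot A η ζ := by
    rw [moveOp, Matrix.of_apply, if_pos h]
  rw [h1]
  symm
  refine Finset.sum_subset (fun A hA => ?_) fun A hA hA' => ?_
  · rw [Finset.mem_filter] at hA
    exact Finset.mem_powerset.2 hA.2.1
  · by_contra hne
    refine hA' ?_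
    have hhost : S.Hosts A ρ := by
      refine ⟨Finset.mem_powerset.1 hA, ?_, ?_, fun x hx => ?_⟩
      · by_contra hc
        rw [hP.isLocal_gPot.conn A hc] at hne
        exact hne rfl
      · by_contra hc
        rw [hP.gPot_card A (by omega)] at hne
        exact hne rfl
      · by_contra hxA
        have h2 := (hP.isLocal_gPot.loc A).eq_off η ζ hne x hxA
        have h3 := h x
        rw [h2] at h3
        exact (mem_moveSupp.1 hx) (by linarith)
    rw [Finset.mem_filter, Finset.mem_powerset]
    exact ⟨fun x hx => mem_depSet.2 ⟨A, hhost, hx⟩, hhost⟩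

theorem loc_moveOp {S : Setup k} {c : ℝ} (hP : S.PotBounds c) {V : Finset S.Pt} {ρ : S.Pt → ℤ}
    (hρ : ρ ∈ S.moves V) : S.Loc (S.depSet ρ) (S.moveOp ρ) := by
  classical
  have hsub := moveSupp_subset_depSet hρ
  have hsum : S.Loc (S.depSet ρ)
      (∑ A ∈ (S.depSet ρ).powerset.filter (fun A => S.Hosts A ρ), S.gPot A) :=
    Loc.sum fun A hA => (hP.isLocal_gPot.loc A).mono
      (Finset.mem_powerset.1 (Finset.mem_filter.1 hA).1)
  refine ⟨fun η ζ hne x hx => ?_, fun π hπ η ζ => ?_⟩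
  · exact eq_of_notMem_moveSupp (moveOp_apply_ne_zero hne) fun h => hx (hsub h)
  · have key : (∀ x, ((π x (ζ x) : S.Lvl) : ℤ) = ((π x (η x) : S.Lvl) : ℤ) + ρ x) ↔
        ∀ x, ((ζ x : ℕ) : ℤ) = ((η x : ℕ) : ℤ) + ρ x := by
      refine forall_congr' fun x => ?_
      by_cases hx : x ∈ S.depSet ρ
      · rw [hπ x hx]; rfl
      · have h0 : ρ x = 0 := by
          by_contra h0
          exact hx (hsub (mem_moveSupp.2 h0))
        rw [h0, add_zero, add_zero]
        norm_cast
        rw [Fin.val_inj, Fin.val_inj, EmbeddingLike.apply_eq_iff_eq]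
    by_cases h : ∀ x, ((ζ x : ℕ) : ℤ) = ((η x : ℕ) : ℤ) + ρ x
    · rw [moveOp_apply hP h, moveOp_apply hP (key.2 h)]
      have := hsum.perm π hπ η ζ
      rwa [Matrix.sum_apply, Matrix.sum_apply] at this
    · rw [moveOp, Matrix.of_apply, Matrix.of_apply, if_neg h, if_neg fun h' => h (key.1 h')]

theorem exists_host_of_moveOp_ne_zero {S : Setup k} {c : ℝ} (hP : S.PotBounds c) {ρ : S.Pt → ℤ}
    {η ζ : S.Conf} (h : S.moveOp ρ η ζ ≠ 0) : ∃ A, S.Hosts A ρ ∧ S.gPot A η ζ ≠ 0 := by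
  classical
  rw [moveOp_apply hP (moveOp_apply_ne_zero h)] at h
  obtain ⟨A, hA, hne⟩ := Finset.exists_ne_zero_of_sum_ne_zero h
  exact ⟨A, (Finset.mem_filter.1 hA).2, hne⟩

theorem sum_sub_eq_of_eq_off {S : Setup k} {V W : Finset S.Pt} {η ζ : S.Conf} (hWV : W ⊆ V)
    (h : ∀ x, x ∉ W → η x = ζ x) :
    S.energy V η - S.energy V ζ = S.energy W η - S.energy W ζ := by
  rw [energy, energy, energy, energy, ← Finset.sum_sub_distrib, ← Finset.sum_sub_distrib]
  symm
  refine Finset.sum_subset hWV fun x _ hx => ?_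
  rw [h x hx, sub_self]

/-- The matrix elements of `W_ρ` link configurations in every volume containing the move. -/
theorem linked_of_moveOp_ne_zero {S : Setup k} {c : ℝ} (hP : S.PotBounds c) {ρ : S.Pt → ℤ}
    {V : Finset S.Pt} (hV : S.moveSupp ρ ⊆ V) {η ζ : S.Conf} (h : S.moveOp ρ η ζ ≠ 0) :
    S.Linked V ρ (S.restrict V η) (S.restrict V ζ) := by
  obtain ⟨A, hA, hne⟩ := exists_host_of_moveOp_ne_zero hP h
  have h1 := moveOp_apply_ne_zero h
  refine ⟨Or.inl fun x => ?_, ?_⟩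
  · have := h1 x.1
    simp only [restrict]
    linarith
  · have h2 := hP.gPot_res A η ζ hne
    rw [sum_sub_eq_of_eq_off hA.2.2.2 fun x hx => eq_of_notMem_moveSupp h1 hx,
      ← sum_sub_eq_of_eq_off hV fun x hx => eq_of_notMem_moveSupp h1 hx] at h2
    have h3 : ∀ ξ : S.Conf, ∑ x : {x : S.Pt // x ∈ V}, ((S.restrict V ξ x : ℕ) : ℝ) ^ S.q =
        S.energy V ξ := fun ξ => Finset.sum_coe_sort V fun x => ((ξ x : ℕ) : ℝ) ^ S.q
    rw [h3, h3]
    exact h2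

/-! ### Clusters of active moves -/

/-- The component of (the restriction to `V` of) the configuration `η`. -/
noncomputable def comp (S : Setup k) (V : Finset S.Pt) (η : S.Conf) : S.Comp V :=
  (S.resGraph V).connectedComponentMk (S.restrict V η)

/-- The moves that are active in the component of `η`. -/
def Act (S : Setup k) (V : Finset S.Pt) (η : S.Conf) : Set (S.Pt → ℤ) := S.activeMoves (S.comp V η)

/-- Two sites of `V` lie in the dependence set of one active move. -/
def Spot (S : Setup k) (V : Finset S.Pt) (η : S.Conf) (x z : S.Pt) : Prop :=
  ∃ ρ ∈ S.Act V η, (x ∈ S.depSet ρ ∧ x ∈ V) ∧ z ∈ S.depSet ρ ∧ z ∈ V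

/-- Two sites lie in the same cluster of resonant spots (or are equal). -/
def Cl (S : Setup k) (V : Finset S.Pt) (η : S.Conf) : S.Pt → S.Pt → Prop :=
  Relation.ReflTransGen (S.Spot V η)

theorem Spot.symm {S : Setup k} {V : Finset S.Pt} {η : S.Conf} {x z : S.Pt} (h : S.Spot V η x z) :
    S.Spot V η z x := by
  obtain ⟨ρ, h1, h2, h3⟩ := h
  exact ⟨ρ, h1, h3, h2⟩

theorem Cl.symm {S : Setup k} {V : Finset S.Pt} {η : S.Conf} {x z : S.Pt} (h : S.Cl V η x z) :
    S.Cl V η z x := by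
  induction h with
  | refl => exact .refl
  | tail _ h2 ih => exact ih.head h2.symm

theorem mem_comp_supp {S : Setup k} {V : Finset S.Pt} {η : S.Conf} {σ : S.VConf V} :
    σ ∈ (S.comp V η).supp ↔ (S.resGraph V).Reachable (S.restrict V η) σ := by
  rw [comp, SimpleGraph.ConnectedComponent.mem_supp_iff, SimpleGraph.ConnectedComponent.eq]
  exact ⟨fun h => h.symm, fun h => h.symm⟩

/-- Membership in the left region, phrased with the cluster relation. -/
theorem mem_leftRegion {S : Setup k} {y : Fin k → ℤ} {η : S.Conf} {x : S.Pt} :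
    x ∈ S.leftRegion (S.comp (S.ball y) η) ↔
      x ∈ S.ball y ∧ ∃ z, S.Cl (S.ball y) η x z ∧ z.1 0 ≤ S.a := by
  classical
  set V := S.ball y with hV
  set coll := S.spots (S.comp V η) with hcoll
  set rel : Set S.Pt → Set S.Pt → Prop := fun u v => u ∈ coll ∧ v ∈ coll ∧ (u ∩ v).Nonempty with hrel
  have hspot : ∀ t ∈ coll, ∀ u ∈ t, ∀ v ∈ t, S.Spot V η u v := by
    rintro t ⟨ρ, hρ, rfl⟩ u hu v hv
    exact ⟨ρ, hρ, hu, hv⟩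
  have hpath : ∀ s ∈ coll, ∀ t, Relation.ReflTransGen rel s t →
      t ∈ coll ∧ ∀ u ∈ s, ∀ v ∈ t, S.Cl V η u v := by
    intro s hs t h
    induction h with
    | refl => exact ⟨hs, fun u hu v hv => .single (hspot s hs u hu v hv)⟩
    | tail _ h2 ih =>
      obtain ⟨_, h4, w, hw1, hw2⟩ := h2
      exact ⟨h4, fun u hu v hv => (ih.2 u hu w hw1).tail (hspot _ h4 w hw2 v hv)⟩
  have hsymm : ∀ s t, Relation.ReflTransGen rel s t → Relation.ReflTransGen rel t s := by
    intro s t h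
    induction h with
    | refl => exact .refl
    | tail _ h2 ih => exact ih.head ⟨h2.2.1, h2.1, by rw [Set.inter_comm]; exact h2.2.2⟩
  have hdef : x ∈ S.leftRegion (S.comp V η) ↔ x ∈ V ∧ (x.1 0 ≤ S.a ∨
      ∃ K ∈ clusters coll, (∃ z ∈ K, z.1 0 ≤ S.a) ∧ x ∈ K) := by
    rw [leftRegion, Finset.mem_filter]
  rw [hdef]
  refine and_congr_right fun _ => ⟨?_, ?_⟩
  · rintro (h | ⟨K, ⟨s, hs, rfl⟩, ⟨z, ⟨t, ht, hzt⟩, hz⟩, ⟨t', ht', hxt'⟩⟩)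
    · exact ⟨x, .refl, h⟩
    · have ht'' : t' ∈ coll := (hpath s hs t' ht').1
      exact ⟨z, (hpath t' ht'' t ((hsymm _ _ ht').trans ht)).2 x hxt' z hzt, hz⟩
  · rintro ⟨z, hz, hza⟩
    have : x = z ∨ ∃ t ∈ coll, ∃ t', x ∈ t ∧ z ∈ t' ∧ Relation.ReflTransGen rel t t' := by
      clear hza
      induction hz with
      | refl => exact Or.inl rfl
      | @tail v w _ h2 ih =>
        obtain ⟨ρ, hρ, h3, h4⟩ := h2
        have hmem : {x | x ∈ S.depSet ρ ∧ x ∈ V} ∈ coll := ⟨ρ, hρ, rfl⟩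
        right
        rcases ih with rfl | ⟨t, ht, t', hxt, hvt', hr⟩
        · exact ⟨_, hmem, _, h3, h4, .refl⟩
        · exact ⟨t, ht, _, hxt, h4, hr.tail ⟨(hpath t ht t' hr).1, hmem, v, hvt', h3⟩⟩
    rcases this with rfl | ⟨t, ht, t', hxt, hzt', hr⟩
    · exact Or.inl hza
    · exact Or.inr ⟨_, ⟨t, ht, rfl⟩, ⟨z, ⟨t', hr, hzt'⟩, hza⟩, ⟨t, .refl, hxt⟩⟩

/-- Transplantation of an active move: if the cluster of `x` for `(V, η)` lies in a set `U` on which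
`η'` agrees with `η`, then every active move touching the cluster is active for `(V', η')` as well.
The path of moves leading to the resonance is cut down to the moves inside the cluster, which do not see
the rest of the configuration. -/
theorem act_transfer {S : Setup k} {V V' U : Finset S.Pt} {η η' : S.Conf} (hUV' : U ⊆ V')
    (hη : ∀ x ∈ U, η x = η' x) {x : S.Pt} (hx : ∀ z, S.Cl V η x z → z ∈ U) {ρ : S.Pt → ℤ}
    (hρ : ρ ∈ S.Act V η) {u : S.Pt} (hu : u ∈ S.depSet ρ) (huV : u ∈ V) (hxu : S.Cl V η x u) :
    ρ ∈ S.Act V' η' := by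
  classical
  set K : Set S.Pt := {z | S.Cl V η x z ∧ z ∈ V} with hK
  have hKU : ∀ z ∈ K, z ∈ U := fun z hz => hx z hz.1
  have hsub : ∀ ρ ∈ S.Act V η, ∀ u ∈ S.depSet ρ, u ∈ K → ∀ z ∈ S.moveSupp ρ, z ∈ K := by
    intro ρ hρ u hu huK z hz
    have hzV := (mem_moves.1 hρ.1).2.2.2.1 hz
    exact ⟨huK.1.tail ⟨ρ, hρ, ⟨hu, huK.2⟩, moveSupp_subset_depSet hρ.1 hz, hzV⟩, hzV⟩
  let κ : S.VConf V → S.VConf V' := fun σ z =>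
    if h : z.1 ∈ K then σ ⟨z.1, h.2⟩ else η' z.1
  have hκK : ∀ σ (z : {z // z ∈ V'}) (h : z.1 ∈ K), κ σ z = σ ⟨z.1, h.2⟩ := fun σ z h => dif_pos h
  have hκn : ∀ σ (z : {z // z ∈ V'}), z.1 ∉ K → κ σ z = η' z.1 := fun σ z h => dif_neg h
  have hbase : κ (S.restrict V η) = S.restrict V' η' := by
    funext z
    by_cases hz : z.1 ∈ K
    · rw [hκK _ _ hz]
      exact hη z.1 (hKU _ hz)
    · rw [hκn _ _ hz]; rfl
  -- moves inside the cluster act in the same way before and after transplantation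
  have hlink : ∀ ρ, (∀ z ∈ S.moveSupp ρ, z ∈ K) → ∀ σ τ, S.Linked V ρ σ τ →
      S.Linked V' ρ (κ σ) (κ τ) := by
    rintro ρ hρK σ τ ⟨h1, h2⟩
    have h0 : ∀ z, z ∉ K → ρ z = 0 := fun z hz => by
      by_contra hne
      exact hz (hρK z (mem_moveSupp.2 hne))
    have hdiff : ∀ s : ℤ, (∀ z, ((τ z : ℕ) : ℤ) - ((σ z : ℕ) : ℤ) = s * ρ z.1) →
        ∀ z, ((κ τ z : ℕ) : ℤ) - ((κ σ z : ℕ) : ℤ) = s * ρ z.1 := by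
      intro s h z
      by_cases hz : z.1 ∈ K
      · rw [hκK _ _ hz, hκK _ _ hz]; exact h ⟨z.1, hz.2⟩
      · rw [hκn _ _ hz, hκn _ _ hz, h0 z.1 hz]; simp
    have hστ : ∀ z : {z // z ∈ V}, z.1 ∉ K → σ z = τ z := by
      intro z hz
      have h3 := h0 z.1 hz
      rcases h1 with h1 | h1
      · have := h1 z
        rw [h3] at this
        exact Fin.ext (by omega)
      · have := h1 z
        rw [h3] at this
        exact Fin.ext (by omega)
    refine ⟨?_, ?_⟩
    · rcases h1 with h1 | h1
      · left
        simpa using hdiff 1 (by simpa using h1)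
      · right
        simpa using hdiff (-1) (by simpa using h1)
    · let G : S.Pt → ℝ := fun z =>
        if h : z ∈ K then ((σ ⟨z, h.2⟩ : ℕ) : ℝ) ^ S.q - ((τ ⟨z, h.2⟩ : ℕ) : ℝ) ^ S.q else 0
      have e1 : (∑ z, ((σ z : ℕ) : ℝ) ^ S.q) - ∑ z, ((τ z : ℕ) : ℝ) ^ S.q = ∑ z, G z := by
        rw [← Finset.sum_sub_distrib, ← Finset.sum_subset (Finset.subset_univ V),
          ← Finset.sum_coe_sort V G]
        · refine Finset.sum_congr rfl fun z _ => ?_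
          by_cases hz : z.1 ∈ K
          · simp only [G, dif_pos hz]
          · simp only [G, dif_neg hz, hστ z hz, sub_self]
        · intro z _ hz
          exact dif_neg fun h => hz h.2
      have e2 : (∑ z, ((κ σ z : ℕ) : ℝ) ^ S.q) - ∑ z, ((κ τ z : ℕ) : ℝ) ^ S.q = ∑ z, G z := by
        rw [← Finset.sum_sub_distrib, ← Finset.sum_subset (Finset.subset_univ V'),
          ← Finset.sum_coe_sort V' G]
        · refine Finset.sum_congr rfl fun z _ => ?_
          by_cases hz : z.1 ∈ K
          · simp only [G, dif_pos hz, hκK _ _ hz]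
          · simp only [G, dif_neg hz, hκn _ _ hz, sub_self]
        · intro z _ hz
          exact dif_neg fun h => hz (hUV' (hKU z h))
      rw [e2, ← e1]
      exact h2
  have hstay : ∀ ρ, ρ ∈ S.moves V → (∀ u ∈ S.depSet ρ, u ∉ K) → ∀ σ τ, S.Linked V ρ σ τ →
      κ σ = κ τ := by
    rintro ρ hρ hρK σ τ ⟨h1, _⟩
    funext z
    by_cases hz : z.1 ∈ K
    · rw [hκK _ _ hz, hκK _ _ hz]
      have h3 : ρ z.1 = 0 := by
        by_contra hne
        exact hρK z.1 (moveSupp_subset_depSet hρ (mem_moveSupp.2 hne)) hz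
      rcases h1 with h1 | h1
      · have := h1 ⟨z.1, hz.2⟩
        rw [h3] at this
        exact Fin.ext (by omega)
      · have := h1 ⟨z.1, hz.2⟩
        rw [h3] at this
        exact Fin.ext (by omega)
    · rw [hκn _ _ hz, hκn _ _ hz]
  have hact : ∀ ρ ∈ S.moves V, ∀ σ τ, S.Linked V ρ σ τ →
      (S.resGraph V).Reachable (S.restrict V η) σ → (S.resGraph V).Reachable (S.restrict V η) τ →
      ρ ∈ S.Act V η := fun ρ hρ σ τ h hσ hτ =>
    ⟨hρ, σ, mem_comp_supp.2 hσ, τ, mem_comp_supp.2 hτ, h⟩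
  have hmoves' : ∀ ρ ∈ S.moves V, (∀ z ∈ S.moveSupp ρ, z ∈ K) → ρ ∈ S.moves V' :=
    fun ρ hρ h => moves_of_subset hρ fun z hz => hUV' (hKU z (h z hz))
  have hstep : ∀ ρ ∈ S.Act V η, ∀ σ τ, S.Linked V ρ σ τ →
      (S.resGraph V').Reachable (κ σ) (κ τ) := by
    intro ρ hρ σ τ h
    by_cases hρK : ∃ u ∈ S.depSet ρ, u ∈ K
    · obtain ⟨u, hu, huK⟩ := hρK
      have h1 := hsub ρ hρ u hu huK
      by_cases heq : κ σ = κ τ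
      · rw [heq]
      · exact SimpleGraph.Adj.reachable ((SimpleGraph.fromRel_adj _ _ _).2
          ⟨heq, Or.inl ⟨ρ, hmoves' ρ hρ.1 h1, hlink ρ h1 σ τ h⟩⟩)
    · push Not at hρK
      rw [hstay ρ hρ.1 hρK σ τ h]
  have hreach : ∀ σ, (S.resGraph V).Reachable (S.restrict V η) σ →
      (S.resGraph V').Reachable (S.restrict V' η') (κ σ) := by
    intro σ hσ
    have hσ' := (SimpleGraph.reachable_iff_reflTransGen _ _).1 hσ
    induction hσ' with
    | refl => rw [hbase]
    | @tail σ τ h1 h2 ih =>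
      have hσr : (S.resGraph V).Reachable (S.restrict V η) σ :=
        (SimpleGraph.reachable_iff_reflTransGen _ _).2 h1
      refine (ih hσr).trans ?_
      obtain ⟨_, ⟨ρ, hρ, h⟩ | ⟨ρ, hρ, h⟩⟩ := (SimpleGraph.fromRel_adj _ _ _).1 h2
      · exact hstep ρ (hact ρ hρ σ τ h hσr hσ) σ τ h
      · exact (hstep ρ (hact ρ hρ τ σ h hσ hσr) τ σ h).symm
  obtain ⟨hρV, σ, hσ, τ, hτ, h⟩ := id hρ
  have h1 := hsub ρ hρ u hu ⟨hxu, huV⟩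
  exact ⟨hmoves' ρ hρV h1, κ σ, mem_comp_supp.2 (hreach σ (mem_comp_supp.1 hσ)), κ τ,
    mem_comp_supp.2 (hreach τ (mem_comp_supp.1 hτ)), hlink ρ h1 σ τ h⟩

/-- Locality of clusters. -/
theorem cl_transfer {S : Setup k} {V V' U : Finset S.Pt} {η η' : S.Conf} (hUV' : U ⊆ V')
    (hη : ∀ x ∈ U, η x = η' x) {x : S.Pt} (hx : ∀ z, S.Cl V η x z → z ∈ U) {z : S.Pt}
    (h : S.Cl V η x z) : S.Cl V' η' x z := by
  induction h with
  | refl => exact .refl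
  | @tail v w h1 h2 ih =>
    obtain ⟨ρ, hρ, ⟨hv, hvV⟩, hw, hwV⟩ := id h2
    exact ih.tail ⟨ρ, act_transfer hUV' hη hx hρ hv hvV h1, ⟨hv, hUV' (hx v h1)⟩, hw,
      hUV' (hx w (h1.tail h2))⟩

/-- A configuration is good for `y` if all clusters in `B_y` are much smaller than `r ^ 2`. -/
def Good (S : Setup k) (y : Fin k → ℤ) (η : S.Conf) : Prop :=
  ∀ x z, S.Cl (S.ball y) η x z → ∀ i, 8 * ((k : ℤ) + 1) * |x.1 i - z.1 i| ≤ (S.r : ℤ) ^ 2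

theorem Good.eucl_sub_le {S : Setup k} {y : Fin k → ℤ} {η : S.Conf} (h : S.Good y η) {x z : S.Pt}
    (hxz : S.Cl (S.ball y) η x z) : eucl (x.1 - z.1) ≤ (S.r : ℝ) ^ 2 / 8 := by
  refine (eucl_le_sum _).trans ?_
  have h1 : ∀ i ∈ Finset.univ, |(((x.1 - z.1) i : ℤ) : ℝ)| ≤ (S.r : ℝ) ^ 2 / (8 * ((k : ℝ) + 1)) := by
    intro i _
    rw [le_div_iff₀ (by positivity), mul_comm]
    have := h x z hxz i
    exact_mod_cast this
  refine (Finset.sum_le_card_nsmul _ _ _ h1).trans (le_of_eq ?_)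
  simp
  field_simp

theorem mem_ball_of_cl {S : Setup k} {V : Finset S.Pt} {η : S.Conf} {x z : S.Pt} (hx : x ∈ V)
    (h : S.Cl V η x z) : z ∈ V := by
  cases h with
  | refl => exact hx
  | tail _ h2 =>
    obtain ⟨ρ, _, _, _, hz⟩ := h2
    exact hz

theorem Good.eucl_center_le {S : Setup k} {y : Fin k → ℤ} {η : S.Conf} (h : S.Good y η) {x z : S.Pt}
    (hxz : S.Cl (S.ball y) η x z) {y' : Fin k → ℤ} (hx : S.Near y' x) :
    eucl (z.1 - S.center y') ≤ 11 / 8 * (S.r : ℝ) ^ 2 := by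
  have h1 := h.eucl_sub_le hxz
  have h2 := Setup.eucl_sub_le z.1 x.1 (S.center y')
  rw [eucl_sub_comm z.1 x.1] at h2
  have h3 := hx.2
  linarith

/-- Near both `y` and `y'` the left regions of good configurations coincide. -/
theorem Good.mem_leftRegion_iff {S : Setup k} {y y' : Fin k → ℤ} {η : S.Conf} (h : S.Good y η)
    (h' : S.Good y' η) {x : S.Pt} (hx : S.Near y x) (hx' : S.Near y' x) :
    x ∈ S.leftRegion (S.comp (S.ball y) η) ↔ x ∈ S.leftRegion (S.comp (S.ball y') η) := by
  classical
  have key : ∀ {y y' : Fin k → ℤ}, S.Good y η → S.Good y' η → S.Near y x → S.Near y' x →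
      x ∈ S.leftRegion (S.comp (S.ball y) η) → x ∈ S.leftRegion (S.comp (S.ball y') η) := by
    intro y y' h h' hx hx' hL
    obtain ⟨_, z, hz, hza⟩ := mem_leftRegion.1 hL
    refine mem_leftRegion.2 ⟨hx'.mem_ball, z, ?_, hza⟩
    refine cl_transfer (U := S.ball y ∩ S.ball y') Finset.inter_subset_right (fun _ _ => rfl)
      (fun w hw => ?_) hz
    have h1 := mem_ball_of_cl hx.mem_ball hw
    refine Finset.mem_inter.2 ⟨h1, mem_ball.2 ⟨(mem_ball.1 h1).1, ?_⟩⟩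
    have := h.eucl_center_le hw hx'
    nlinarith [sq_nonneg (S.r : ℝ)]
  exact ⟨key h h' hx hx', key h' h hx' hx⟩

theorem comp_eq_of_moveOp_ne_zero {S : Setup k} {c : ℝ} (hP : S.PotBounds c) {ρ : S.Pt → ℤ}
    {V W : Finset S.Pt} (hρ : ρ ∈ S.moves W) (hV : S.moveSupp ρ ⊆ V) {η ζ : S.Conf}
    (h : S.moveOp ρ η ζ ≠ 0) : S.comp V η = S.comp V ζ := by
  have h1 := linked_of_moveOp_ne_zero hP hV h
  rw [comp, comp, SimpleGraph.ConnectedComponent.eq]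
  by_cases heq : S.restrict V η = S.restrict V ζ
  · rw [heq]
  · exact SimpleGraph.Adj.reachable ((SimpleGraph.fromRel_adj _ _ _).2
      ⟨heq, Or.inl ⟨ρ, moves_of_subset hρ hV, h1⟩⟩)

theorem mem_act_of_moveOp_ne_zero {S : Setup k} {c : ℝ} (hP : S.PotBounds c) {ρ : S.Pt → ℤ}
    {V W : Finset S.Pt} (hρ : ρ ∈ S.moves W) (hV : S.moveSupp ρ ⊆ V) {η ζ : S.Conf}
    (h : S.moveOp ρ η ζ ≠ 0) : ρ ∈ S.Act V η := by
  refine ⟨moves_of_subset hρ hV, S.restrict V η, mem_comp_supp.2 (SimpleGraph.Reachable.refl _),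
    S.restrict V ζ, ?_, linked_of_moveOp_ne_zero hP hV h⟩
  rw [comp_eq_of_moveOp_ne_zero hP hρ hV h]
  exact mem_comp_supp.2 (SimpleGraph.Reachable.refl _)

/-- The left region contains the dependence set of an active move entirely or not at all. -/
theorem mem_leftRegion_iff_of_mem_act {S : Setup k} {y : Fin k → ℤ} {η : S.Conf} {ρ : S.Pt → ℤ}
    (hρ : ρ ∈ S.Act (S.ball y) η) {x z : S.Pt} (hx : x ∈ S.depSet ρ) (hxV : x ∈ S.ball y)
    (hz : z ∈ S.depSet ρ) (hzV : z ∈ S.ball y) :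
    x ∈ S.leftRegion (S.comp (S.ball y) η) ↔ z ∈ S.leftRegion (S.comp (S.ball y) η) := by
  have key : ∀ {x z : S.Pt}, x ∈ S.depSet ρ → x ∈ S.ball y → z ∈ S.depSet ρ → z ∈ S.ball y →
      x ∈ S.leftRegion (S.comp (S.ball y) η) → z ∈ S.leftRegion (S.comp (S.ball y) η) := by
    intro x z hx hxV hz hzV hL
    obtain ⟨_, w, hw, hwa⟩ := mem_leftRegion.1 hL
    exact mem_leftRegion.2 ⟨hzV, w, .head ⟨ρ, hρ, ⟨hz, hzV⟩, hx, hxV⟩ hw, hwa⟩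
  exact ⟨key hx hxV hz hzV, key hz hzV hx hxV⟩

/-- A move attached to a point `y` does not change the left region of `y'` near `y'`, if the configuration is
good before and after: either it is a move inside `B_{y'}`, or it is far from `y'`. -/
theorem mem_leftRegion_iff_of_moveOp_ne_zero {S : Setup k} (hr : 2 ≤ S.r) {c : ℝ} (hP : S.PotBounds c)
    {ρ : S.Pt → ℤ} {W : Finset S.Pt} (hρ : ρ ∈ S.moves W) {η ζ : S.Conf} (h : S.moveOp ρ η ζ ≠ 0)
    {y' : Fin k → ℤ} (hη : S.Good y' η) (hζ : S.Good y' ζ) {x : S.Pt} (hx : S.Near y' x) :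
    x ∈ S.leftRegion (S.comp (S.ball y') η) ↔ x ∈ S.leftRegion (S.comp (S.ball y') ζ) := by
  classical
  by_cases hV : S.moveSupp ρ ⊆ S.ball y'
  · rw [comp_eq_of_moveOp_ne_zero hP hρ hV h]
  have hfar : ∀ z ∈ S.moveSupp ρ, 11 / 8 * (S.r : ℝ) ^ 2 < eucl (z.1 - S.center y') := by
    intro z hz
    obtain ⟨w, hw, hwV⟩ := Finset.not_subset.1 hV
    have hws : w ∈ S.strip := S.depSet_subset_strip ρ (moveSupp_subset_depSet hρ hw)
    have h1 : 2 * (S.r : ℝ) ^ 2 < eucl (w.1 - S.center y') := by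
      by_contra hle
      exact hwV (mem_ball.2 ⟨hws, not_lt.1 hle⟩)
    have h2 := eucl_sub_le_of_mem_depSet (moveSupp_subset_depSet hρ hw) hz
    have h3 := Setup.eucl_sub_le w.1 z.1 (S.center y')
    have h4 : (2 : ℝ) ≤ S.r := by exact_mod_cast hr
    nlinarith
  have key : ∀ {η ζ : S.Conf}, S.Good y' η → (∀ z, z ∉ S.moveSupp ρ → η z = ζ z) →
      x ∈ S.leftRegion (S.comp (S.ball y') η) → x ∈ S.leftRegion (S.comp (S.ball y') ζ) := by
    intro η ζ hη hηζ hL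
    obtain ⟨hxV, z, hz, hza⟩ := mem_leftRegion.1 hL
    refine mem_leftRegion.2 ⟨hxV, z, ?_, hza⟩
    refine cl_transfer (U := S.ball y' \ S.moveSupp ρ) Finset.sdiff_subset
      (fun w hw => hηζ w (Finset.mem_sdiff.1 hw).2) (fun w hw => ?_) hz
    refine Finset.mem_sdiff.2 ⟨mem_ball_of_cl hxV hw, fun hwρ => ?_⟩
    have := hη.eucl_center_le hw hx
    linarith [hfar w hwρ]
  have h1 := moveOp_apply_ne_zero h
  exact ⟨key hη fun z hz => eq_of_notMem_moveSupp h1 hz,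
    key hζ fun z hz => (eq_of_notMem_moveSupp h1 hz).symm⟩

/-! ### Large clusters are rare -/

/-- The exponent of the width of the resonances in frequency space. -/
noncomputable def resExp (S : Setup k) : ℝ := max (1 + S.γ) (S.q - 2)

theorem Admissible.resExp_pos {S : Setup k} (hS : S.Admissible) : 0 < S.resExp :=
  lt_max_of_lt_left (by linarith [hS.γ_pos])

theorem lvl_le {S : Setup k} (hM : 0 ≤ S.M) (t : S.Lvl) : ((t : ℕ) : ℝ) ≤ S.M := by
  have h1 : (t : ℕ) ≤ ⌊S.M⌋₊ := Nat.lt_succ_iff.1 t.2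
  exact (Nat.cast_le.2 h1).trans (Nat.floor_le hM)

/-- The exponent gained per active move: a resonance of width `M ^ max (1 + γ) (q - 2)` in the frequency
`t ^ (q - 1)` contains a fraction `M ^ (-gap q γ)` of the levels `t ≤ M`. -/
noncomputable def gap (q γ : ℝ) : ℝ := 1 - max (1 + γ) (q - 2) / (q - 1)

theorem gap_pos {q γ : ℝ} (hq : 2 < q) (hγq : γ < q - 2) : 0 < gap q γ := by
  have h1 : max (1 + γ) (q - 2) < q - 1 := max_lt (by linarith) (by linarith)
  have h2 : max (1 + γ) (q - 2) / (q - 1) < 1 := (div_lt_one (by linarith)).2 h1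
  unfold gap
  linarith

/-- A bounded displacement that nearly conserves the energy is nearly orthogonal to the frequencies, by
Taylor expansion. -/
theorem abs_pairing_freq_le {S : Setup k} (hS : S.Admissible) {ι : Type*} [Fintype ι] {N : ℕ}
    (hN : Fintype.card ι ≤ N) {σ τ : ι → S.Lvl}
    (hd : ∀ x, |((τ x : ℕ) : ℤ) - ((σ x : ℕ) : ℤ)| ≤ S.r)
    (hE : |(∑ x, ((σ x : ℕ) : ℝ) ^ S.q) - ∑ x, ((τ x : ℕ) : ℝ) ^ S.q| ≤ S.M ^ (1 + S.γ)) :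
    |∑ x, ((((τ x : ℕ) : ℤ) - ((σ x : ℕ) : ℤ) : ℤ) : ℝ) * ((σ x : ℕ) : ℝ) ^ (S.q - 1)| ≤
        (1 + (S.q - 1) * N * S.r ^ 2 + (S.q - 1) * S.r) * S.M ^ S.resExp ∧
      ∀ x, |((τ x : ℕ) : ℝ) ^ (S.q - 1) - ((σ x : ℕ) : ℝ) ^ (S.q - 1)| ≤
        (1 + (S.q - 1) * N * S.r ^ 2 + (S.q - 1) * S.r) * S.M ^ S.resExp := by
  have hM := hS.M_pos
  have hq := hS.two_lt
  have hT : 0 < S.M ^ S.resExp := Real.rpow_pos_of_pos hM _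
  have h1 : S.M ^ (1 + S.γ) ≤ S.M ^ S.resExp :=
    Real.rpow_le_rpow_of_exponent_le hS.one_le (le_max_left _ _)
  have h2 : S.M ^ (S.q - 2) ≤ S.M ^ S.resExp :=
    Real.rpow_le_rpow_of_exponent_le hS.one_le (le_max_right _ _)
  have hN0 : (0 : ℝ) ≤ N := Nat.cast_nonneg _
  have hr0 : (0 : ℝ) ≤ S.r := Nat.cast_nonneg _
  have hd' : ∀ x, |((τ x : ℕ) : ℝ) - ((σ x : ℕ) : ℝ)| ≤ S.r := fun x => by exact_mod_cast hd x
  have hqN : 0 ≤ (S.q - 1) * N * S.r ^ 2 := mul_nonneg (mul_nonneg (by linarith) hN0) (by positivity)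
  have hqr : 0 ≤ (S.q - 1) * S.r := mul_nonneg (by linarith) hr0
  constructor
  · have h3 : ∀ x, |((τ x : ℕ) : ℝ) ^ S.q - ((σ x : ℕ) : ℝ) ^ S.q -
        S.q * ((σ x : ℕ) : ℝ) ^ (S.q - 1) * (((τ x : ℕ) : ℝ) - ((σ x : ℕ) : ℝ))| ≤
        S.q * (S.q - 1) * S.M ^ S.resExp * S.r ^ 2 := by
      intro x
      refine (abs_rpow_sub_linear_le hq (Nat.cast_nonneg _) (Nat.cast_nonneg _)
        (lvl_le hM.le (σ x)) (lvl_le hM.le (τ x))).trans ?_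
      have h4 : 0 ≤ S.q * (S.q - 1) := mul_nonneg (by linarith) (by linarith)
      refine mul_le_mul (mul_le_mul_of_nonneg_left h2 h4)
        (pow_le_pow_left₀ (abs_nonneg _) (hd' x) 2) (by positivity) (mul_nonneg h4 hT.le)
    have h5 : |∑ x, (((τ x : ℕ) : ℝ) ^ S.q - ((σ x : ℕ) : ℝ) ^ S.q -
        S.q * ((σ x : ℕ) : ℝ) ^ (S.q - 1) * (((τ x : ℕ) : ℝ) - ((σ x : ℕ) : ℝ)))| ≤
        N * (S.q * (S.q - 1) * S.M ^ S.resExp * S.r ^ 2) := by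
      refine (Finset.abs_sum_le_sum_abs _ _).trans
        ((Finset.sum_le_card_nsmul _ _ _ fun x _ => h3 x).trans ?_)
      rw [nsmul_eq_mul]
      refine mul_le_mul_of_nonneg_right (by exact_mod_cast hN) ?_
      exact mul_nonneg (mul_nonneg (mul_nonneg (by linarith) (by linarith)) hT.le) (by positivity)
    set P := ∑ x, ((((τ x : ℕ) : ℤ) - ((σ x : ℕ) : ℤ) : ℤ) : ℝ) * ((σ x : ℕ) : ℝ) ^ (S.q - 1) with hP
    have h6 : ∑ x, (((τ x : ℕ) : ℝ) ^ S.q - ((σ x : ℕ) : ℝ) ^ S.q -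
        S.q * ((σ x : ℕ) : ℝ) ^ (S.q - 1) * (((τ x : ℕ) : ℝ) - ((σ x : ℕ) : ℝ))) =
        (∑ x, ((τ x : ℕ) : ℝ) ^ S.q) - (∑ x, ((σ x : ℕ) : ℝ) ^ S.q) - S.q * P := by
      rw [hP, Finset.sum_sub_distrib, Finset.sum_sub_distrib, Finset.mul_sum]
      congr 1
      refine Finset.sum_congr rfl fun x _ => ?_
      push_cast
      ring
    rw [h6] at h5
    have h7 : S.q * |P| ≤ S.M ^ S.resExp + N * (S.q * (S.q - 1) * S.M ^ S.resExp * S.r ^ 2) := by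
      rw [← abs_of_pos (by linarith : 0 < S.q), ← abs_mul, abs_of_pos (by linarith : 0 < S.q)]
      have e1 := abs_le.1 h5
      have e2 := abs_le.1 (hE.trans h1)
      exact abs_le.2 ⟨by linarith, by linarith⟩
    have h8 : S.q * |P| ≤ S.q * ((1 + (S.q - 1) * N * S.r ^ 2) * S.M ^ S.resExp) := by
      nlinarith
    have h9 := le_of_mul_le_mul_left h8 (by linarith : 0 < S.q)
    refine h9.trans (mul_le_mul_of_nonneg_right (by linarith) hT.le)
  · intro x
    have h3 := abs_rpow_sub_rpow_le (by linarith : 1 < S.q - 1)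
      (Nat.cast_nonneg ((σ x : ℕ))) (Nat.cast_nonneg ((τ x : ℕ)))
      (lvl_le hM.le (σ x)) (lvl_le hM.le (τ x))
    rw [show S.q - 1 - 1 = S.q - 2 by ring] at h3
    refine h3.trans ?_
    calc _ ≤ (S.q - 1) * S.M ^ S.resExp * S.r :=
          mul_le_mul (mul_le_mul_of_nonneg_left h2 (by linarith)) (hd' x) (abs_nonneg _)
            (mul_nonneg (by linarith) hT.le)
      _ = (S.q - 1) * S.r * S.M ^ S.resExp := by ring
      _ ≤ _ := mul_le_mul_of_nonneg_right (by linarith) hT.le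

theorem Linked.abs_sub_le {S : Setup k} {V : Finset S.Pt} {ρ : S.Pt → ℤ} (hρ : ρ ∈ S.moves V)
    {σ τ : S.VConf V} (h : S.Linked V ρ σ τ) (x : {x // x ∈ V}) :
    |((τ x : ℕ) : ℤ) - ((σ x : ℕ) : ℤ)| ≤ S.r := by
  have := (mem_moves.1 hρ).1 x.1
  rcases h.1 with h1 | h1
  · rw [h1]; exact this
  · rw [h1, abs_neg]; exact this

/-- A move that is active somewhere in the component of `η` is resonant at `η` itself, up to a constant. -/
theorem exists_act_resonant (k : ℕ) (q : ℝ) (hq : 2 < q) (r : ℕ) : ∃ B : ℝ, 0 ≤ B ∧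
    ∀ S : Setup k, S.Admissible → S.q = q → S.r = r → ∀ (y : Fin k → ℤ) (η : S.Conf),
      ∀ ρ ∈ S.Act (S.ball y) η,
        |∑ x : {x // x ∈ S.ball y}, (ρ x.1 : ℝ) * ((η x.1 : ℕ) : ℝ) ^ (q - 1)| ≤
          B * S.M ^ S.resExp := by
  set N := (2 * (2 * r ^ 2) + 1) ^ (k + 1) with hN
  obtain ⟨B, hB, h⟩ := exists_drift_bound N r
  set e : ℝ := 1 + (q - 1) * N * r ^ 2 + (q - 1) * r with he
  have he0 : 0 ≤ e := by
    have h1 : 0 ≤ (q - 1) * N * r ^ 2 :=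
      mul_nonneg (mul_nonneg (by linarith) (Nat.cast_nonneg _)) (by positivity)
    have h2 : 0 ≤ (q - 1) * r := mul_nonneg (by linarith) (Nat.cast_nonneg _)
    linarith
  refine ⟨e + N * r * (B * e), by positivity, ?_⟩
  rintro S hS rfl rfl y η ρ hρ
  set V := S.ball y with hV
  have hcard : Fintype.card {x // x ∈ V} ≤ N := by
    rw [Fintype.card_coe]; exact S.card_ball_le y
  have hT : 0 < S.M ^ S.resExp := Real.rpow_pos_of_pos hS.M_pos _
  have hω : StrictMono fun t : ℕ => (t : ℝ) ^ (S.q - 1) := fun a b hab =>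
    Real.rpow_lt_rpow (Nat.cast_nonneg _) (by exact_mod_cast hab) (by linarith)
  let step : ({x // x ∈ V} → ℕ) → ({x // x ∈ V} → ℕ) → Prop := fun σ τ =>
    ∃ σ' τ' : S.VConf V, (∀ x, σ x = σ' x) ∧ (∀ x, τ x = τ' x) ∧ (S.resGraph V).Adj σ' τ'
  have hadj : ∀ σ τ : S.VConf V, (S.resGraph V).Adj σ τ →
      (∀ x, |((τ x : ℕ) : ℤ) - ((σ x : ℕ) : ℤ)| ≤ S.r) ∧
      |(∑ x, ((σ x : ℕ) : ℝ) ^ S.q) - ∑ x, ((τ x : ℕ) : ℝ) ^ S.q| ≤ S.M ^ (1 + S.γ) := by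
    intro σ τ hστ
    obtain ⟨_, ⟨ρ, hρ, h1⟩ | ⟨ρ, hρ, h1⟩⟩ := (SimpleGraph.fromRel_adj _ _ _).1 hστ
    · exact ⟨h1.abs_sub_le hρ, h1.2⟩
    · refine ⟨fun x => ?_, ?_⟩
      · rw [abs_sub_comm]; exact h1.abs_sub_le hρ x
      · rw [abs_sub_comm]; exact h1.2
  have hstep : IsResonantStep S.r (fun t : ℕ => (t : ℝ) ^ (S.q - 1)) (e * S.M ^ S.resExp) step := by
    refine ⟨?_, ?_, ?_⟩
    · rintro σ τ ⟨σ', τ', h1, h2, h3⟩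
      exact ⟨τ', σ', h2, h1, h3.symm⟩
    · rintro σ τ ⟨σ', τ', h1, h2, h3⟩
      obtain ⟨h4, h5⟩ := hadj _ _ h3
      refine ⟨fun x => ((τ' x : ℕ) : ℤ) - ((σ' x : ℕ) : ℤ), h4, fun x => by rw [h1, h2], ?_⟩
      simp only [h1]
      exact (abs_pairing_freq_le hS hcard h4 h5).1
    · rintro σ τ ⟨σ', τ', h1, h2, h3⟩ x
      obtain ⟨h4, h5⟩ := hadj _ _ h3
      simp only [h1, h2]
      exact (abs_pairing_freq_le hS hcard h4 h5).2 x
  obtain ⟨hρV, σ, hσ, τ, hτ, hlink⟩ := hρ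
  have hreach : Relation.ReflTransGen step (fun x => (S.restrict V η x : ℕ)) (fun x => (σ x : ℕ)) := by
    have h1 := (SimpleGraph.reachable_iff_reflTransGen _ _).1 (mem_comp_supp.1 hσ)
    exact h1.lift (fun (σ : S.VConf V) x => (σ x : ℕ)) fun a b hab =>
      ⟨a, b, fun _ => rfl, fun _ => rfl, hab⟩
  have hdrift := h _ hcard _ hω _ (by positivity) step hstep _ _ hreach
  have h1 : |∑ x : {x // x ∈ V}, (ρ x.1 : ℝ) * ((σ x : ℕ) : ℝ) ^ (S.q - 1)| ≤ e * S.M ^ S.resExp := by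
    have h2 := (abs_pairing_freq_le hS hcard (hlink.abs_sub_le hρV) hlink.2).1
    rcases hlink.1 with h3 | h3
    · simpa only [h3] using h2
    · simp only [h3, Int.cast_neg, neg_mul, Finset.sum_neg_distrib, abs_neg] at h2
      exact h2
  have h2 := abs_pairing_le hcard (ρ := fun x : {x // x ∈ V} => ρ x.1)
    (fun x => (mem_moves.1 hρV).1 x.1) (by positivity) hdrift
  have h3 : ∑ x : {x // x ∈ V}, (ρ x.1 : ℝ) * ((η x.1 : ℕ) : ℝ) ^ (S.q - 1) =
      (∑ x : {x // x ∈ V}, (ρ x.1 : ℝ) * ((σ x : ℕ) : ℝ) ^ (S.q - 1)) -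
      ∑ x : {x // x ∈ V}, (ρ x.1 : ℝ) * (((σ x : ℕ) : ℝ) ^ (S.q - 1) -
        ((S.restrict V η x : ℕ) : ℝ) ^ (S.q - 1)) := by
    rw [← Finset.sum_sub_distrib]
    refine Finset.sum_congr rfl fun x _ => ?_
    simp only [restrict]
    ring
  rw [h3]
  refine (abs_sub _ _).trans ?_
  calc _ ≤ e * S.M ^ S.resExp + N * S.r * (B * (e * S.M ^ S.resExp)) := add_le_add h1 h2
    _ = _ := by ring

/-- A chain of overlapping spots crosses every level of the `i`-th coordinate between its ends. -/
theorem exists_act_crossing {S : Setup k} {V : Finset S.Pt} {η : S.Conf} {x z : S.Pt}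
    (h : S.Cl V η x z) (i : Fin (k + 1)) {m : ℤ} (hx : x.1 i ≤ m) (hz : m < z.1 i) :
    ∃ ρ ∈ S.Act V η, ∀ w ∈ S.depSet ρ, m - 2 * S.r < w.1 i ∧ w.1 i ≤ m + 2 * S.r := by
  induction h with
  | refl => omega
  | @tail u v h1 h2 ih =>
    by_cases hu : m < u.1 i
    · exact ih hu
    obtain ⟨ρ, hρ, ⟨hu1, _⟩, hv1, _⟩ := h2
    have key : ∀ a ∈ S.depSet ρ, ∀ b ∈ S.depSet ρ, |a.1 i - b.1 i| ≤ 2 * S.r := by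
      intro a ha b hb
      have := (abs_apply_le_eucl (a.1 - b.1) i).trans
        (eucl_sub_le_of_mem_depSet₂ hρ.1 ha hb)
      rw [Pi.sub_apply] at this
      exact_mod_cast this
    refine ⟨ρ, hρ, fun w hw => ?_⟩
    have h3 := abs_le.1 (key w hw u hu1)
    have h4 := abs_le.1 (key w hw v hv1)
    constructor <;> omega

/-- A large cluster contains many active moves with disjoint supports. -/
theorem exists_disjoint_act {S : Setup k} {y : Fin k → ℤ} {η : S.Conf} (hη : ¬ S.Good y η) :
    ∃ f : ℕ → S.Pt → ℤ, (∀ j < S.r / (32 * (k + 1)), f j ∈ S.Act (S.ball y) η) ∧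
      ∀ i < S.r / (32 * (k + 1)), ∀ j < S.r / (32 * (k + 1)), i ≠ j →
        Disjoint (S.moveSupp (f i)) (S.moveSupp (f j)) := by
  classical
  unfold Good at hη
  push Not at hη
  obtain ⟨x, z, hxz, i, hi⟩ := hη
  set n := S.r / (32 * (k + 1)) with hn
  wlog hle : x.1 i ≤ z.1 i generalizing x z
  · exact this z x hxz.symm (by rwa [abs_sub_comm]) (by omega)
  rw [abs_sub_comm, abs_of_nonneg (by omega)] at hi
  have hnr : 32 * ((k : ℤ) + 1) * n ≤ S.r := by
    have := Nat.div_mul_le_self S.r (32 * (k + 1))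
    rw [← hn] at this
    have h2 : ((n * (32 * (k + 1)) : ℕ) : ℤ) ≤ S.r := by exact_mod_cast this
    push_cast at h2
    linarith
  have hlev : ∀ j < n, x.1 i + 4 * S.r * j < z.1 i := by
    intro j hj
    have hj' : (j : ℤ) ≤ n := by exact_mod_cast hj.le
    have hr0 : (0 : ℤ) ≤ S.r := Int.natCast_nonneg _
    have hk : (0 : ℤ) < (k : ℤ) + 1 := by positivity
    have h1 : 8 * ((k : ℤ) + 1) * (4 * S.r * j) ≤ (S.r : ℤ) ^ 2 := by
      calc 8 * ((k : ℤ) + 1) * (4 * S.r * j) = S.r * (32 * ((k : ℤ) + 1) * j) := by ring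
        _ ≤ S.r * (32 * ((k : ℤ) + 1) * n) := by gcongr
        _ ≤ S.r * S.r := by gcongr
        _ = _ := by ring
    have h2 : 8 * ((k : ℤ) + 1) * (4 * S.r * j) < 8 * ((k : ℤ) + 1) * (z.1 i - x.1 i) := by linarith
    have h3 := lt_of_mul_lt_mul_left h2 (by positivity)
    linarith
  have hex : ∀ j : ℕ, ∃ ρ, j < n → ρ ∈ S.Act (S.ball y) η ∧ ∀ w ∈ S.depSet ρ,
      x.1 i + 4 * S.r * j - 2 * S.r < w.1 i ∧ w.1 i ≤ x.1 i + 4 * S.r * j + 2 * S.r := by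
    intro j
    by_cases hj : j < n
    · obtain ⟨ρ, hρ, h⟩ := exists_act_crossing hxz i (m := x.1 i + 4 * S.r * j)
        (by have : (0 : ℤ) ≤ 4 * S.r * j := by positivity
            linarith) (hlev j hj)
      exact ⟨ρ, fun _ => ⟨hρ, h⟩⟩
    · exact ⟨0, fun h => absurd h hj⟩
  choose f hf using hex
  refine ⟨f, fun j hj => (hf j hj).1, ?_⟩
  have key : ∀ a < n, ∀ b < n, a < b → Disjoint (S.moveSupp (f a)) (S.moveSupp (f b)) := by
    intro a ha b hb hab
    rw [Finset.disjoint_left]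
    intro w hwa hwb
    have h1 := ((hf a ha).2 w (moveSupp_subset_depSet (hf a ha).1.1 hwa)).2
    have h2 := ((hf b hb).2 w (moveSupp_subset_depSet (hf b hb).1.1 hwb)).1
    have h3 : (a : ℤ) + 1 ≤ b := by exact_mod_cast hab
    have hr0 : (0 : ℤ) ≤ S.r := Int.natCast_nonneg _
    nlinarith
  intro a ha b hb hab
  rcases lt_or_gt_of_ne hab with h | h
  · exact key a ha b hb h
  · exact (key b hb a ha h).symm

theorem card_moves_ball_le (S : Setup k) (y : Fin k → ℤ) : (S.moves (S.ball y)).card ≤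
    (2 * S.r + 1) ^ (2 * (2 * S.r ^ 2) + 1) ^ (k + 1) := by
  classical
  have h1 : (S.moves (S.ball y)).card ≤ (box {x // x ∈ S.ball y} S.r).card := by
    refine Finset.card_le_card_of_injOn (fun ρ x => ρ x.1) (fun ρ hρ => ?_) fun ρ hρ ρ' hρ' h => ?_
    · exact mem_box.2 fun x => (mem_moves.1 hρ).1 x.1
    · funext x
      by_cases hx : x ∈ S.ball y
      · exact congrFun h ⟨x, hx⟩
      · have h0 : ∀ ρ ∈ S.moves (S.ball y), ρ x = 0 := fun ρ hρ => by
          by_contra hne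
          exact hx ((mem_moves.1 hρ).2.2.2.1 (mem_moveSupp.2 hne))
        rw [h0 ρ hρ, h0 ρ' hρ']
  refine h1.trans ?_
  rw [card_box, Fintype.card_coe]
  exact Nat.pow_le_pow_right (by omega) (S.card_ball_le y)

open Classical in
/-- Configurations with a large cluster are rare: each of `r / (32 d)` disjoint resonances restricts one
occupation number to a fraction `M ^ (-gap q γ)` of the levels. -/
theorem exists_card_not_good_le (k : ℕ) (q γ : ℝ) (hq : 2 < q) (r : ℕ) :
    ∃ C : ℝ, 0 ≤ C ∧ ∀ S : Setup k, S.Admissible → S.q = q → S.γ = γ → S.r = r → ∀ y : Fin k → ℤ,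
      ((Finset.univ.filter fun η : S.Conf => ¬ S.Good y η).card : ℝ) ≤
        C * S.M ^ (-gap q γ * (r / (32 * (k + 1)) : ℕ)) *
          Fintype.card S.Conf := by
  classical
  obtain ⟨B, hB, hres⟩ := exists_act_resonant k q hq r
  set n := r / (32 * (k + 1)) with hn
  set N := (2 * (2 * r ^ 2) + 1) ^ (k + 1) with hN
  set β : ℝ := (2 * B) ^ (1 / (q - 1)) + 1 with hβ
  have hβ0 : 0 ≤ β := by positivity
  refine ⟨(((2 * r + 1) ^ N : ℕ) : ℝ) ^ n * β ^ n, by positivity, ?_⟩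
  rintro S hS rfl rfl rfl y
  have hM := hS.M_pos
  set V := S.ball y with hV
  set b : ℝ := B * S.M ^ S.resExp with hb
  have hb0 : 0 ≤ b := by positivity
  let Q : (S.Pt → ℤ) → S.Conf → Prop := fun ρ η =>
    |∑ x ∈ V, (ρ x : ℝ) * ((η x : ℕ) : ℝ) ^ (S.q - 1)| ≤ b
  set m : ℕ := ⌊(2 * b) ^ (1 / (S.q - 1)) + 1⌋₊ with hm
  -- one resonance condition on one occupation number
  have hone : ∀ ρ ∈ S.moves V, ∀ x ∈ S.moveSupp ρ, ∀ η : S.Conf,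
      (Finset.univ.filter fun t => Q ρ (Function.update η x t)).card ≤ m := by
    intro ρ hρ x hx η
    have hxV : x ∈ V := (mem_moves.1 hρ).2.2.2.1 hx
    set R : ℝ := ∑ z ∈ V.erase x, (ρ z : ℝ) * ((η z : ℕ) : ℝ) ^ (S.q - 1) with hR
    have hs : (1 : ℝ) ≤ |(ρ x : ℝ)| := by
      have := Int.one_le_abs (mem_moveSupp.1 hx)
      exact_mod_cast this
    have hs0 : (ρ x : ℝ) ≠ 0 := by
      intro h0; rw [h0, abs_zero] at hs; linarith
    have hQ : ∀ t, Q ρ (Function.update η x t) → -(R / ρ x) - b ≤ ((t : ℕ) : ℝ) ^ (S.q - 1) ∧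
        ((t : ℕ) : ℝ) ^ (S.q - 1) ≤ -(R / ρ x) - b + 2 * b := by
      intro t ht
      have h1 : ∑ z ∈ V, (ρ z : ℝ) * ((Function.update η x t z : S.Lvl) : ℝ) ^ (S.q - 1) =
          ρ x * ((t : ℕ) : ℝ) ^ (S.q - 1) + R := by
        rw [← Finset.add_sum_erase V _ hxV, Function.update_self, hR]
        congr 1
        refine Finset.sum_congr rfl fun z hz => ?_
        rw [Function.update_of_ne (Finset.ne_of_mem_erase hz)]
      have h2 : |ρ x * ((t : ℕ) : ℝ) ^ (S.q - 1) + R| ≤ b := by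
        rw [← h1]; exact ht
      have h3 : ρ x * ((t : ℕ) : ℝ) ^ (S.q - 1) + R =
          ρ x * (((t : ℕ) : ℝ) ^ (S.q - 1) + R / ρ x) := by field_simp
      rw [h3, abs_mul] at h2
      have h4 : |((t : ℕ) : ℝ) ^ (S.q - 1) + R / ρ x| ≤ b := by
        nlinarith [abs_nonneg (((t : ℕ) : ℝ) ^ (S.q - 1) + R / ρ x)]
      have h5 := abs_le.1 h4
      constructor <;> linarith
    refine Nat.le_floor ?_
    refine le_trans ?_ (card_rpow_mem_interval_le (p := S.q - 1) (by linarith) (⌊S.M⌋₊ + 1)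
      (-(R / ρ x) - b) (2 * b) (by linarith))
    exact_mod_cast Finset.card_le_card fun t ht => by
      rw [Finset.mem_filter] at ht ⊢
      exact ⟨ht.1, hQ t ht.2⟩
  -- a fixed family of moves with disjoint supports
  have hfam : ∀ f : Fin n → S.Pt → ℤ, (∀ j, f j ∈ S.moves V) →
      (∀ i j, i ≠ j → Disjoint (S.moveSupp (f i)) (S.moveSupp (f j))) →
      (Finset.univ.filter fun η : S.Conf => ∀ j, Q (f j) η).card * Fintype.card S.Lvl ^ n ≤
        m ^ n * Fintype.card S.Conf := by
    intro f hf hdisj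
    rcases Nat.eq_zero_or_pos n with h0 | hpos
    · have e1 : ∀ a : ℕ, a ^ n = 1 := fun a => by rw [h0, pow_zero]
      rw [e1, e1, mul_one, one_mul]
      exact Finset.card_le_univ _
    have hne : ∀ j, ∃ x, x ∈ S.moveSupp (f j) := fun j => moveSupp_nonempty (hf j)
    choose x hx using hne
    let j' : ℕ → Fin n := fun j => if h : j < n then ⟨j, h⟩ else ⟨0, hpos⟩
    have hj' : ∀ j (h : j < n), j' j = ⟨j, h⟩ := fun j h => dif_pos h
    have h1 := card_forall_lt_mul_pow_le n (fun j => x (j' j)) (fun j => Q (f (j' j))) m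
      (fun i hi j hj hij η t hQ => ?_) (fun j hj η => hone _ (hf _) _ (hx _) η)
    · refine le_trans (Nat.mul_le_mul_right _ (Finset.card_le_card fun η hη => ?_)) h1
      rw [Finset.mem_filter] at hη ⊢
      exact ⟨hη.1, fun j _ => hη.2 _⟩
    · have hne : j' i ≠ j' j := by
        rw [hj' i hi, hj' j hj]
        simpa using hij
      have hxz : f (j' j) (x (j' i)) = 0 := by
        by_contra h0
        exact Finset.disjoint_left.1 (hdisj _ _ hne) (hx _) (mem_moveSupp.2 h0)
      have h2 : ∑ z ∈ V, (f (j' j) z : ℝ) *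
          ((Function.update η (x (j' i)) t z : S.Lvl) : ℝ) ^ (S.q - 1) =
          ∑ z ∈ V, (f (j' j) z : ℝ) * ((η z : ℕ) : ℝ) ^ (S.q - 1) := by
        refine Finset.sum_congr rfl fun z _ => ?_
        by_cases hz : z = x (j' i)
        · rw [hz, hxz]; simp
        · rw [Function.update_of_ne hz]
      change |_| ≤ b
      rw [h2]
      exact hQ
  -- the union over all families
  set Fam : Finset (Fin n → S.Pt → ℤ) := (Fintype.piFinset fun _ : Fin n => S.moves V).filter
    fun f => ∀ i j, i ≠ j → Disjoint (S.moveSupp (f i)) (S.moveSupp (f j)) with hFam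
  have hcover : (Finset.univ.filter fun η : S.Conf => ¬ S.Good y η) ⊆
      Fam.biUnion fun f => Finset.univ.filter fun η : S.Conf => ∀ j, Q (f j) η := by
    intro η hη
    obtain ⟨f, hf, hd⟩ := exists_disjoint_act (Finset.mem_filter.1 hη).2
    refine Finset.mem_biUnion.2 ⟨fun j => f j, ?_, ?_⟩
    · rw [hFam, Finset.mem_filter, Fintype.mem_piFinset]
      exact ⟨fun j => (hf j j.2).1, fun i j hij => hd i i.2 j j.2 fun h => hij (Fin.ext h)⟩
    · rw [Finset.mem_filter]
      refine ⟨Finset.mem_univ _, fun j => ?_⟩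
      have := hres S hS rfl rfl y η (f j) (hf j j.2)
      rwa [Finset.sum_coe_sort V fun x => (f j x : ℝ) * ((η x : ℕ) : ℝ) ^ (S.q - 1)] at this
  have hFcard : Fam.card ≤ ((2 * S.r + 1) ^ N) ^ n := by
    refine (Finset.card_filter_le _ _).trans ?_
    rw [Fintype.card_piFinset, Finset.prod_const, Finset.card_univ, Fintype.card_fin]
    exact Nat.pow_le_pow_left (S.card_moves_ball_le y) n
  set bad : ℕ := (Finset.univ.filter fun η : S.Conf => ¬ S.Good y η).card with hbad
  have htotal : bad * Fintype.card S.Lvl ^ n ≤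
      ((2 * S.r + 1) ^ N) ^ n * (m ^ n * Fintype.card S.Conf) := by
    calc bad * Fintype.card S.Lvl ^ n
        ≤ (∑ f ∈ Fam, (Finset.univ.filter fun η : S.Conf => ∀ j, Q (f j) η).card) *
          Fintype.card S.Lvl ^ n :=
          Nat.mul_le_mul_right _ ((Finset.card_le_card hcover).trans Finset.card_biUnion_le)
      _ = ∑ f ∈ Fam, (Finset.univ.filter fun η : S.Conf => ∀ j, Q (f j) η).card *
          Fintype.card S.Lvl ^ n := Finset.sum_mul _ _ _
      _ ≤ ∑ f ∈ Fam, m ^ n * Fintype.card S.Conf := by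
          refine Finset.sum_le_sum fun f hf => ?_
          rw [hFam, Finset.mem_filter, Fintype.mem_piFinset] at hf
          exact hfam f hf.1 hf.2
      _ ≤ _ := by
          rw [Finset.sum_const, smul_eq_mul]
          exact Nat.mul_le_mul_right _ hFcard
  have hL : S.M ≤ (Fintype.card S.Lvl : ℝ) := by
    rw [Fintype.card_fin]
    push_cast
    exact (Nat.lt_floor_add_one S.M).le
  have hmle : (m : ℝ) ≤ β * S.M ^ (S.resExp / (S.q - 1)) := by
    have h1 : (0 : ℝ) ≤ (2 * b) ^ (1 / (S.q - 1)) := by positivity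
    refine (Nat.floor_le (by linarith)).trans ?_
    have h2 : (2 * b) ^ (1 / (S.q - 1)) = (2 * B) ^ (1 / (S.q - 1)) * S.M ^ (S.resExp / (S.q - 1)) := by
      rw [hb, ← mul_assoc, Real.mul_rpow (by positivity) (by positivity), ← Real.rpow_mul hM.le]
      congr 2
      ring
    have h3 : 1 ≤ S.M ^ (S.resExp / (S.q - 1)) :=
      Real.one_le_rpow hS.one_le (div_nonneg hS.resExp_pos.le (by linarith))
    rw [h2, hβ, add_mul, one_mul]
    linarith
  have hreal : (bad : ℝ) * S.M ^ n ≤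
      (((2 * S.r + 1) ^ N : ℕ) : ℝ) ^ n * ((β * S.M ^ (S.resExp / (S.q - 1))) ^ n *
        Fintype.card S.Conf) := by
    calc (bad : ℝ) * S.M ^ n ≤ bad * (Fintype.card S.Lvl : ℝ) ^ n := by gcongr
      _ ≤ (((2 * S.r + 1) ^ N : ℕ) : ℝ) ^ n * ((m : ℝ) ^ n * Fintype.card S.Conf) := by
          exact_mod_cast htotal
      _ ≤ _ := by gcongr
  have hpow : S.M ^ (-gap S.q S.γ * (n : ℕ)) * S.M ^ n =
      (S.M ^ (S.resExp / (S.q - 1))) ^ n := by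
    rw [← Real.rpow_natCast, ← Real.rpow_natCast, ← Real.rpow_mul hM.le, ← Real.rpow_add hM]
    congr 1
    change -(1 - S.resExp / (S.q - 1)) * (n : ℝ) + n = _
    ring
  have hMn : 0 < S.M ^ n := by positivity
  refine le_of_mul_le_mul_right ?_ hMn
  refine hreal.trans (le_of_eq ?_)
  rw [mul_pow, ← hpow]
  ring

/-! ### The terms of the strip Hamiltonian -/

/-- Labels of the terms of the strip Hamiltonian: sets `A` for the diagonal terms `D(A)`, moves `ρ` for
the operators `W_ρ`. -/
abbrev Term (S : Setup k) := Finset S.Pt ⊕ (S.Pt → ℤ)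

/-- The operator of a term. -/
noncomputable def termOp (S : Setup k) : S.Term → S.Op
  | .inl A => S.dPot A
  | .inr ρ => S.moveOp ρ

/-- The set that decides to which point `y`, and to which side, a term is assigned. -/
def termSupp (S : Setup k) : S.Term → Finset S.Pt
  | .inl A => A
  | .inr ρ => S.moveSupp ρ

/-- The set of sites on which a term acts. -/
noncomputable def termDep (S : Setup k) : S.Term → Finset S.Pt
  | .inl A => A
  | .inr ρ => S.depSet ρ

/-- The change of the configuration effected by a term. -/
def termShift (S : Setup k) : S.Term → S.Pt → ℤ
  | .inl _ => 0
  | .inr ρ => ρ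

open Classical in
/-- The terms attached to the point `y`. -/
noncomputable def terms (S : Setup k) (yc : Finset S.Pt → (Fin k → ℤ)) (y : Fin k → ℤ) :
    Finset S.Term :=
  (S.strip.powerset.filter fun A => yc A = y ∧ S.Conn A ∧ A.card ≤ S.r).disjSum
    ((S.moves S.strip).filter fun ρ => yc (S.moveSupp ρ) = y)

theorem inl_mem_terms {S : Setup k} {yc : Finset S.Pt → (Fin k → ℤ)} {y : Fin k → ℤ}
    {A : Finset S.Pt} : Sum.inl A ∈ S.terms yc y ↔
      A ⊆ S.strip ∧ yc A = y ∧ S.Conn A ∧ A.card ≤ S.r := by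
  simp [terms]

theorem inr_mem_terms {S : Setup k} {yc : Finset S.Pt → (Fin k → ℤ)} {y : Fin k → ℤ}
    {ρ : S.Pt → ℤ} : Sum.inr ρ ∈ S.terms yc y ↔ ρ ∈ S.moves S.strip ∧ yc (S.moveSupp ρ) = y := by
  simp [terms]

open Classical in
/-- The part of the terms in `J` selected by a condition on the row configuration. -/
noncomputable def select (S : Setup k) (J : Finset S.Term) (χ : S.Term → S.Conf → Prop) : S.Op :=
  ∑ j ∈ J, Matrix.diagonal (fun η => if χ j η then (1 : ℂ) else 0) * S.termOp j

/-- Sums over components `μ` of terms selected by `μ`, rewritten term by term: exactly one `μ` contains a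
given row. The sets `A` that are not connected or too large drop out since `D(A) = 0`. -/
theorem sum_proj_mul_eq_select {S : Setup k} {c : ℝ} (hP : S.PotBounds c)
    (yc : Finset S.Pt → (Fin k → ℤ)) (y : Fin k → ℤ) (p : S.Comp (S.ball y) → Finset S.Pt → Prop)
    [∀ μ, DecidablePred fun A => yc A = y ∧ p μ A]
    [∀ μ, DecidablePred fun ρ => yc (S.moveSupp ρ) = y ∧ p μ (S.moveSupp ρ)] :
    (∑ μ : S.Comp (S.ball y), S.proj μ *
      ((∑ A ∈ S.strip.powerset with yc A = y ∧ p μ A, S.dPot A) +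
        ∑ ρ ∈ S.moves S.strip with yc (S.moveSupp ρ) = y ∧ p μ (S.moveSupp ρ), S.moveOp ρ)) =
    S.select (S.terms yc y) fun j η => p (S.comp (S.ball y) η) (S.termSupp j) := by
  classical
  ext η η'
  rw [Matrix.sum_apply, Finset.sum_eq_single (S.comp (S.ball y) η)]
  · rw [select, terms, Finset.sum_disjSum, Matrix.add_apply, Matrix.sum_apply, Matrix.sum_apply,
      proj, Matrix.diagonal_mul, if_pos (mem_comp_supp.2 (SimpleGraph.Reachable.refl _)), one_mul,
      Matrix.add_apply, Matrix.sum_apply, Matrix.sum_apply]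
    simp only [Matrix.diagonal_mul, termSupp, termOp, Finset.sum_filter]
    congr 1
    · refine Finset.sum_congr rfl fun A _ => ?_
      by_cases h1 : S.Conn A ∧ A.card ≤ S.r
      · simp only [h1, and_true]
        by_cases h2 : yc A = y <;> by_cases h3 : p (S.comp (S.ball y) η) A <;> simp [h2, h3]
      · have h0 : S.dPot A η η' = 0 := by
          rcases not_and_or.1 h1 with h1 | h1
          · rw [hP.isLocal_dPot.conn A h1]; rfl
          · rw [hP.dPot_card A (by omega)]; rfl
        simp [h0]
    · refine Finset.sum_congr rfl fun ρ _ => ?_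
      by_cases h2 : yc (S.moveSupp ρ) = y <;>
        by_cases h3 : p (S.comp (S.ball y) η) (S.moveSupp ρ) <;> simp [h2, h3]
  · intro μ _ hμ
    rw [proj, Matrix.diagonal_mul, if_neg, zero_mul]
    intro h
    exact hμ h.symm
  · simp

theorem zLeft_eq {S : Setup k} {c : ℝ} (hP : S.PotBounds c) (yc : Finset S.Pt → (Fin k → ℤ))
    (y : Fin k → ℤ) : S.zLeft yc y = S.select (S.terms yc y) fun j η =>
      S.termSupp j ⊆ S.leftRegion (S.comp (S.ball y) η) :=
  sum_proj_mul_eq_select hP yc y fun μ A => A ⊆ S.leftRegion μ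

theorem zRight_eq {S : Setup k} {c : ℝ} (hP : S.PotBounds c) (yc : Finset S.Pt → (Fin k → ℤ))
    (y : Fin k → ℤ) : S.zRight yc y = S.select (S.terms yc y) fun j η =>
      ¬ S.termSupp j ⊆ S.leftRegion (S.comp (S.ball y) η) :=
  sum_proj_mul_eq_select hP yc y fun μ A => ¬ A ⊆ S.leftRegion μ

section Terms

variable {S : Setup k} {yc : Finset S.Pt → (Fin k → ℤ)} {y : Fin k → ℤ} {j : S.Term}

theorem termSupp_subset_termDep (hj : j ∈ S.terms yc y) : S.termSupp j ⊆ S.termDep j := by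
  rcases j with A | ρ
  · exact subset_rfl
  · exact moveSupp_subset_depSet (inr_mem_terms.1 hj).1

theorem termSupp_nonempty (hj : j ∈ S.terms yc y) : (S.termSupp j).Nonempty := by
  rcases j with A | ρ
  · exact (inl_mem_terms.1 hj).2.2.1.nonempty
  · exact moveSupp_nonempty (inr_mem_terms.1 hj).1

theorem eucl_sub_le_of_mem_termDep (hj : j ∈ S.terms yc y) {x w : S.Pt} (hx : x ∈ S.termDep j)
    (hw : w ∈ S.termSupp j) : eucl (x.1 - w.1) ≤ S.r := by
  rcases j with A | ρ
  · obtain ⟨_, _, h3, h4⟩ := inl_mem_terms.1 hj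
    exact (h3.eucl_sub_le hx hw).trans (by exact_mod_cast h4)
  · exact eucl_sub_le_of_mem_depSet hx hw

theorem near_of_mem_termDep (hr : 4 ≤ S.r) (hyc : S.Assigns yc) (hj : j ∈ S.terms yc y) {x : S.Pt}
    (hx : x ∈ S.termDep j) : S.Near y x := by
  have hstrip : S.termDep j ⊆ S.strip := by
    rcases j with A | ρ
    · exact (inl_mem_terms.1 hj).1
    · exact S.depSet_subset_strip ρ
  have hcard : (S.termSupp j).card ≤ S.r := by
    rcases j with A | ρ
    · exact (inl_mem_terms.1 hj).2.2.2
    · exact (mem_moves.1 (inr_mem_terms.1 hj).1).2.2.2.2.1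
  have hy : yc (S.termSupp j) = y := by
    rcases j with A | ρ
    · exact (inl_mem_terms.1 hj).2.1
    · exact (inr_mem_terms.1 hj).2
  obtain ⟨w, hw, hyw⟩ := hyc _ (termSupp_nonempty hj)
    ((termSupp_subset_termDep hj).trans hstrip) hcard
  exact near_of_tail_eq hr (hstrip hx) (hstrip (termSupp_subset_termDep hj hw)) (hy ▸ hyw)
    (eucl_sub_le_of_mem_termDep hj hx hw)

theorem termDep_subset_ball (hr : 4 ≤ S.r) (hyc : S.Assigns yc) (hj : j ∈ S.terms yc y) :
    S.termDep j ⊆ S.ball y := fun _ hx => (near_of_mem_termDep hr hyc hj hx).mem_ball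

theorem loc_termOp {c : ℝ} (hP : S.PotBounds c) (hj : j ∈ S.terms yc y) :
    S.Loc (S.termDep j) (S.termOp j) := by
  rcases j with A | ρ
  · exact hP.isLocal_dPot.loc A
  · exact loc_moveOp hP (inr_mem_terms.1 hj).1

theorem termOp_apply_ne_zero {η ζ : S.Conf} (h : S.termOp j η ζ ≠ 0) :
    ∀ x, ((ζ x : ℕ) : ℤ) = ((η x : ℕ) : ℤ) + S.termShift j x := by
  rcases j with A | ρ
  · have : η = ζ := by
      by_contra hne
      exact h (S.dPot_apply_ne A hne)
    intro x
    rw [this]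
    simp [termShift]
  · exact moveOp_apply_ne_zero h

theorem conf_ext {η ζ : S.Conf} (h : ∀ x, ((η x : ℕ) : ℤ) = ((ζ x : ℕ) : ℤ)) : η = ζ :=
  funext fun x => Fin.ext (by exact_mod_cast h x)

theorem isShift_diagonal_mul_termOp (f : S.Conf → ℂ) (j : S.Term) :
    S.IsShift (Matrix.diagonal f * S.termOp j) := by
  refine ⟨fun η ζ ζ' h h' => conf_ext fun x => ?_, fun ζ η η' h h' => conf_ext fun x => ?_⟩ <;>
  · rw [Matrix.diagonal_mul] at h h'
    have h1 := termOp_apply_ne_zero (right_ne_zero_of_mul h) x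
    have h2 := termOp_apply_ne_zero (right_ne_zero_of_mul h') x
    linarith

/-- The number of sites that the terms attached to one point `y` can see, as a function of `r`. -/
def ballCard (k r : ℕ) : ℕ := (2 * (2 * r ^ 2) + 1) ^ (k + 1)

theorem card_terms_le (hr : 4 ≤ S.r) (hyc : S.Assigns yc) :
    (S.terms yc y).card ≤ 2 ^ ballCard k S.r + (2 * S.r + 1) ^ ballCard k S.r := by
  classical
  have hsub : S.terms yc y ⊆ (S.ball y).powerset.disjSum (S.moves (S.ball y)) := by
    intro j hj
    have h1 := (termSupp_subset_termDep hj).trans (termDep_subset_ball hr hyc hj)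
    rcases j with A | ρ
    · rw [Finset.inl_mem_disjSum, Finset.mem_powerset]
      exact h1
    · rw [Finset.inr_mem_disjSum]
      exact moves_of_subset (inr_mem_terms.1 hj).1 h1
  refine (Finset.card_le_card hsub).trans ?_
  rw [Finset.card_disjSum, Finset.card_powerset]
  exact add_le_add (Nat.pow_le_pow_right (by norm_num) (S.card_ball_le y)) (S.card_moves_ball_le y)

theorem card_hosts_le (hr : 4 ≤ S.r) (hyc : S.Assigns yc)
    {ρ : S.Pt → ℤ} (hj : Sum.inr ρ ∈ S.terms yc y) :
    ((S.depSet ρ).powerset.card : ℝ) ≤ 2 ^ ballCard k S.r := by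
  rw [Finset.card_powerset]
  have h1 : (S.depSet ρ).card ≤ ballCard k S.r :=
    (Finset.card_le_card (termDep_subset_ball hr hyc hj)).trans (S.card_ball_le y)
  exact_mod_cast Nat.pow_le_pow_right (by norm_num) h1

theorem norm_termOp_apply_le (hS : S.Admissible) (hr : 4 ≤ S.r) (hyc : S.Assigns yc) {c : ℝ}
    (hP : S.PotBounds c) (hj : j ∈ S.terms yc y) (η ζ : S.Conf) :
    ‖S.termOp j η ζ‖ ≤ 2 ^ ballCard k S.r * (2 * c) * S.M ^ S.q := by
  classical
  have hc := hP.one_le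
  have hM := hS.M_pos
  have hq : 0 < S.M ^ S.q := Real.rpow_pos_of_pos hM _
  have h2 : (1 : ℝ) ≤ 2 ^ ballCard k S.r := one_le_pow₀ (by norm_num)
  rcases j with A | ρ
  · refine (hP.dPot_le' A η ζ).trans ?_
    refine mul_le_mul_of_nonneg_right ?_ hq.le
    nlinarith
  · by_cases h : S.moveOp ρ η ζ = 0
    · change ‖S.moveOp ρ η ζ‖ ≤ _
      rw [h, norm_zero]
      positivity
    · change ‖S.moveOp ρ η ζ‖ ≤ _
      rw [moveOp_apply hP (moveOp_apply_ne_zero h)]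
      have h3 : ∀ A ∈ (S.depSet ρ).powerset.filter (fun A => S.Hosts A ρ),
          ‖S.gPot A η ζ‖ ≤ c * S.M ^ S.q := fun A _ =>
        (hP.gPot_le A η ζ).trans (hS.mul_weight_pow_le (by linarith) _)
      refine (norm_sum_le_of_le _ h3).trans ?_
      rw [Finset.sum_const, nsmul_eq_mul]
      have h4 : (((S.depSet ρ).powerset.filter (fun A => S.Hosts A ρ)).card : ℝ) ≤
          2 ^ ballCard k S.r :=
        le_trans (by exact_mod_cast Finset.card_filter_le _ _) (card_hosts_le hr hyc hj)
      have h5 : 0 ≤ c * S.M ^ S.q := by positivity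
      nlinarith [mul_le_mul_of_nonneg_right h4 h5]

end Terms

/-! ### Hilbert–Schmidt bounds for sums of sparse operators -/

open Classical in
/-- A sum of operators with one matrix element per row, small except on a rare set of rows. -/
theorem hsNorm_sum_le {S : Setup k} {ι : Type*} (P : Finset ι) (X : ι → S.Op) (Bad : ι → S.Conf → Prop)
    {s b δ : ℝ} (hs : 0 ≤ s) (hb : 0 ≤ b) (hδ : 0 ≤ δ)
    (hrow : ∀ p ∈ P, ∀ η ζ ζ', X p η ζ ≠ 0 → X p η ζ' ≠ 0 → ζ = ζ')
    (hgood : ∀ p ∈ P, ∀ η ζ, ¬ Bad p η → ‖X p η ζ‖ ≤ s) (hbad : ∀ p ∈ P, ∀ η ζ, ‖X p η ζ‖ ≤ b)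
    (hrare : ∀ p ∈ P, ((Finset.univ.filter fun η => Bad p η).card : ℝ) ≤ δ * Fintype.card S.Conf) :
    S.hsNorm (∑ p ∈ P, X p) ≤ P.card * (s + b * Real.sqrt δ) := by
  have hΩ : (0 : ℝ) < Fintype.card S.Conf := by exact_mod_cast Fintype.card_pos
  rw [hsNorm_eq]
  refine Real.sqrt_le_iff.2 ⟨by positivity, ?_⟩
  rw [div_le_iff₀ hΩ]
  have h1 : ∀ p ∈ P, ∑ η, ∑ ζ, ‖X p η ζ‖ ^ 2 ≤ (s ^ 2 + b ^ 2 * δ) * Fintype.card S.Conf := by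
    intro p hp
    have h2 : ∀ η, ∑ ζ, ‖X p η ζ‖ ^ 2 ≤ s ^ 2 + b ^ 2 * (if Bad p η then 1 else 0) := by
      intro η
      split_ifs with h
      · refine (sum_norm_sq_le_of_subsingleton _ (hbad p hp η) (hrow p hp η)).trans ?_
        nlinarith [sq_nonneg s]
      · refine (sum_norm_sq_le_of_subsingleton _ (fun ζ => hgood p hp η ζ h) (hrow p hp η)).trans ?_
        linarith
    refine (Finset.sum_le_sum fun η _ => h2 η).trans ?_
    rw [Finset.sum_add_distrib, ← Finset.mul_sum, Finset.sum_boole, Finset.sum_const,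
      Finset.card_univ, nsmul_eq_mul]
    have := mul_le_mul_of_nonneg_left (hrare p hp) (sq_nonneg b)
    linarith
  have hsq : (s ^ 2 + b ^ 2 * δ) ≤ (s + b * Real.sqrt δ) ^ 2 := by
    have h3 : Real.sqrt δ ^ 2 = δ := Real.sq_sqrt hδ
    have h4 : 0 ≤ s * (b * Real.sqrt δ) := by positivity
    nlinarith
  calc ∑ η, ∑ ζ, ‖(∑ p ∈ P, X p) η ζ‖ ^ 2
      ≤ ∑ η, ∑ ζ, (P.card : ℝ) * ∑ p ∈ P, ‖X p η ζ‖ ^ 2 := by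
        refine Finset.sum_le_sum fun η _ => Finset.sum_le_sum fun ζ _ => ?_
        rw [Matrix.sum_apply]
        refine (pow_le_pow_left₀ (norm_nonneg _) (norm_sum_le _ _) 2).trans ?_
        exact sq_sum_le_card_mul_sum_sq
    _ = P.card * ∑ p ∈ P, ∑ η, ∑ ζ, ‖X p η ζ‖ ^ 2 := by
        simp only [← Finset.mul_sum]
        congr 1
        rw [Finset.sum_comm]
        rw [← Finset.sum_comm]
        simp only [Finset.sum_comm (s := P)]
    _ ≤ P.card * ∑ p ∈ P, (s ^ 2 + b ^ 2 * δ) * Fintype.card S.Conf :=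
        mul_le_mul_of_nonneg_left (Finset.sum_le_sum h1) (by positivity)
    _ = P.card ^ 2 * (s ^ 2 + b ^ 2 * δ) * Fintype.card S.Conf := by
        rw [Finset.sum_const, nsmul_eq_mul]; ring
    _ ≤ _ := by
        refine mul_le_mul_of_nonneg_right ?_ hΩ.le
        rw [mul_pow]
        exact mul_le_mul_of_nonneg_left hsq (by positivity)

/-! ### Norm and support of a selection of terms -/

theorem opNorm_select_le {S : Setup k} {yc : Finset S.Pt → (Fin k → ℤ)} {y : Fin k → ℤ}
    (hS : S.Admissible) (hr : 4 ≤ S.r) (hyc : S.Assigns yc) {c : ℝ} (hP : S.PotBounds c)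
    (χ : S.Term → S.Conf → Prop) : S.opNorm (S.select (S.terms yc y) χ) ≤
      (S.terms yc y).card * (2 ^ ballCard k S.r * (2 * c) * S.M ^ S.q) := by
  classical
  refine (S.opNorm_sum_le _ _).trans ?_
  rw [← nsmul_eq_mul]
  refine Finset.sum_le_card_nsmul _ _ _ fun j hj => ?_
  have hM := hS.M_pos
  have hc := hP.one_le
  refine S.opNorm_le_of_isShift (isShift_diagonal_mul_termOp _ j) (by positivity) fun η ζ => ?_
  rw [Matrix.diagonal_mul]
  refine le_trans ?_ (norm_termOp_apply_le hS hr hyc hP hj η ζ)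
  split_ifs <;> simp

theorem comp_congr {S : Setup k} {V : Finset S.Pt} {η ζ : S.Conf} (h : ∀ x ∈ V, η x = ζ x) :
    S.comp V η = S.comp V ζ := by
  have : S.restrict V η = S.restrict V ζ := funext fun x => h x.1 x.2
  rw [comp, comp, this]

theorem loc_select {S : Setup k} {yc : Finset S.Pt → (Fin k → ℤ)} {y : Fin k → ℤ}
    (hr : 4 ≤ S.r) (hyc : S.Assigns yc) {c : ℝ} (hP : S.PotBounds c)
    (p : S.Comp (S.ball y) → Finset S.Pt → Prop) :
    S.Loc (S.ball y)
      (S.select (S.terms yc y) fun j η => p (S.comp (S.ball y) η) (S.termSupp j)) := by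
  classical
  refine Loc.sum fun j hj => Loc.mul (Loc.diagonal _ fun η ζ h => ?_)
    ((loc_termOp hP hj).mono (termDep_subset_ball hr hyc hj))
  simp only [comp_congr h]

/-! ### Commutators with distant operators -/

open Classical in
/-- If the selection of the terms can be read off from a region `U`, except at bad configurations, and
only selects terms inside `U`, then the sum nearly commutes with operators outside `U`. -/
theorem hsNorm_comm_select_le {S : Setup k} {yc : Finset S.Pt → (Fin k → ℤ)} {y : Fin k → ℤ}
    (hS : S.Admissible) (hr : 4 ≤ S.r) (hyc : S.Assigns yc) {c : ℝ} (hP : S.PotBounds c)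
    (χ : S.Term → S.Conf → Prop) {U A : Finset S.Pt} {O : S.Op} (hO : S.Loc A O)
    (hUA : Disjoint U A) {δ : ℝ} (hδ : 0 ≤ δ)
    (hrare : ((Finset.univ.filter fun η : S.Conf => ¬ S.Good y η).card : ℝ) ≤
      δ * Fintype.card S.Conf)
    (hsub : ∀ j ∈ S.terms yc y, ∀ η, S.Good y η → χ j η → S.termDep j ⊆ U)
    (hdep : ∀ j ∈ S.terms yc y, ∀ η η', S.Good y η → S.Good y η' → (∀ x ∈ U, η x = η' x) →
      χ j η' → χ j η) :
    S.hsNorm (S.comm (S.select (S.terms yc y) χ) O) ≤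
      2 * ((S.terms yc y).card * (2 ^ ballCard k S.r * (2 * c) * S.M ^ S.q * Real.sqrt δ)) *
        S.opNorm O := by
  have hM := hS.M_pos
  have hc := hP.one_le
  -- the selection as seen from `U`: it depends on `η` in `U` only and agrees with `χ` at good `η`
  obtain ⟨χ', hχ'⟩ : ∃ χ' : S.Term → S.Conf → Prop, ∀ j η, χ' j η ↔
      ∃ η', S.Good y η' ∧ (∀ x ∈ U, η x = η' x) ∧ χ j η' := ⟨_, fun _ _ => Iff.rfl⟩
  have hχ : ∀ j ∈ S.terms yc y, ∀ η, S.Good y η → (χ' j η ↔ χ j η) := fun j hj η hη =>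
    (hχ' j η).trans ⟨fun ⟨η', h1, h2, h3⟩ => hdep j hj η η' hη h1 h2 h3,
      fun h => ⟨η, hη, fun _ _ => rfl, h⟩⟩
  have hloc : S.Loc U (S.select (S.terms yc y) χ') := by
    refine Loc.sum fun j hj => ?_
    by_cases hj' : ∃ η, S.Good y η ∧ χ j η
    · obtain ⟨η, h1, h2⟩ := hj'
      refine Loc.mul (Loc.diagonal _ fun η ζ h => ?_) ((loc_termOp hP hj).mono (hsub j hj η h1 h2))
      refine if_congr ?_ rfl rfl
      rw [hχ', hχ']
      exact ⟨fun ⟨η', h3, h4, h5⟩ => ⟨η', h3, fun x hx => (h x hx) ▸ h4 x hx, h5⟩,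
        fun ⟨η', h3, h4, h5⟩ => ⟨η', h3, fun x hx => (h x hx).symm ▸ h4 x hx, h5⟩⟩
    · have h0 : (fun η => if χ' j η then (1 : ℂ) else 0) = fun _ => 0 := by
        funext η
        exact if_neg fun h => let ⟨η', h1, _, h2⟩ := (hχ' j η).1 h; hj' ⟨η', h1, h2⟩
      rw [h0, Matrix.diagonal_zero, zero_mul]
      exact Loc.zero S U
  set X : S.Term → S.Op := fun j => Matrix.diagonal (fun η =>
    (if χ j η then (1 : ℂ) else 0) - if χ' j η then (1 : ℂ) else 0) * S.termOp j with hX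
  have hsplit : S.select (S.terms yc y) χ = S.select (S.terms yc y) χ' + ∑ j ∈ S.terms yc y, X j := by
    rw [select, select, ← Finset.sum_add_distrib]
    refine Finset.sum_congr rfl fun j _ => ?_
    rw [hX, ← add_mul, Matrix.diagonal_add]
    congr 2
    funext η
    ring
  have hcomm : S.comm (S.select (S.terms yc y) χ) O = S.comm (∑ j ∈ S.terms yc y, X j) O := by
    have h0 := hloc.mul_comm_of_disjoint hO hUA
    rw [hsplit, Setup.comm, Setup.comm, add_mul, mul_add, h0]
    abel
  have happ : ∀ j η ζ, X j η ζ = ((if χ j η then (1 : ℂ) else 0) - if χ' j η then (1 : ℂ) else 0) *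
      S.termOp j η ζ := fun j η ζ => Matrix.diagonal_mul _ _ _ _
  have hT : 0 ≤ 2 ^ ballCard k S.r * (2 * c) * S.M ^ S.q := by positivity
  have hhs := hsNorm_sum_le (S.terms yc y) X (fun _ η => ¬ S.Good y η) le_rfl hT hδ
    (fun j _ => (isShift_diagonal_mul_termOp _ j).1)
    (fun j hj η ζ hη => by
      simp only [happ, hχ j hj η (not_not.1 hη), sub_self, zero_mul, norm_zero, le_refl])
    (fun j hj η ζ => by
      rw [happ, norm_mul]
      refine le_trans ?_ (norm_termOp_apply_le hS hr hyc hP hj η ζ)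
      have : ‖(if χ j η then (1 : ℂ) else 0) - if χ' j η then (1 : ℂ) else 0‖ ≤ 1 := by
        split_ifs <;> simp
      exact mul_le_of_le_one_left (norm_nonneg _) this)
    (fun _ _ => by convert hrare)
  rw [zero_add] at hhs
  rw [hcomm]
  refine (S.hsNorm_comm_le _ O).trans ?_
  have := S.opNorm_nonneg O
  gcongr

/-! ### Commutators of left and right terms -/

theorem norm_mul_apply_le {S : Setup k} {X Y : S.Op}
    (hX : ∀ η ζ ζ', X η ζ ≠ 0 → X η ζ' ≠ 0 → ζ = ζ') {b b' : ℝ} (hb : ∀ η ζ, ‖X η ζ‖ ≤ b)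
    (hb' : ∀ η ζ, ‖Y η ζ‖ ≤ b') (η ζ : S.Conf) : ‖(X * Y) η ζ‖ ≤ b * b' := by
  have hb0 : 0 ≤ b := (norm_nonneg _).trans (hb η η)
  have hb0' : 0 ≤ b' := (norm_nonneg _).trans (hb' η η)
  rw [Matrix.mul_apply]
  by_cases h : ∃ ξ, X η ξ ≠ 0
  · obtain ⟨ξ, hξ⟩ := h
    rw [Finset.sum_eq_single ξ _ (by simp), norm_mul]
    · exact mul_le_mul (hb _ _) (hb' _ _) (norm_nonneg _) hb0
    · intro ξ' _ hne
      rw [mul_eq_zero]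
      left
      by_contra h'
      exact hne (hX η ξ' ξ h' hξ)
  · push Not at h
    simp only [h, zero_mul, Finset.sum_const_zero, norm_zero]
    positivity

theorem exists_of_mul_apply_ne_zero {S : Setup k} {X Y : S.Op} {η ζ : S.Conf}
    (h : (X * Y) η ζ ≠ 0) : ∃ ξ, X η ξ ≠ 0 ∧ Y ξ ζ ≠ 0 := by
  rw [Matrix.mul_apply] at h
  obtain ⟨ξ, -, hξ⟩ := Finset.exists_ne_zero_of_sum_ne_zero h
  exact ⟨ξ, left_ne_zero_of_mul hξ, right_ne_zero_of_mul hξ⟩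

section Pairs

variable {S : Setup k} {yc : Finset S.Pt → (Fin k → ℤ)} {y y' : Fin k → ℤ} {i j : S.Term}

theorem mem_leftRegion_iff_of_termOp_ne_zero (hr : 4 ≤ S.r) {c : ℝ} (hP : S.PotBounds c)
    (hi : i ∈ S.terms yc y) {η ζ : S.Conf} (h : S.termOp i η ζ ≠ 0) (hη : S.Good y' η)
    (hζ : S.Good y' ζ) {x : S.Pt} (hx : S.Near y' x) :
    x ∈ S.leftRegion (S.comp (S.ball y') η) ↔ x ∈ S.leftRegion (S.comp (S.ball y') ζ) := by
  rcases i with A | ρ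
  · have : η = ζ := by
      by_contra hne
      exact h (S.dPot_apply_ne A hne)
    rw [this]
  · exact mem_leftRegion_iff_of_moveOp_ne_zero (by omega) hP (inr_mem_terms.1 hi).1 h hη hζ hx

/-- A term with its support in the left region has its whole dependence set there. -/
theorem mem_leftRegion_of_termOp_ne_zero (hr : 4 ≤ S.r) (hyc : S.Assigns yc) {c : ℝ}
    (hP : S.PotBounds c) (hi : i ∈ S.terms yc y) {η ζ : S.Conf} (h : S.termOp i η ζ ≠ 0)
    (hL : S.termSupp i ⊆ S.leftRegion (S.comp (S.ball y) η)) {x : S.Pt} (hx : x ∈ S.termDep i) :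
    x ∈ S.leftRegion (S.comp (S.ball y) η) := by
  have hball := termDep_subset_ball hr hyc hi
  obtain ⟨z, hz⟩ := termSupp_nonempty hi
  have hz' := termSupp_subset_termDep hi hz
  rcases i with A | ρ
  · exact hL hx
  · exact (mem_leftRegion_iff_of_mem_act (mem_act_of_moveOp_ne_zero hP (inr_mem_terms.1 hi).1
      ((termSupp_subset_termDep hi).trans hball) h) hx (hball hx) hz' (hball hz')).2 (hL hz)

/-- A move that does not have its support in the left region has its whole dependence set outside. -/
theorem notMem_leftRegion_of_moveOp_ne_zero (hr : 4 ≤ S.r) (hyc : S.Assigns yc) {c : ℝ}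
    (hP : S.PotBounds c) {ρ : S.Pt → ℤ} (hi : Sum.inr ρ ∈ S.terms yc y) {η ζ : S.Conf}
    (h : S.moveOp ρ η ζ ≠ 0) (hL : ¬ S.moveSupp ρ ⊆ S.leftRegion (S.comp (S.ball y) η)) {x : S.Pt}
    (hx : x ∈ S.depSet ρ) : x ∉ S.leftRegion (S.comp (S.ball y) η) := by
  have hball : S.depSet ρ ⊆ S.ball y := termDep_subset_ball hr hyc hi
  obtain ⟨z, hz, hzL⟩ := Finset.not_subset.1 hL
  have hz' := moveSupp_subset_depSet (inr_mem_terms.1 hi).1 hz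
  rwa [mem_leftRegion_iff_of_mem_act (mem_act_of_moveOp_ne_zero hP (inr_mem_terms.1 hi).1
    ((moveSupp_subset_depSet (inr_mem_terms.1 hi).1).trans hball) h) hx (hball hx) hz' (hball hz')]

/-- The configurations excluded when the left term `i` of `y` meets the right term `j` of `y'`: those
that are not good for `y` and `y'`, or cease to be so after one of the terms has acted. -/
def PairBad (S : Setup k) (y y' : Fin k → ℤ) (i j : S.Term) (η : S.Conf) : Prop :=
  ¬ S.Good y η ∨ ¬ S.Good y' η ∨ (∃ ζ, S.termOp i η ζ ≠ 0 ∧ ¬ S.Good y' ζ) ∨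
    ∃ ζ, S.termOp j η ζ ≠ 0 ∧ ¬ S.Good y ζ

open Classical in
theorem card_pairBad_le {b : ℝ}
    (hrare : ∀ y, ((Finset.univ.filter fun η : S.Conf => ¬ S.Good y η).card : ℝ) ≤ b) :
    ((Finset.univ.filter fun η => S.PairBad y y' i j η).card : ℝ) ≤ 4 * b := by
  have himg : ∀ (i : S.Term) (y : Fin k → ℤ),
      (Finset.univ.filter fun η => ∃ ζ, S.termOp i η ζ ≠ 0 ∧ ¬ S.Good y ζ).card ≤
        (Finset.univ.filter fun η : S.Conf => ¬ S.Good y η).card := by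
    intro i y
    choose! f hf using fun (η : S.Conf) (h : ∃ ζ, S.termOp i η ζ ≠ 0 ∧ ¬ S.Good y ζ) => h
    refine Finset.card_le_card_of_injOn f (fun η hη => ?_) fun η hη ξ hξ h => ?_
    · have := hf η (by simpa using hη)
      simpa using this.2
    · have h1 := termOp_apply_ne_zero (hf η (by simpa using hη)).1
      have h2 := termOp_apply_ne_zero (hf ξ (by simpa using hξ)).1
      refine conf_ext fun x => ?_
      have h3 := h1 x
      have h4 := h2 x
      rw [h] at h3
      linarith
  have hsub : (Finset.univ.filter fun η => S.PairBad y y' i j η) ⊆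
      (Finset.univ.filter fun η : S.Conf => ¬ S.Good y η) ∪
        ((Finset.univ.filter fun η : S.Conf => ¬ S.Good y' η) ∪
          ((Finset.univ.filter fun η => ∃ ζ, S.termOp i η ζ ≠ 0 ∧ ¬ S.Good y' ζ) ∪
            Finset.univ.filter fun η => ∃ ζ, S.termOp j η ζ ≠ 0 ∧ ¬ S.Good y ζ)) := by
    intro η hη
    simp only [Finset.mem_union, Finset.mem_filter, Finset.mem_univ, true_and]
    exact (Finset.mem_filter.1 hη).2
  have h1 := (Finset.card_le_card hsub).trans ((Finset.card_union_le _ _).trans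
    (Nat.add_le_add_left ((Finset.card_union_le _ _).trans (Nat.add_le_add_left
      (Finset.card_union_le _ _) _)) _))
  have h2 : ((Finset.univ.filter fun η => S.PairBad y y' i j η).card : ℝ) ≤
      ((Finset.univ.filter fun η : S.Conf => ¬ S.Good y η).card : ℝ) +
      ((Finset.univ.filter fun η : S.Conf => ¬ S.Good y' η).card + (
      (Finset.univ.filter fun η => ∃ ζ, S.termOp i η ζ ≠ 0 ∧ ¬ S.Good y' ζ).card +
      (Finset.univ.filter fun η => ∃ ζ, S.termOp j η ζ ≠ 0 ∧ ¬ S.Good y ζ).card)) := by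
    exact_mod_cast h1
  have h3 : ((Finset.univ.filter fun η => ∃ ζ, S.termOp i η ζ ≠ 0 ∧ ¬ S.Good y' ζ).card : ℝ) ≤
      (Finset.univ.filter fun η : S.Conf => ¬ S.Good y' η).card := by exact_mod_cast himg i y'
  have h4 : ((Finset.univ.filter fun η => ∃ ζ, S.termOp j η ζ ≠ 0 ∧ ¬ S.Good y ζ).card : ℝ) ≤
      (Finset.univ.filter fun η : S.Conf => ¬ S.Good y η).card := by exact_mod_cast himg j y
  linarith [hrare y, hrare y']

/-- The commutator of a left term with a right move vanishes at good rows: if their dependence sets met, the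
common site would belong to the left region and to its complement. -/
theorem comm_termOp_inr_apply (hr : 4 ≤ S.r) (hyc : S.Assigns yc) {c : ℝ} (hP : S.PotBounds c)
    (hi : i ∈ S.terms yc y) {ρ : S.Pt → ℤ} (hj : Sum.inr ρ ∈ S.terms yc y') {η : S.Conf}
    (hη : ¬ S.PairBad y y' i (.inr ρ) η) (hL : S.termSupp i ⊆ S.leftRegion (S.comp (S.ball y) η))
    (hR : ¬ S.moveSupp ρ ⊆ S.leftRegion (S.comp (S.ball y') η)) (ζ : S.Conf) :
    S.comm (S.termOp i) (S.moveOp ρ) η ζ = 0 := by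
  by_cases hdisj : Disjoint (S.termDep i) (S.depSet ρ)
  · exact congrFun (congrFun ((loc_termOp hP hi).comm_eq_zero (loc_termOp hP hj) hdisj) η) ζ
  obtain ⟨x, hxi, hxj⟩ := Finset.not_disjoint_iff.1 hdisj
  have hxy := near_of_mem_termDep hr hyc hi hxi
  have hxy' : S.Near y' x := near_of_mem_termDep hr hyc hj hxj
  unfold PairBad at hη
  push Not at hη
  obtain ⟨h1, h2, h3, h4⟩ := hη
  have hiff := h1.mem_leftRegion_iff h2 hxy hxy'
  have hab : (S.termOp i * S.moveOp ρ) η ζ = 0 := by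
    by_contra hne
    obtain ⟨ξ, hiξ, hjξ⟩ := exists_of_mul_apply_ne_zero hne
    have hst : ∀ z, S.Near y' z → (z ∈ S.leftRegion (S.comp (S.ball y') η) ↔
        z ∈ S.leftRegion (S.comp (S.ball y') ξ)) := fun z hz =>
      mem_leftRegion_iff_of_termOp_ne_zero hr hP hi hiξ h2 (h3 ξ hiξ) hz
    have hR' : ¬ S.moveSupp ρ ⊆ S.leftRegion (S.comp (S.ball y') ξ) := fun h => hR fun z hz =>
      (hst z (near_of_mem_termDep hr hyc hj (termSupp_subset_termDep hj hz))).2 (h hz)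
    exact notMem_leftRegion_of_moveOp_ne_zero hr hyc hP hj hjξ hR' hxj ((hst x hxy').1 (hiff.1
      (mem_leftRegion_of_termOp_ne_zero hr hyc hP hi hiξ hL hxi)))
  have hba : (S.moveOp ρ * S.termOp i) η ζ = 0 := by
    by_contra hne
    obtain ⟨ξ, hjξ, hiξ⟩ := exists_of_mul_apply_ne_zero hne
    have hst : ∀ z, S.Near y z → (z ∈ S.leftRegion (S.comp (S.ball y) η) ↔
        z ∈ S.leftRegion (S.comp (S.ball y) ξ)) := fun z hz =>
      mem_leftRegion_iff_of_termOp_ne_zero hr hP hj hjξ h1 (h4 ξ hjξ) hz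
    have hL' : S.termSupp i ⊆ S.leftRegion (S.comp (S.ball y) ξ) := fun z hz =>
      (hst z (near_of_mem_termDep hr hyc hi (termSupp_subset_termDep hi hz))).1 (hL hz)
    exact notMem_leftRegion_of_moveOp_ne_zero hr hyc hP hj hjξ hR hxj (hiff.1 ((hst x hxy).2
      (mem_leftRegion_of_termOp_ne_zero hr hyc hP hi hiξ hL' hxi)))
  rw [Setup.comm, Matrix.sub_apply, hab, hba, sub_zero]

/-- A left move and a right diagonal term commute, unless the set `A` of the latter meets the support of
the move without being contained in its dependence set. Then `A`, together with any set hosting the move,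
has more than `r` sites, and the product of the two matrix elements is of order `δ ^ r`. -/
theorem norm_comm_moveOp_dPot_le (hS : S.Admissible) (hr : 4 ≤ S.r) (hyc : S.Assigns yc) {c : ℝ}
    (hP : S.PotBounds c) {ρ : S.Pt → ℤ} (hi : Sum.inr ρ ∈ S.terms yc y) {A : Finset S.Pt}
    (hj : Sum.inl A ∈ S.terms yc y') {η : S.Conf} (h1 : S.Good y η) (h2 : S.Good y' η)
    (hL : S.moveSupp ρ ⊆ S.leftRegion (S.comp (S.ball y) η))
    (hR : ¬ A ⊆ S.leftRegion (S.comp (S.ball y') η)) (ζ : S.Conf) :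
    ‖S.comm (S.moveOp ρ) (S.dPot A) η ζ‖ ≤
      2 ^ ballCard k S.r * (2 * c ^ 2 * S.M ^ (2 * (1 + S.γ)) * S.weight ^ S.r) := by
  classical
  have hM := hS.M_pos
  have hc := hP.one_le
  have hw := hS.weight_pos
  have hbound : 0 ≤ 2 * c ^ 2 * S.M ^ (2 * (1 + S.γ)) * S.weight ^ S.r := by positivity
  have hdiag : S.dPot A = Matrix.diagonal fun η => S.dPot A η η := by
    ext ξ ξ'
    by_cases h : ξ = ξ'
    · rw [h, Matrix.diagonal_apply_eq]
    · rw [Matrix.diagonal_apply_ne _ h, S.dPot_apply_ne A h]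
  have hcomm : S.comm (S.moveOp ρ) (S.dPot A) η ζ =
      S.moveOp ρ η ζ * (S.dPot A ζ ζ - S.dPot A η η) := by
    rw [Setup.comm, Matrix.sub_apply, hdiag, Matrix.mul_diagonal, Matrix.diagonal_mul,
      Matrix.diagonal_apply_eq, Matrix.diagonal_apply_eq]
    ring
  rw [hcomm]
  by_cases hne : S.moveOp ρ η ζ = 0
  · rw [hne, zero_mul, norm_zero]
    positivity
  have hshift := moveOp_apply_ne_zero hne
  by_cases hmeet : Disjoint A (S.moveSupp ρ)
  · have heq : ∀ x ∈ A, ζ x = η x := fun x hx =>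
      (eq_of_notMem_moveSupp hshift (Finset.disjoint_left.1 hmeet hx)).symm
    rw [(hP.isLocal_dPot.loc A).congr (fun _ _ => rfl) (fun _ _ => rfl) heq heq, sub_self, mul_zero,
      norm_zero]
    positivity
  have hAdep : ¬ A ⊆ S.depSet ρ := by
    intro h
    obtain ⟨z, hz, hzL⟩ := Finset.not_subset.1 hR
    exact hzL ((h1.mem_leftRegion_iff h2 (near_of_mem_termDep hr hyc hi (h hz))
      (near_of_mem_termDep hr hyc hj hz)).1
        (mem_leftRegion_of_termOp_ne_zero hr hyc hP hi hne hL (h hz)))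
  obtain ⟨hA1, _, hA3, _⟩ := inl_mem_terms.1 hj
  have hcard : ∀ A', S.Hosts A' ρ → S.r < A.card + A'.card := by
    intro A' hA'
    by_contra hle
    refine hAdep fun x hx => mem_depSet.2 ⟨A ∪ A', ⟨Finset.union_subset hA1 hA'.1,
      hA3.union hA'.2.1 fun hd => hmeet (hd.mono_right hA'.2.2.2),
      (Finset.card_union_le _ _).trans (not_lt.1 hle),
      hA'.2.2.2.trans Finset.subset_union_right⟩, Finset.mem_union_left _ hx⟩
  have hA_one : A.card ≠ 1 := by
    intro h
    obtain ⟨x, rfl⟩ := Finset.card_eq_one.1 h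
    refine hAdep ?_
    rw [Finset.disjoint_singleton_left, not_not] at hmeet
    rw [Finset.singleton_subset_iff]
    exact moveSupp_subset_depSet (inr_mem_terms.1 hi).1 hmeet
  rw [moveOp_apply hP hshift, Finset.sum_mul]
  have hterm : ∀ A' ∈ (S.depSet ρ).powerset.filter (fun A' => S.Hosts A' ρ),
      ‖S.gPot A' η ζ * (S.dPot A ζ ζ - S.dPot A η η)‖ ≤
        2 * c ^ 2 * S.M ^ (2 * (1 + S.γ)) * S.weight ^ S.r := by
    intro A' hA'
    have h3 := hP.gPot_le A' η ζ
    have h4 : ‖S.dPot A ζ ζ - S.dPot A η η‖ ≤ 2 * (c * S.M ^ (1 + S.γ) * S.weight ^ A.card) := by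
      refine (norm_sub_le _ _).trans ?_
      have := hP.dPot_le A ζ ζ hA_one
      have := hP.dPot_le A η η hA_one
      linarith
    rw [norm_mul]
    refine (mul_le_mul h3 h4 (norm_nonneg _) (by positivity)).trans ?_
    have h5 : S.weight ^ (A.card + A'.card) ≤ S.weight ^ S.r :=
      pow_le_pow_of_le_one hw.le hS.weight_le_one (hcard A' (Finset.mem_filter.1 hA').2).le
    have h6 : S.M ^ (2 * (1 + S.γ)) = S.M ^ (1 + S.γ) * S.M ^ (1 + S.γ) := by
      rw [← Real.rpow_add hM]
      congr 1
      ring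
    calc c * S.M ^ (1 + S.γ) * S.weight ^ A'.card * (2 * (c * S.M ^ (1 + S.γ) * S.weight ^ A.card))
        = 2 * c ^ 2 * S.M ^ (2 * (1 + S.γ)) * S.weight ^ (A.card + A'.card) := by
          rw [h6, pow_add]; ring
      _ ≤ _ := by gcongr
  refine (norm_sum_le_of_le _ hterm).trans ?_
  rw [Finset.sum_const, nsmul_eq_mul]
  refine mul_le_mul_of_nonneg_right ?_ hbound
  exact le_trans (by exact_mod_cast Finset.card_filter_le _ _) (card_hosts_le hr hyc hi)

end Pairs

open Classical in
/-- The left terms of `y` and the right terms of `y'` nearly commute. -/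
theorem hsNorm_comm_zLeft_zRight_le {S : Setup k} {yc : Finset S.Pt → (Fin k → ℤ)}
    (hS : S.Admissible) (hr : 4 ≤ S.r) (hyc : S.Assigns yc) {c : ℝ} (hP : S.PotBounds c)
    {δ : ℝ} (hδ : 0 ≤ δ)
    (hrare : ∀ y, ((Finset.univ.filter fun η : S.Conf => ¬ S.Good y η).card : ℝ) ≤
      δ * Fintype.card S.Conf) (y y' : Fin k → ℤ) :
    S.hsNorm (S.comm (S.zLeft yc y) (S.zRight yc y')) ≤
      ((S.terms yc y).card * (S.terms yc y').card : ℕ) *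
        (2 ^ ballCard k S.r * (2 * c ^ 2 * S.M ^ (2 * (1 + S.γ)) * S.weight ^ S.r) +
          2 * (2 ^ ballCard k S.r * (2 * c) * S.M ^ S.q) ^ 2 * Real.sqrt (4 * δ)) := by
  have hM := hS.M_pos
  have hc := hP.one_le
  have hw := hS.weight_pos
  set s := 2 ^ ballCard k S.r * (2 * c ^ 2 * S.M ^ (2 * (1 + S.γ)) * S.weight ^ S.r) with hs
  set b := 2 ^ ballCard k S.r * (2 * c) * S.M ^ S.q with hb
  have hs0 : 0 ≤ s := by positivity
  have hb0 : 0 ≤ b := by positivity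
  obtain ⟨χ, hχ⟩ : ∃ χ : S.Term → S.Conf → Prop, ∀ i η, χ i η ↔
      S.termSupp i ⊆ S.leftRegion (S.comp (S.ball y) η) := ⟨_, fun _ _ => Iff.rfl⟩
  obtain ⟨χ', hχ'⟩ : ∃ χ' : S.Term → S.Conf → Prop, ∀ j η, χ' j η ↔
      ¬ S.termSupp j ⊆ S.leftRegion (S.comp (S.ball y') η) := ⟨_, fun _ _ => Iff.rfl⟩
  have hzL : S.zLeft yc y = S.select (S.terms yc y) χ := by
    rw [zLeft_eq hP]
    congr 1
    funext i η
    exact (propext (hχ i η)).symm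
  have hzR : S.zRight yc y' = S.select (S.terms yc y') χ' := by
    rw [zRight_eq hP]
    congr 1
    funext i η
    exact (propext (hχ' i η)).symm
  set X : S.Term → S.Op := fun i =>
    Matrix.diagonal (fun η => if χ i η then (1 : ℂ) else 0) * S.termOp i with hX
  set Y : S.Term → S.Op := fun j =>
    Matrix.diagonal (fun η => if χ' j η then (1 : ℂ) else 0) * S.termOp j with hY
  have hXa : ∀ i η ζ, X i η ζ = (if χ i η then (1 : ℂ) else 0) * S.termOp i η ζ := fun i η ζ =>
    Matrix.diagonal_mul _ _ _ _
  have hYa : ∀ i η ζ, Y i η ζ = (if χ' i η then (1 : ℂ) else 0) * S.termOp i η ζ := fun i η ζ =>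
    Matrix.diagonal_mul _ _ _ _
  have hsum : S.comm (S.zLeft yc y) (S.zRight yc y') =
      ∑ p ∈ S.terms yc y ×ˢ S.terms yc y', S.comm (X p.1) (Y p.2) := by
    rw [hzL, hzR, select, select, Setup.comm, Finset.sum_mul_sum, Finset.sum_mul_sum,
      Finset.sum_comm (s := S.terms yc y'), ← Finset.sum_sub_distrib, Finset.sum_product]
    refine Finset.sum_congr rfl fun i _ => ?_
    rw [← Finset.sum_sub_distrib]
    rfl
  have hXb : ∀ i ∈ S.terms yc y, ∀ η ζ, ‖X i η ζ‖ ≤ b := fun i hi η ζ => by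
    refine le_trans ?_ (norm_termOp_apply_le hS hr hyc hP hi η ζ)
    rw [hXa]
    split_ifs <;> simp
  have hYb : ∀ i ∈ S.terms yc y', ∀ η ζ, ‖Y i η ζ‖ ≤ b := fun i hi η ζ => by
    refine le_trans ?_ (norm_termOp_apply_le hS hr hyc hP hi η ζ)
    rw [hYa]
    split_ifs <;> simp
  have hshift : ∀ i j η ζ, S.comm (X i) (Y j) η ζ ≠ 0 → ∀ x,
      ((ζ x : ℕ) : ℤ) = ((η x : ℕ) : ℤ) + S.termShift i x + S.termShift j x := by
    intro i j η ζ h x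
    rw [Setup.comm, Matrix.sub_apply] at h
    have h' : (X i * Y j) η ζ ≠ 0 ∨ (Y j * X i) η ζ ≠ 0 := by
      by_contra hcon
      push Not at hcon
      rw [hcon.1, hcon.2, sub_zero] at h
      exact h rfl
    rcases h' with h' | h'
    · obtain ⟨ξ, h1, h2⟩ := exists_of_mul_apply_ne_zero h'
      rw [hXa] at h1
      rw [hYa] at h2
      rw [termOp_apply_ne_zero (right_ne_zero_of_mul h2) x,
        termOp_apply_ne_zero (right_ne_zero_of_mul h1) x]
    · obtain ⟨ξ, h1, h2⟩ := exists_of_mul_apply_ne_zero h'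
      rw [hYa] at h1
      rw [hXa] at h2
      rw [termOp_apply_ne_zero (right_ne_zero_of_mul h2) x,
        termOp_apply_ne_zero (right_ne_zero_of_mul h1) x]
      ring
  have hgood : ∀ i ∈ S.terms yc y, ∀ j ∈ S.terms yc y', ∀ η ζ, ¬ S.PairBad y y' i j η →
      ‖S.comm (X i) (Y j) η ζ‖ ≤ s := by
    intro i hi j hj η ζ hη
    have hη' := hη
    unfold PairBad at hη'
    push Not at hη'
    obtain ⟨h1, h2, h3, h4⟩ := hη'
    -- one term does not change the selection of the other
    have hst : ∀ ξ, S.termOp i η ξ ≠ 0 → (χ' j ξ ↔ χ' j η) := by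
      intro ξ hξ
      rw [hχ', hχ', not_iff_not]
      refine forall_congr' fun x => forall_congr' fun hx => ?_
      exact (mem_leftRegion_iff_of_termOp_ne_zero hr hP hi hξ h2 (h3 ξ hξ)
        (near_of_mem_termDep hr hyc hj (termSupp_subset_termDep hj hx))).symm
    have hst' : ∀ ξ, S.termOp j η ξ ≠ 0 → (χ i ξ ↔ χ i η) := by
      intro ξ hξ
      rw [hχ, hχ]
      refine forall_congr' fun x => forall_congr' fun hx => ?_
      exact (mem_leftRegion_iff_of_termOp_ne_zero hr hP hj hξ h1 (h4 ξ hξ)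
        (near_of_mem_termDep hr hyc hi (termSupp_subset_termDep hi hx))).symm
    have hfactor : S.comm (X i) (Y j) η ζ = ((if χ i η then (1 : ℂ) else 0) *
        if χ' j η then (1 : ℂ) else 0) * S.comm (S.termOp i) (S.termOp j) η ζ := by
      rw [Setup.comm, Setup.comm, Matrix.sub_apply, Matrix.sub_apply, Matrix.mul_apply,
        Matrix.mul_apply, Matrix.mul_apply, Matrix.mul_apply, mul_sub, Finset.mul_sum, Finset.mul_sum]
      congr 1
      · refine Finset.sum_congr rfl fun ξ _ => ?_
        rw [hXa, hYa]
        by_cases hξ : S.termOp i η ξ = 0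
        · rw [hξ]; ring
        · simp only [hst ξ hξ]; ring
      · refine Finset.sum_congr rfl fun ξ _ => ?_
        rw [hXa, hYa]
        by_cases hξ : S.termOp j η ξ = 0
        · rw [hξ]; ring
        · simp only [hst' ξ hξ]; ring
    rw [hfactor]
    by_cases hsel : χ i η ∧ χ' j η
    swap
    · have h0 : ((if χ i η then (1 : ℂ) else 0) * if χ' j η then (1 : ℂ) else 0) = 0 := by
        rcases not_and_or.1 hsel with h | h <;> simp [h]
      rw [h0, zero_mul, norm_zero]
      exact hs0
    rw [if_pos hsel.1, if_pos hsel.2, one_mul, one_mul]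
    have hL := (hχ i η).1 hsel.1
    have hR := (hχ' j η).1 hsel.2
    rcases j with A | ρ'
    · rcases i with A' | ρ
      · have h0 : S.comm (S.termOp (.inl A')) (S.termOp (.inl A)) = 0 := by
          change S.comm (S.dPot A') (S.dPot A) = 0
          rw [Setup.comm, dPot, diagPart, diagPart, Matrix.diagonal_mul_diagonal,
            Matrix.diagonal_mul_diagonal, sub_eq_zero]
          congr 1
          funext ξ
          exact mul_comm _ _
        rw [h0, Matrix.zero_apply, norm_zero]
        exact hs0
      · exact norm_comm_moveOp_dPot_le hS hr hyc hP hi hj h1 h2 hL hR ζ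
    · have h0 := comm_termOp_inr_apply hr hyc hP hi hj hη hL hR ζ
      change ‖S.comm (S.termOp i) (S.moveOp ρ') η ζ‖ ≤ s
      rw [h0, norm_zero]
      exact hs0
  rw [hsum, ← Finset.card_product]
  refine hsNorm_sum_le _ _ (fun p η => S.PairBad y y' p.1 p.2 η) hs0 (by positivity) (by positivity)
    (fun p _ η ζ ζ' h h' => conf_ext fun x => ?_) (fun p hp η ζ h => ?_) (fun p hp η ζ => ?_)
    fun p _ => ?_
  · rw [hshift _ _ _ _ h, hshift _ _ _ _ h']
  · exact hgood p.1 (Finset.mem_product.1 hp).1 p.2 (Finset.mem_product.1 hp).2 η ζ h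
  · obtain ⟨hp1, hp2⟩ := Finset.mem_product.1 hp
    rw [Setup.comm, Matrix.sub_apply]
    refine (norm_sub_le _ _).trans ?_
    have h1 := norm_mul_apply_le (isShift_diagonal_mul_termOp _ p.1).1 (hXb p.1 hp1) (hYb p.2 hp2) η ζ
    have h2 := norm_mul_apply_le (isShift_diagonal_mul_termOp _ p.2).1 (hYb p.2 hp2) (hXb p.1 hp1) η ζ
    linarith
  · rw [mul_assoc]
    convert card_pairBad_le hrare

/-! ### Commutators with operators far to the left or right -/

section Distant

variable {S : Setup k} {yc : Finset S.Pt → (Fin k → ℤ)} {y : Fin k → ℤ}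

theorem Good.abs_sub_le {η : S.Conf} (h : S.Good y η) {x z : S.Pt} (hxz : S.Cl (S.ball y) η x z) :
    8 * |x.1 0 - z.1 0| ≤ (S.r : ℤ) ^ 2 := by
  have h1 := h x z hxz 0
  have h2 : 0 ≤ (k : ℤ) * |x.1 0 - z.1 0| := by positivity
  nlinarith

theorem abs_sub_le_of_mem_termDep {j : S.Term} (hj : j ∈ S.terms yc y) {x w : S.Pt}
    (hx : x ∈ S.termDep j) (hw : w ∈ S.termSupp j) : |x.1 0 - w.1 0| ≤ S.r := by
  have h := (abs_apply_le_eucl (x.1 - w.1) 0).trans (eucl_sub_le_of_mem_termDep hj hx hw)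
  have h' : ((|x.1 0 - w.1 0| : ℤ) : ℝ) ≤ ((S.r : ℤ) : ℝ) := by
    push_cast
    simpa using h
  exact_mod_cast h'

theorem four_mul_le_sq (hr : 4 ≤ S.r) : 4 * (S.r : ℤ) ≤ (S.r : ℤ) ^ 2 := by
  have : (4 : ℤ) ≤ S.r := by exact_mod_cast hr
  nlinarith

open Classical in
theorem hsNorm_comm_zLeft_le (hS : S.Admissible) (hr : 4 ≤ S.r) (hyc : S.Assigns yc) {c : ℝ}
    (hP : S.PotBounds c) {δ : ℝ} (hδ : 0 ≤ δ)
    (hrare : ((Finset.univ.filter fun η : S.Conf => ¬ S.Good y η).card : ℝ) ≤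
      δ * Fintype.card S.Conf) {A : Finset S.Pt} {O : S.Op} (hO : S.Loc A O)
    (hA : ∀ x ∈ A, (S.r : ℤ) ^ 2 < 2 * (x.1 0 - S.a)) :
    S.hsNorm (S.comm (S.zLeft yc y) O) ≤
      2 * ((S.terms yc y).card * (2 ^ ballCard k S.r * (2 * c) * S.M ^ S.q * Real.sqrt δ)) *
        S.opNorm O := by
  have hr2 := four_mul_le_sq hr
  rw [zLeft_eq hP]
  refine hsNorm_comm_select_le hS hr hyc hP _
    (U := Finset.univ.filter fun x : S.Pt => 2 * (x.1 0 - S.a) ≤ (S.r : ℤ) ^ 2) hO ?_ hδ hrare ?_ ?_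
  · refine Finset.disjoint_left.2 fun x hx hxA => ?_
    have h1 := (Finset.mem_filter.1 hx).2
    have h2 := hA x hxA
    omega
  · intro j hj η hη hL x hx
    refine Finset.mem_filter.2 ⟨Finset.mem_univ _, ?_⟩
    obtain ⟨w, hw⟩ := termSupp_nonempty hj
    obtain ⟨_, z, hz, hza⟩ := mem_leftRegion.1 (hL hw)
    have h1 := abs_le.1 (abs_sub_le_of_mem_termDep hj hx hw)
    have h2 := hη.abs_sub_le hz
    have h3 := le_abs_self (w.1 0 - z.1 0)
    omega
  · intro j hj η η' hη hη' hU hL w hw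
    obtain ⟨hwV, z, hz, hza⟩ := mem_leftRegion.1 (hL hw)
    refine mem_leftRegion.2 ⟨hwV, z, ?_, hza⟩
    refine cl_transfer (U := (Finset.univ.filter fun x : S.Pt =>
      2 * (x.1 0 - S.a) ≤ (S.r : ℤ) ^ 2) ∩ S.ball y) Finset.inter_subset_right
      (fun x hx => (hU x (Finset.mem_inter.1 hx).1).symm) (fun v hv => ?_) hz
    refine Finset.mem_inter.2 ⟨Finset.mem_filter.2 ⟨Finset.mem_univ _, ?_⟩, mem_ball_of_cl hwV hv⟩
    have h1 := hη'.abs_sub_le hv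
    have h2 := hη'.abs_sub_le hz
    have h3 := neg_abs_le (w.1 0 - v.1 0)
    have h4 := le_abs_self (w.1 0 - z.1 0)
    omega

open Classical in
theorem hsNorm_comm_zRight_le (hS : S.Admissible) (hr : 4 ≤ S.r) (hyc : S.Assigns yc) {c : ℝ}
    (hP : S.PotBounds c) {δ : ℝ} (hδ : 0 ≤ δ)
    (hrare : ((Finset.univ.filter fun η : S.Conf => ¬ S.Good y η).card : ℝ) ≤
      δ * Fintype.card S.Conf) {A : Finset S.Pt} {O : S.Op} (hO : S.Loc A O)
    (hA : ∀ x ∈ A, (S.r : ℤ) ^ 2 < 2 * (S.a - x.1 0)) :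
    S.hsNorm (S.comm (S.zRight yc y) O) ≤
      2 * ((S.terms yc y).card * (2 ^ ballCard k S.r * (2 * c) * S.M ^ S.q * Real.sqrt δ)) *
        S.opNorm O := by
  have hr2 := four_mul_le_sq hr
  have hball : ∀ j ∈ S.terms yc y, ∀ w ∈ S.termSupp j, w ∈ S.ball y := fun j hj w hw =>
    termDep_subset_ball hr hyc hj (termSupp_subset_termDep hj hw)
  have hpos : ∀ (η : S.Conf) (w : S.Pt), w ∈ S.ball y →
      w ∉ S.leftRegion (S.comp (S.ball y) η) → S.a < w.1 0 := by
    intro η w hwV hw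
    by_contra hle
    exact hw (mem_leftRegion.2 ⟨hwV, w, .refl, not_lt.1 hle⟩)
  rw [zRight_eq hP]
  refine hsNorm_comm_select_le hS hr hyc hP _
    (U := Finset.univ.filter fun x : S.Pt => 2 * (S.a - x.1 0) ≤ (S.r : ℤ) ^ 2) hO ?_ hδ hrare ?_ ?_
  · refine Finset.disjoint_left.2 fun x hx hxA => ?_
    have h1 := (Finset.mem_filter.1 hx).2
    have h2 := hA x hxA
    omega
  · intro j hj η hη hL x hx
    refine Finset.mem_filter.2 ⟨Finset.mem_univ _, ?_⟩
    obtain ⟨w, hw, hwL⟩ := Finset.not_subset.1 hL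
    have h1 := abs_le.1 (abs_sub_le_of_mem_termDep hj hx hw)
    have h2 := hpos η w (hball j hj w hw) hwL
    omega
  · intro j hj η η' hη hη' hU hR hL
    obtain ⟨w, hw, hwL⟩ := Finset.not_subset.1 hR
    obtain ⟨hwV, z, hz, hza⟩ := mem_leftRegion.1 (hL hw)
    refine hwL (mem_leftRegion.2 ⟨hwV, z, ?_, hza⟩)
    refine cl_transfer (U := (Finset.univ.filter fun x : S.Pt =>
      2 * (S.a - x.1 0) ≤ (S.r : ℤ) ^ 2) ∩ S.ball y) Finset.inter_subset_right
      (fun x hx => hU x (Finset.mem_inter.1 hx).1) (fun v hv => ?_) hz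
    refine Finset.mem_inter.2 ⟨Finset.mem_filter.2 ⟨Finset.mem_univ _, ?_⟩, mem_ball_of_cl hwV hv⟩
    have h1 := hη.abs_sub_le hv
    have h2 := hpos η' w hwV hwL
    have h3 := le_abs_self (w.1 0 - v.1 0)
    have h4 := abs_nonneg (w.1 0 - v.1 0)
    omega

end Distant

/-! ### Choice of the constants -/

/-- The rate of the exponential smallness in `r`: from the order of perturbation theory reached by two sets
with more than `r` sites, and from the rarity of bad configurations, whose `r / (32 d)` resonances enter
the Hilbert–Schmidt norm through a square root. -/
noncomputable def rate (k : ℕ) (q γ : ℝ) : ℝ := min (γ / 3 ^ (k + 1)) (gap q γ / (64 * (k + 1)))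

theorem rate_pos {k : ℕ} {q γ : ℝ} (hq : 2 < q) (hγ : 0 < γ) (hγq : γ < q - 2) : 0 < rate k q γ := by
  have := gap_pos hq hγq
  exact lt_min (by positivity) (by positivity)

/-- The rounding in `r / (32 d)` costs a factor `M ^ (gap q γ / 2)`. -/
theorem gap_mul_div_le {k : ℕ} {q γ : ℝ} (hq : 2 < q) (hγq : γ < q - 2) (r : ℕ) :
    -gap q γ * (r / (32 * (k + 1)) : ℕ) / 2 ≤ gap q γ / 2 - rate k q γ * r := by
  have hg := gap_pos hq hγq
  set n := r / (32 * (k + 1)) with hn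
  have h1 : (r : ℝ) ≤ 32 * (k + 1) * (n + 1) := by
    have := Nat.lt_div_mul_add (a := r) (b := 32 * (k + 1)) (by omega)
    have h2 : r ≤ 32 * (k + 1) * (n + 1) := by rw [mul_add, mul_one, mul_comm]; exact this.le
    exact_mod_cast h2
  have h3 : rate k q γ * r ≤ gap q γ / (64 * (k + 1)) * (32 * (k + 1) * (n + 1)) :=
    mul_le_mul (min_le_right _ _) h1 (by positivity) (by positivity)
  have h4 : gap q γ / (64 * ((k : ℝ) + 1)) * (32 * (k + 1) * (n + 1)) = gap q γ * (n + 1) / 2 := by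
    field_simp
    ring
  linarith

end Setup
end ResonantSplitting

open ResonantSplitting Setup in
theorem proposition5 (k : ℕ) (q γ : ℝ) (hq : 2 < q) (hγ : 0 < γ) (hγq : γ < q - 2) :
    ∃ C c : ℝ, 0 < C ∧ 0 < c ∧ ∃ r₀ : ℕ, ∀ r : ℕ, r₀ ≤ r →
      ∃ Cr M₀ : ℝ, 0 < Cr ∧ 0 < M₀ ∧ ∀ M : ℝ, M₀ ≤ M →
        ∀ g₁ g₂ : ℝ, |g₁| ≤ 1 → |g₂| ≤ 1 →
          ∀ (a : ℤ) (Λ : Finset (ResonantSplitting.Site k)),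
            let S : ResonantSplitting.Setup k := ⟨q, γ, g₁, g₂, M, r, a, Λ⟩
            ∀ yc : Finset S.Pt → (Fin k → ℤ), S.Assigns yc →
              ∀ y : Fin k → ℤ,
                -- supports and norms
                (S.SupportedIn (S.ball y) (S.zLeft yc y) ∧
                  S.SupportedIn (S.ball y) (S.zRight yc y) ∧
                  S.opNorm (S.zLeft yc y) ≤ Cr * M ^ C ∧
                  S.opNorm (S.zRight yc y) ≤ Cr * M ^ C) ∧
                -- left and right parts commute up to a sparse term
                (∀ y' : Fin k → ℤ,
                  S.hsNorm (S.comm (S.zLeft yc y) (S.zRight yc y')) ≤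
                    Cr * M ^ (C - c * r)) ∧
                -- the left part does not reach far to the right
                (∀ (A : Finset S.Pt) (O : S.Op), S.SupportedIn A O →
                  (∀ x ∈ A, (a : ℝ) + (r : ℝ) ^ 2 / 2 < (x.1 0 : ℝ)) →
                  S.hsNorm (S.comm (S.zLeft yc y) O) ≤ Cr * M ^ (C - c * r) * S.opNorm O) ∧
                -- the right part does not reach far to the left
                (∀ (A : Finset S.Pt) (O : S.Op), S.SupportedIn A O →
                  (∀ x ∈ A, (x.1 0 : ℝ) < (a : ℝ) - (r : ℝ) ^ 2 / 2) →
                  S.hsNorm (S.comm (S.zRight yc y) O) ≤ Cr * M ^ (C - c * r) * S.opNorm O) := by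
  classical
  have hg := gap_pos hq hγq
  -- `M ^ (2 * q)` bounds products of two terms, `M ^ (2 * (1 + γ))` products of two resonant ones
  refine ⟨2 * q + 2 * (1 + γ) + gap q γ, rate k q γ, by positivity, rate_pos hq hγ hγq, 4,
    fun r hr => ?_⟩
  obtain ⟨c, hc⟩ := exists_potBounds k r
  obtain ⟨B, hB, hrare⟩ := exists_card_not_good_le k q γ hq r
  have hc1 : 1 ≤ c := (hc ⟨q, γ, 0, 0, 1, r, 0, ∅⟩
    ⟨hq, hγ, hγq, le_rfl, by simp, by simp⟩ rfl).one_le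
  set C := 2 * q + 2 * (1 + γ) + gap q γ with hC
  set P : ℝ := 2 ^ ballCard k r with hPdef
  set nT : ℝ := 2 ^ ballCard k r + (2 * r + 1) ^ ballCard k r with hnT
  have hP0 : 0 ≤ P := by positivity
  have hnT0 : 0 ≤ nT := by positivity
  set b₀ := P * (2 * c) with hb₀
  have hb₀0 : 0 ≤ b₀ := by positivity
  set e := Real.sqrt B with he
  have he0 : 0 ≤ e := Real.sqrt_nonneg _
  refine ⟨nT * b₀ + nT * nT * (P * (2 * c ^ 2) + 2 * b₀ ^ 2 * (2 * e)) + 2 * (nT * (b₀ * e)) + 1, 1,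
    by positivity, one_pos, ?_⟩
  intro M hM g₁ g₂ hg₁ hg₂ a Λ S yc hyc y
  have hS : S.Admissible := ⟨hq, hγ, hγq, hM, hg₁, hg₂⟩
  have hpot := hc S hS rfl
  have hM0 : 0 < M := hS.M_pos
  have hr' : 4 ≤ S.r := hr
  set n : ℕ := r / (32 * (k + 1)) with hn
  set δ := B * M ^ (-gap q γ * n) with hδ
  have hδ0 : 0 ≤ δ := by positivity
  have hbad : ∀ y, ((Finset.univ.filter fun η : S.Conf => ¬ S.Good y η).card : ℝ) ≤
      δ * Fintype.card S.Conf := by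
    intro y
    have := hrare S hS rfl rfl rfl y
    convert this
  have hsqrt : Real.sqrt δ = e * M ^ (-gap q γ * n / 2) := by
    rw [hδ, Real.sqrt_mul hB, Real.sqrt_eq_rpow (M ^ _), ← Real.rpow_mul hM0.le]
    congr 2
    ring
  have hsqrt4 : Real.sqrt (4 * δ) = 2 * Real.sqrt δ := by
    rw [Real.sqrt_mul (by norm_num), show (4 : ℝ) = 2 ^ 2 by norm_num,
      Real.sqrt_sq (by norm_num)]
  have hcard : ∀ y, ((S.terms yc y).card : ℝ) ≤ nT := by
    intro y
    have := card_terms_le (y := y) hr' hyc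
    rw [hnT]
    exact_mod_cast this
  have hexp := gap_mul_div_le (k := k) hq hγq r
  set T := M ^ (C - rate k q γ * r) with hT
  have hT0 : 0 ≤ T := by positivity
  -- the three powers of `M` that occur
  have hpow₁ : M ^ q * M ^ (-gap q γ * n / 2) ≤ T := by
    rw [← Real.rpow_add hM0]
    exact Real.rpow_le_rpow_of_exponent_le hM (by rw [hC]; linarith)
  have hpow₂ : (M ^ q) ^ 2 * M ^ (-gap q γ * n / 2) ≤ T := by
    rw [← Real.rpow_natCast, ← Real.rpow_mul hM0.le, ← Real.rpow_add hM0]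
    exact Real.rpow_le_rpow_of_exponent_le hM (by rw [hC]; push_cast; linarith)
  have hpow₃ : M ^ (2 * (1 + γ)) * S.weight ^ r ≤ T := by
    rw [S.weight_pow hM0.le, ← Real.rpow_add hM0]
    refine Real.rpow_le_rpow_of_exponent_le hM ?_
    have h1 : rate k q γ * r ≤ γ / 3 ^ (k + 1) * r :=
      mul_le_mul_of_nonneg_right (min_le_left _ _) (by positivity)
    have h2 : -S.γ * r / 3 ^ (k + 1) = -(γ / 3 ^ (k + 1) * r) := by
      change -γ * r / 3 ^ (k + 1) = _
      ring
    rw [h2, hC]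
    linarith
  have hnorm : ∀ χ, S.opNorm (S.select (S.terms yc y) χ) ≤
      (nT * b₀ + nT * nT * (P * (2 * c ^ 2) + 2 * b₀ ^ 2 * (2 * e)) + 2 * (nT * (b₀ * e)) + 1) *
        M ^ C := by
    intro χ
    refine (opNorm_select_le hS hr' hyc hpot χ).trans ?_
    have h1 : M ^ q ≤ M ^ C := Real.rpow_le_rpow_of_exponent_le hM (by rw [hC]; linarith)
    calc ((S.terms yc y).card : ℝ) * (b₀ * M ^ q) ≤ nT * (b₀ * M ^ C) := by
          gcongr
          exact hcard y
      _ = nT * b₀ * M ^ C := by ring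
      _ ≤ _ := by
          refine mul_le_mul_of_nonneg_right ?_ (by positivity)
          have h2 : 0 ≤ nT * nT * (P * (2 * c ^ 2) + 2 * b₀ ^ 2 * (2 * e)) := by positivity
          have h3 : 0 ≤ 2 * (nT * (b₀ * e)) := by positivity
          linarith
  have hfar : ∀ O : S.Op, 2 * (((S.terms yc y).card : ℝ) * (b₀ * M ^ q * Real.sqrt δ)) *
      S.opNorm O ≤ (nT * b₀ + nT * nT * (P * (2 * c ^ 2) + 2 * b₀ ^ 2 * (2 * e)) +
        2 * (nT * (b₀ * e)) + 1) * T * S.opNorm O := by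
    intro O
    refine mul_le_mul_of_nonneg_right ?_ (S.opNorm_nonneg O)
    calc 2 * (((S.terms yc y).card : ℝ) * (b₀ * M ^ q * Real.sqrt δ))
        = 2 * ((S.terms yc y).card * (b₀ * e * (M ^ q * M ^ (-gap q γ * n / 2)))) := by
          rw [hsqrt]; ring
      _ ≤ 2 * (nT * (b₀ * e * T)) := by
          gcongr
          exact hcard y
      _ = 2 * (nT * (b₀ * e)) * T := by ring
      _ ≤ _ := by
          refine mul_le_mul_of_nonneg_right ?_ hT0
          have h2 : 0 ≤ nT * nT * (P * (2 * c ^ 2) + 2 * b₀ ^ 2 * (2 * e)) := by positivity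
          have h3 : 0 ≤ nT * b₀ := by positivity
          linarith
  refine ⟨⟨?_, ?_, ?_, ?_⟩, fun y' => ?_, fun A O hO hA => ?_, fun A O hO hA => ?_⟩
  · rw [zLeft_eq hpot]
    exact (loc_select hr' hyc hpot fun μ A => A ⊆ S.leftRegion μ).supportedIn
  · rw [zRight_eq hpot]
    exact (loc_select hr' hyc hpot fun μ A => ¬ A ⊆ S.leftRegion μ).supportedIn
  · rw [zLeft_eq hpot]
    exact hnorm _
  · rw [zRight_eq hpot]
    exact hnorm _
  · refine (hsNorm_comm_zLeft_zRight_le hS hr' hyc hpot hδ0 hbad y y').trans ?_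
    rw [hsqrt4, hsqrt]
    calc (((S.terms yc y).card * (S.terms yc y').card : ℕ) : ℝ) *
          (P * (2 * c ^ 2 * M ^ (2 * (1 + γ)) * S.weight ^ r) +
            2 * (b₀ * M ^ q) ^ 2 * (2 * (e * M ^ (-gap q γ * n / 2))))
        = ((S.terms yc y).card : ℝ) * (S.terms yc y').card *
          (P * (2 * c ^ 2) * (M ^ (2 * (1 + γ)) * S.weight ^ r) +
            2 * b₀ ^ 2 * (2 * e) * ((M ^ q) ^ 2 * M ^ (-gap q γ * n / 2))) := by
          push_cast; ring
      _ ≤ nT * nT * (P * (2 * c ^ 2) * T + 2 * b₀ ^ 2 * (2 * e) * T) := by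
          have hw := hS.weight_pos
          gcongr
          · exact hcard y
          · exact hcard y'
      _ = nT * nT * (P * (2 * c ^ 2) + 2 * b₀ ^ 2 * (2 * e)) * T := by ring
      _ ≤ _ := by
          refine mul_le_mul_of_nonneg_right ?_ hT0
          have h2 : 0 ≤ 2 * (nT * (b₀ * e)) := by positivity
          have h3 : 0 ≤ nT * b₀ := by positivity
          linarith
  · refine (hsNorm_comm_zLeft_le hS hr' hyc hpot hδ0 (hbad y) hO.loc fun x hx => ?_).trans (hfar O)
    have h1 := hA x hx
    have h2 : ((r : ℤ) ^ 2 : ℝ) < ((2 * (x.1 0 - a) : ℤ) : ℝ) := by push_cast; linarith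
    exact_mod_cast h2
  · refine (hsNorm_comm_zRight_le hS hr' hyc hpot hδ0 (hbad y) hO.loc fun x hx => ?_).trans (hfar O)
    have h1 := hA x hx
    have h2 : ((r : ℤ) ^ 2 : ℝ) < ((2 * (a - x.1 0) : ℤ) : ℝ) := by push_cast; linarith
    exact_mod_cast h2
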